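/- **Conventions.** A signed graph $\Sigma=(\Gamma,\sigma)$ is a finite graph $\Gamma=(V,E)$, loops and multiple edges allowed, with $\sigma:E\to\{+1,-1\}$. The degree $d(v)$ counts loops twice; the negative degree $d^-(v)$ is the degree of $v$ in the subgraph of all vertices and all negative edges. A path may be open (distinct vertices, length $0$ allowed) or closed (positive length, one terminus, no other repetition of vertices or edges); it is nontrivial if it has positive length. A circle is the graph of a closed path; it has no terminus. The internal vertices of a path or circle are those that are not termini; terminal edges are those incident with a terminus. The sign of a path or circle is the product of its edge signs; $\Sigma$ is balanced if all its circles are positive. An isthmus is an edge whose deletion separates its ends. A block is a maximal connected subgraph any two of whose edges lie in a common circle; it is nontrivial if it contains a circle (a loop does). A megablock is a maximal connected union of one or more nontrivial blocks. The naturally vertex-signed line graph of a signed simple graph is the line graph of $\Gamma$ with vertices signed by $\sigma$; it is consistent if in each of its circles the product of the vertex signs is positive. **Property 2.** For every vertex $v$: if $d(v)>3$, then $d^-(v)=0$; if $d(v)=3$, then $d^-(v)\in\{0,2\}$; if $d^-(v)=2$, then every circle through $v$ contains all the negative edges at $v$. **Construction A.** In a graph $\Gamma$ choose a set of pairwise vertex-disjoint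 paths and circles $P$, all of whose vertices have $d(v)\le 3$, such that each $P$ is either (i) a nontrivial path in a nontrivial block $B$, with internal vertices of degree $2$ in $B$ and termini of degree $2$ in $\Gamma$; or (ii) a path all of whose edges are isthmi, with termini of degree at most $2$ in $\Gamma$; or (iii) a circle that is a megablock of $\Gamma$. Make the edges of the chosen paths and circles negative and all other edges positive. **Construction B.** Let $\Gamma'$ be a graph in which each vertex of degree $2$ supports a loop. (1) Sign $\Gamma'$ arbitrarily, by $\sigma'$. (2) Choose a set $F'$ of edges of $\Gamma'$ containing all negative edges. (3) Partition $F'$ into a set $\mathcal D'$ of nontrivial paths and circles such that (a) internal vertices have degree at most $3$ in $\Gamma'$; (b) the third edge at each internal vertex of degree $3$ is an isthmus of $\Gamma'$; (c) each open path lies in a nontrivial block or consists of isthmi; (d) no terminus has degree $2$ in $\Gamma'$. (4) Subdivide each edge $e'$ into a nontrivial path $P_{e'}$ with the same termini (a closed path if $e'$ is a loop; $e'$ may be left as it is), obtaining $\Gamma$; each $P'\in\mathcal D'$ becomes a path or circle $P$, with the same termini. (5) Make all edges of $P_{e'}$ positive if $e'\notin F'$. (6) For each $P'\in\mathcal D'$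 sign the edges of $P$ so that, for each edge $f'$ of $P'$, (a) $\sigma(P_{f'})=\sigma'(f')$; (b) $P_{f'}$ is not all positive; (c) each terminal edge of $P$ incident with a terminus of degree $\neq 1$ is positive; (d) each edge of $P$ incident with an internal vertex of $P$ of degree $3$ is negative. **Construction C.** As B, but omitting (1) and (6a) and with $F'$ an arbitrary set of edges of $\Gamma'$; after $\Sigma$ is constructed, $\Gamma'$ is signed by $\sigma'(e')=\sigma(P_{e'})$. **Construction D.** As B, but in (1) each nontrivial block of $\Gamma'$ is signed so that it is balanced. **Theorem (Constructive Characterization).** (a) For a signed graph $\Sigma$, not necessarily simple, the following are equivalent: (i) $\Sigma$ satisfies Property 2; (ii) $\Sigma$ is constructed by Construction A; (iii) $\Sigma$ is constructed by Construction B; (iv) $\Sigma$ is constructed by Construction C. (b) For a signed simple graph $\Sigma$, the following are equivalent: (i) the naturally vertex-signed line graph of $\Sigma$ is consistent; (ii) $\Sigma$ is balanced and is constructed by Construction A (or, equivalently, by B, or by C); (iii) $\Sigma$ is constructed by Construction D. -/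

import Mathlib

universe u v

open scoped Graph

namespace Graph

variable {α : Type u} {β : Type v}

/-- The degree of a vertex; a loop counts twice. -/
noncomputable def degree (G : Graph α β) (x : α) : ℕ :=
  {e | G.IsNonloopAt e x}.ncard + 2 * {e | G.IsLoopAt e x}.ncard

/-- `P` is the graph of an open path joining `s` to `t`. Length `0` is allowed (then `s = t`). -/
def IsOpenPath (P : Graph α β) (s t : α) : Prop :=
  ∃ (n : ℕ) (x : Fin (n + 1) → α) (e : Fin n → β),
    Function.Injective x ∧ x 0 = s ∧ x (Fin.last n) = t ∧
    V(P) = Set.range x ∧ E(P) = Set.range e ∧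
    ∀ i : Fin n, P.IsLink (e i) (x i.castSucc) (x i.succ)

/-- `P` is the graph of a closed path with terminus `s`. The length is positive; length `1` is a
loop and length `2` is a pair of parallel edges. -/
def IsClosedPath (P : Graph α β) (s : α) : Prop :=
  ∃ (n : ℕ) (x : Fin (n + 1) → α) (e : Fin n → β),
    0 < n ∧ x 0 = s ∧ x (Fin.last n) = s ∧
    Function.Injective (fun i : Fin n => x i.castSucc) ∧ Function.Injective e ∧
    V(P) = Set.range x ∧ E(P) = Set.range e ∧
    ∀ i : Fin n, P.IsLink (e i) (x i.castSucc) (x i.succ)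

/-- `P` is the graph of a path, open or closed, with termini `s` and `t`. -/
def IsPathBetween (P : Graph α β) (s t : α) : Prop :=
  P.IsOpenPath s t ∨ (s = t ∧ P.IsClosedPath s)

/-- A circle is the graph of a closed path. -/
def IsCircle (C : Graph α β) : Prop := ∃ s, C.IsClosedPath s

/-- `x` and `y` are joined by a walk in `G`. -/
def Joined (G : Graph α β) (x y : α) : Prop := Relation.ReflTransGen G.Adj x y

/-- A connected graph (in particular, it has a vertex). -/
def IsConnected (G : Graph α β) : Prop :=
  V(G).Nonempty ∧ ∀ x ∈ V(G), ∀ y ∈ V(G), G.Joined x y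

/-- An isthmus: an edge whose deletion separates its ends. -/
def IsIsthmus (G : Graph α β) (e : β) : Prop :=
  e ∈ E(G) ∧ ∀ x y, G.IsLink e x y → ¬ (G.deleteEdges {e}).Joined x y

/-- A block: a maximal (connected) subgraph of which any two edges lie in a common circle. -/
def IsBlock (G B : Graph α β) : Prop :=
  Maximal (fun H : Graph α β => H ≤ G ∧ H.IsConnected ∧
    ∀ e ∈ E(H), ∀ f ∈ E(H), e ≠ f → ∃ C ≤ G, C.IsCircle ∧ e ∈ E(C) ∧ f ∈ E(C)) B

/-- A nontrivial block: a block that contains a circle. -/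
def IsNontrivialBlock (G B : Graph α β) : Prop :=
  G.IsBlock B ∧ ∃ C ≤ B, C.IsCircle

/-- A megablock: a maximal connected union of one or more nontrivial blocks. -/
def IsMegablock (G M : Graph α β) : Prop :=
  Maximal (fun H : Graph α β => H ≤ G ∧ H.IsConnected ∧
    ∃ 𝓑 : Set (Graph α β), 𝓑.Nonempty ∧ (∀ B ∈ 𝓑, G.IsNontrivialBlock B) ∧
      V(H) = (⋃ B ∈ 𝓑, V(B)) ∧ E(H) = (⋃ B ∈ 𝓑, E(B))) M

/-- The line graph: its vertices are the edges of `G`, two of them being adjacent when they are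
distinct and have a common end. -/
def lineGraph (G : Graph α β) : SimpleGraph E(G) where
  Adj e f := e ≠ f ∧ ∃ x, G.Inc e x ∧ G.Inc f x
  symm.symm := fun _ _ h => ⟨h.1.symm, h.2.imp fun _ hx => ⟨hx.2, hx.1⟩⟩
  loopless.irrefl := fun _ h => h.1 rfl

end Graph

/-- Data for a path or a circle: its graph, together with the set of its termini. An open path with
graph `P` from `s` to `t` has termini `{s, t}`, a closed path has one terminus, and a circle has
none. -/
structure PathOrCircle (α : Type u) (β : Type v) where
  graph : Graph α β
  termini : Set α

namespace PathOrCircle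

variable {α : Type u} {β : Type v}

def IsOpenPath (P : PathOrCircle α β) : Prop :=
  ∃ s t, P.graph.IsOpenPath s t ∧ P.termini = {s, t}

def IsClosedPath (P : PathOrCircle α β) : Prop :=
  ∃ s, P.graph.IsClosedPath s ∧ P.termini = {s}

/-- A path may be open or closed. -/
def IsPath (P : PathOrCircle α β) : Prop := P.IsOpenPath ∨ P.IsClosedPath

def IsCircle (P : PathOrCircle α β) : Prop := P.graph.IsCircle ∧ P.termini = ∅

/-- Positive length. -/
def Nontrivial (P : PathOrCircle α β) : Prop := E(P.graph).Nonempty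

/-- The vertices that are not termini; for a circle these are all its vertices. -/
def internal (P : PathOrCircle α β) : Set α := V(P.graph) \ P.termini

/-- A `B`-divalent path: a nontrivial path in `B` whose internal vertices have degree `2`
in `B`. -/
def IsDivalentPath (P : PathOrCircle α β) (B : Graph α β) : Prop :=
  P.IsPath ∧ P.Nontrivial ∧ P.graph ≤ B ∧ ∀ x ∈ P.internal, B.degree x = 2

end PathOrCircle

/-- A signed graph. Multiple edges and loops are allowed. Only the signs of the edges in the
edge set of `graph` matter. -/
structure SignedGraph (α : Type u) (β : Type v) where
  graph : Graph α β
  sign : β → ℤˣ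

/-- Consistency of a graph whose vertices are signed by `μ`: the product of the vertex signs in
every circle is positive. -/
def SimpleGraph.IsConsistent {ι : Type v} (L : SimpleGraph ι) (μ : ι → ℤˣ) : Prop :=
  ∀ (x : ι) (c : L.Walk x x), c.IsCycle → (c.support.tail.map μ).prod = 1

/-- `G` is obtained from `G'` by replacing each edge `e'` of `G'` with the nontrivial path `p e'`,
which has the same termini (for a loop this is a circle through its vertex). The vertices of `G'`
are kept, and all the other vertices of the replacing paths are new. -/
structure IsSubdivision {α : Type u} {β γ : Type v} (G' : Graph α γ) (G : Graph α β)
    (p : γ → Graph α β) : Prop where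
  path : ∀ e' x y, G'.IsLink e' x y →
    (p e').IsPathBetween x y ∧ E(p e').Nonempty ∧ V(p e') ∩ V(G') = {x, y}
  path_le : ∀ e' ∈ E(G'), p e' ≤ G
  vertex_disjoint : ∀ e' ∈ E(G'), ∀ f' ∈ E(G'), e' ≠ f' → V(p e') ∩ V(p f') ⊆ V(G')
  edge_disjoint : ∀ e' ∈ E(G'), ∀ f' ∈ E(G'), e' ≠ f' → Disjoint E(p e') E(p f')
  vertexSet_eq : V(G) = V(G') ∪ ⋃ e' ∈ E(G'), V(p e')
  edgeSet_eq : E(G) = ⋃ e' ∈ E(G'), E(p e')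

/-- `D'` is a partition of the set `F'` of edges of `G'` into nontrivial paths and circles that is
admissible for the constructions by subdivision. -/
structure IsAdmissiblePartition {α : Type u} {γ : Type v} (G' : Graph α γ) (F' : Set γ)
    (D' : Set (PathOrCircle α γ)) : Prop where
  le : ∀ P' ∈ D', P'.graph ≤ G'
  path_or_circle : ∀ P' ∈ D', (P'.IsPath ∧ P'.Nontrivial) ∨ P'.IsCircle
  cover : (⋃ P' ∈ D', E(P'.graph)) = F'
  disjoint : D'.PairwiseDisjoint fun P' => E(P'.graph)
  internal_degree : ∀ P' ∈ D', ∀ x ∈ P'.internal, G'.degree x ≤ 3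
  third_edge : ∀ P' ∈ D', ∀ x ∈ P'.internal, G'.degree x = 3 →
    ∀ e', G'.Inc e' x → e' ∉ E(P'.graph) → G'.IsIsthmus e'
  open_path : ∀ P' ∈ D', P'.IsOpenPath →
    (∃ B, G'.IsNontrivialBlock B ∧ P'.graph ≤ B) ∨ ∀ e' ∈ E(P'.graph), G'.IsIsthmus e'
  terminus : ∀ P' ∈ D', ∀ x ∈ P'.termini, G'.degree x ≠ 2

namespace SignedGraph

variable {α : Type u} {β : Type v}

/-- The negative subgraph: all the vertices and all the negative edges. -/
def neg (S : SignedGraph α β) : Graph α β := S.graph.restrict {e | S.sign e = -1}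

/-- The product of the signs of the edges of a path or circle `P`. -/
noncomputable def signOf (S : SignedGraph α β) (P : Graph α β) : ℤˣ := ∏ᶠ e ∈ E(P), S.sign e

/-- Every circle has positive sign. -/
def Balanced (S : SignedGraph α β) : Prop :=
  ∀ C ≤ S.graph, C.IsCircle → S.signOf C = 1

/-- The local conditions on degrees and negative degrees. -/
def LocalProperty (S : SignedGraph α β) : Prop :=
  ∀ x ∈ V(S.graph),
    (3 < S.graph.degree x → S.neg.degree x = 0) ∧
    (S.graph.degree x = 3 → S.neg.degree x = 0 ∨ S.neg.degree x = 2) ∧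
    (S.neg.degree x = 2 → ∀ C ≤ S.graph, C.IsCircle → x ∈ V(C) →
      ∀ e, S.neg.Inc e x → e ∈ E(C))

/-- The naturally vertex-signed line graph is consistent. -/
def LineConsistent (S : SignedGraph α β) : Prop :=
  S.graph.lineGraph.IsConsistent fun e => S.sign e

/-- Pairwise disjoint paths and circles, each of one of three types, are made negative, and the
other edges are made positive. -/
def ConstructionA (S : SignedGraph α β) : Prop :=
  ∃ 𝓐 : Set (PathOrCircle α β),
    (𝓐.PairwiseDisjoint fun P => V(P.graph)) ∧
    (∀ P ∈ 𝓐,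
      (∃ B, S.graph.IsNontrivialBlock B ∧ P.IsDivalentPath B ∧
        (∀ x ∈ V(P.graph), S.graph.degree x ≤ 3) ∧
        ∀ x ∈ P.termini, S.graph.degree x = 2) ∨
      (P.IsPath ∧ P.graph ≤ S.graph ∧ (∀ e ∈ E(P.graph), S.graph.IsIsthmus e) ∧
        (∀ x ∈ V(P.graph), S.graph.degree x ≤ 3) ∧
        ∀ x ∈ P.termini, S.graph.degree x ≤ 2) ∨
      (P.IsCircle ∧ S.graph.IsMegablock P.graph ∧
        ∀ x ∈ V(P.graph), S.graph.degree x ≤ 3)) ∧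
    ∀ e ∈ E(S.graph), S.sign e = -1 ↔ ∃ P ∈ 𝓐, e ∈ E(P.graph)

/-- The part common to the constructions by subdivision. The graph `G'`, whose divalent vertices
all support loops, is subdivided by the paths `p e'`, and the subdivided graph is signed with
respect to the set `F'` of edges and its partition `D'`. For `P'` in `D'`, the derived path or
circle in `S.graph` has the edges of the paths `p f'`, for `f'` in `P'`, and the same termini
as `P'`. -/
structure ArisesBySubdivision {γ : Type v} (S : SignedGraph α β) (G' : Graph α γ) (F' : Set γ)
    (D' : Set (PathOrCircle α γ)) (p : γ → Graph α β) : Prop where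
  no_divalent : ∀ x ∈ V(G'), G'.degree x = 2 → ∃ e', G'.IsLoopAt e' x
  subset : F' ⊆ E(G')
  partition : IsAdmissiblePartition G' F' D'
  subdivision : IsSubdivision G' S.graph p
  positive : ∀ e' ∈ E(G'), e' ∉ F' → ∀ e ∈ E(p e'), S.sign e = 1
  not_all_positive : ∀ P' ∈ D', ∀ f' ∈ E(P'.graph), ∃ e ∈ E(p f'), S.sign e ≠ 1
  terminal_edge : ∀ P' ∈ D', ∀ x ∈ P'.termini, S.graph.degree x ≠ 1 →
    ∀ f' ∈ E(P'.graph), ∀ e ∈ E(p f'), S.graph.Inc e x → S.sign e = 1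
  internal_edge : ∀ P' ∈ D', ∀ x ∉ P'.termini, S.graph.degree x = 3 →
    ∀ f' ∈ E(P'.graph), ∀ e ∈ E(p f'), S.graph.Inc e x → S.sign e = -1

/-- The initial graph is signed arbitrarily; `F'` contains its negative edges and the sign of each
replacing path is that of the edge of `F'` that it replaces. -/
def ConstructionB (S : SignedGraph α β) : Prop :=
  ∃ (γ : Type v) (S' : SignedGraph α γ) (F' : Set γ) (D' : Set (PathOrCircle α γ))
    (p : γ → Graph α β),
    S.ArisesBySubdivision S'.graph F' D' p ∧ E(S'.neg) ⊆ F' ∧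
    ∀ P' ∈ D', ∀ f' ∈ E(P'.graph), S.signOf (p f') = S'.sign f'

/-- `F'` is arbitrary and the initial graph is signed afterwards, by the signs of the paths that
replace its edges. -/
def ConstructionC (S : SignedGraph α β) : Prop :=
  ∃ (γ : Type v) (S' : SignedGraph α γ) (F' : Set γ) (D' : Set (PathOrCircle α γ))
    (p : γ → Graph α β),
    S.ArisesBySubdivision S'.graph F' D' p ∧
    ∀ e' ∈ E(S'.graph), S'.sign e' = S.signOf (p e')

/-- As `ConstructionB`, but each nontrivial block of the initial graph is signed so that it is
balanced. -/
def ConstructionD (S : SignedGraph α β) : Prop :=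
  ∃ (γ : Type v) (S' : SignedGraph α γ) (F' : Set γ) (D' : Set (PathOrCircle α γ))
    (p : γ → Graph α β),
    S.ArisesBySubdivision S'.graph F' D' p ∧ E(S'.neg) ⊆ F' ∧
    (∀ P' ∈ D', ∀ f' ∈ E(P'.graph), S.signOf (p f') = S'.sign f') ∧
    ∀ B, S'.graph.IsNontrivialBlock B → (SignedGraph.mk B S'.sign).Balanced

end SignedGraph

/-! Property 2 is the hub. Part (a) compares it with Construction A and with Construction C; B and C
differ only in when the initial graph is signed (`sign_eq_iff`). In part (b), for simple graphs,
line-graph consistency is equivalent to Property 2 together with balance, and D amounts to C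
together with balance (`balanced_iff`).

The working tool is the even set: a finite edge set in which every vertex has even degree. Each of
its edges lies in a circle inside it (`IsEvenSet.exists_isCircle`), circles are the minimal nonempty
even sets, and an isthmus is an edge in no even set (`isIsthmus_iff`). Statements about circles thus
extend to even sets, which, unlike circles, are closed under symmetric difference and transfer in
both directions under subdivision by plain degree counts (`isEvenSet_lift`, `exists_isEvenSet`).

The second pillar is `IsTransition.exists_isDecomposition`: prescribe at each vertex of a finite set
two edge ends that are to be joined. If no other edge at these vertices lies in an even set, the
edges can be partitioned into paths and circles that pass through exactly the prescribed pairs. It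
is applied to the negative edges (for A), to all edges at divalent vertices (to suppress these
vertices and obtain the initial graph), and to the set `F'` in the initial graph (to obtain its
partition).

From Property 2 to A: negative degrees are at most 2, so the negative edges form vertex-disjoint
paths and circles. A circle containing one edge of such a path contains the next one at every
internal vertex, hence the whole path. So a path consists of isthmi or lies in a block, where its
internal vertices are divalent; a member that is a circle meets no other circle and is a megablock.
The converse checks the three types.

From Property 2 to C: suppress the divalent vertices and let `F'` be the edges whose replacing paths
have a negative edge. At a vertex of degree 3 and negative degree 2 the members of the partition
continue through the negative ends. An even set that uses this vertex contains both negative ends,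
so by parity it omits the third edge end, and the third edge is an isthmus. The converse reads this
backwards.

For the line graph, three edges at a vertex form a triangle, a circle of the graph gives a cycle,
and so does a circle with an extra edge inserted at a vertex; consistency on these gives balance and
Property 2. Conversely, the edges along which a cycle of the line graph really moves form an even
set, of product 1 by balance. If an edge where it does not move is negative, Property 2 forces the
cycle to be a triangle at a vertex of degree 3. -/

namespace Graph

variable {α : Type u} {β : Type v} {G H : Graph α β} {e f : β} {x y z s t : α}
  {X Y ES : Set β} {VS : Set α}

/-! ### Incidence multiplicities and degrees within edge sets -/

open Classical in
/-- The number of ends of the edge `e` that are equal to `x`. -/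
noncomputable def mult (G : Graph α β) (e : β) (x : α) : ℕ :=
  if G.IsLoopAt e x then 2 else if G.Inc e x then 1 else 0

lemma mult_eq_zero_iff : G.mult e x = 0 ↔ ¬ G.Inc e x := by
  unfold mult
  split_ifs with h1 h2
  · simp [h1.inc]
  · simp [h2]
  · simp [h2]

lemma Inc.mult_pos (h : G.Inc e x) : 0 < G.mult e x :=
  Nat.pos_of_ne_zero fun h' => mult_eq_zero_iff.1 h' h

lemma mult_eq_two_iff : G.mult e x = 2 ↔ G.IsLoopAt e x := by
  unfold mult
  split_ifs with h1 h2 <;> simp [h1]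

lemma mult_eq_one_iff : G.mult e x = 1 ↔ G.IsNonloopAt e x := by
  rw [isNonloopAt_iff_inc_not_isLoopAt]
  unfold mult
  split_ifs with h1 h2 <;> simp [*]

open Classical in
lemma IsLink.mult_eq (h : G.IsLink e s t) :
    G.mult e x = (if x = s then 1 else 0) + if x = t then 1 else 0 := by
  have hi : G.Inc e x ↔ x = s ∨ x = t :=
    ⟨fun hx => hx.eq_or_eq_of_isLink h, by rintro (rfl | rfl); exacts [h.inc_left, h.inc_right]⟩
  have hl : G.IsLoopAt e x ↔ x = s ∧ x = t := by
    constructor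
    · intro hx
      exact ⟨hx.eq_of_inc h.inc_left, hx.eq_of_inc h.inc_right⟩
    · rintro ⟨rfl, rfl⟩; exact h
  unfold mult
  by_cases h1 : x = s
  · subst h1
    by_cases h2 : x = t
    · subst h2
      simp [hl]
    · simp [hi, hl, h2]
  · by_cases h2 : x = t
    · subst h2
      simp [hi, hl, h1]
    · simp [hi, hl, h1, h2]

lemma mult_congr (hHG : H ≤ G) (he : e ∈ E(H)) : H.mult e x = G.mult e x := by
  have h1 : H.IsLoopAt e x ↔ G.IsLoopAt e x := IsSubgraph.isLoopAt_congr hHG he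
  have h2 : H.Inc e x ↔ G.Inc e x := IsSubgraph.inc_congr hHG he
  unfold mult
  split_ifs <;> simp_all

/-- The degree of `x` in the edge set `X`. -/
noncomputable def degIn (G : Graph α β) (X : Set β) (x : α) : ℕ := ∑ᶠ e ∈ X, G.mult e x

lemma degIn_congr (hHG : H ≤ G) (hX : X ⊆ E(H)) : H.degIn X x = G.degIn X x :=
  finsum_mem_congr rfl fun _ he => mult_congr hHG (hX he)

@[simp] lemma degIn_empty : G.degIn ∅ x = 0 := finsum_mem_empty

@[simp] lemma degIn_singleton : G.degIn {e} x = G.mult e x := finsum_mem_singleton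

lemma degIn_union (hX : X.Finite) (hY : Y.Finite) (h : Disjoint X Y) :
    G.degIn (X ∪ Y) x = G.degIn X x + G.degIn Y x := finsum_mem_union h hX hY

lemma degIn_insert (hX : X.Finite) (h : e ∉ X) :
    G.degIn (insert e X) x = G.mult e x + G.degIn X x := finsum_mem_insert _ h hX

lemma degIn_pair (h : e ≠ f) : G.degIn {e, f} x = G.mult e x + G.mult f x :=
  finsum_mem_pair h

lemma degIn_diff (hY : Y.Finite) (h : X ⊆ Y) :
    G.degIn Y x = G.degIn X x + G.degIn (Y \ X) x := by
  rw [← degIn_union (hY.subset h) (hY.subset Set.sdiff_subset) Set.disjoint_sdiff_right,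
    Set.union_sdiff_cancel h]

lemma degIn_mono (hY : Y.Finite) (h : X ⊆ Y) : G.degIn X x ≤ G.degIn Y x := by
  rw [degIn_diff hY h]; exact Nat.le_add_right _ _

lemma mult_le_degIn (hX : X.Finite) (h : e ∈ X) : G.mult e x ≤ G.degIn X x := by
  rw [← degIn_singleton]; exact degIn_mono hX (by simpa)

lemma degIn_pos_iff (hX : X.Finite) : 0 < G.degIn X x ↔ ∃ e ∈ X, G.Inc e x := by
  constructor
  · intro h
    by_contra! hc
    refine h.ne' ?_
    exact (finsum_mem_congr rfl fun e he => mult_eq_zero_iff.2 (hc e he)).trans (finsum_mem_zero _)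
  · rintro ⟨e, he, hi⟩
    exact hi.mult_pos.trans_le (mult_le_degIn hX he)

lemma degIn_eq_zero_iff (hX : X.Finite) : G.degIn X x = 0 ↔ ∀ e ∈ X, ¬ G.Inc e x := by
  have := degIn_pos_iff (G := G) (x := x) hX
  rw [Nat.pos_iff_ne_zero, not_iff_comm] at this
  rw [← this]; push Not; rfl

/-- If `X ⊆ Y` and the degree of `x` in `Y` does not exceed that in `X`, then all edges of `Y`
at `x` are in `X`. -/
lemma mem_of_degIn_le (hY : Y.Finite) (h : X ⊆ Y) (hd : G.degIn Y x ≤ G.degIn X x) (he : e ∈ Y)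
    (hi : G.Inc e x) : e ∈ X := by
  by_contra heX
  have h1 := degIn_diff (G := G) (x := x) hY h
  have h2 : 0 < G.degIn (Y \ X) x :=
    (degIn_pos_iff (hY.subset Set.sdiff_subset)).2 ⟨e, ⟨he, heX⟩, hi⟩
  omega

/-- The degree of `x` in `X` depends only on the edges of `X` at `x`. -/
lemma degIn_congr_set (h : ∀ e, G.Inc e x → (e ∈ X ↔ e ∈ Y)) : G.degIn X x = G.degIn Y x := by
  refine finsum_congr fun e => ?_
  by_cases hi : G.Inc e x
  · simp [h e hi]
  · simp [mult_eq_zero_iff.2 hi]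

lemma degIn_le_of_forall (hY : Y.Finite) (h : ∀ e ∈ X, G.Inc e x → e ∈ Y) :
    G.degIn X x ≤ G.degIn Y x := by
  rw [degIn_congr_set (Y := X ∩ Y) fun e hi =>
    ⟨fun he => ⟨he, h e he hi⟩, fun he => he.1⟩]
  exact degIn_mono hY Set.inter_subset_right

/-- The bridge from `degree`, built from two cardinalities, to the additive `degIn` used in all
counting: nonloops at `x` have multiplicity 1 and loops multiplicity 2. -/
lemma degree_eq_degIn (hE : E(G).Finite) : G.degree x = G.degIn E(G) x := by
  have hn : {e | G.IsNonloopAt e x}.Finite := hE.subset fun e he => IsNonloopAt.edge_mem he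
  have hl : {e | G.IsLoopAt e x}.Finite := hE.subset fun e he => IsLoopAt.edge_mem he
  have hd : Disjoint {e | G.IsNonloopAt e x} {e | G.IsLoopAt e x} :=
    Set.disjoint_left.2 fun e h1 h2 => h1.not_isLoopAt _ h2
  rw [degIn_congr_set (Y := {e | G.IsNonloopAt e x} ∪ {e | G.IsLoopAt e x}) fun e hi =>
    ⟨fun _ => hi.isLoopAt_or_isNonloopAt.symm, fun _ => hi.edge_mem⟩, degIn_union hn hl hd, degree]
  congr 1
  · have : ∀ e ∈ {e | G.IsNonloopAt e x}, G.mult e x = 1 := fun e he => mult_eq_one_iff.2 he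
    rw [degIn, finsum_mem_congr rfl this, finsum_one]
  · have : ∀ e ∈ {e | G.IsLoopAt e x}, G.mult e x = 2 * 1 := fun e he => mult_eq_two_iff.2 he
    rw [degIn, finsum_mem_congr rfl this, ← mul_finsum_mem' _ _ hl, finsum_one]

lemma degree_eq_degIn_of_le (hE : E(G).Finite) (h : H ≤ G) : H.degree x = G.degIn E(H) x := by
  rw [degree_eq_degIn (hE.subset (IsSubgraph.edgeSet_mono h)), degIn_congr h subset_rfl]

/-! ### Open and closed paths -/

/-- `G.OPath s t VS ES`: there is an open path in `G` from `s` to `t` with vertex set `VS` and edge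
set `ES`. -/
inductive OPath (G : Graph α β) : α → α → Set α → Set β → Prop
  | nil {x : α} (hx : x ∈ V(G)) : OPath G x x {x} ∅
  | cons {e : β} {x y z : α} {VS : Set α} {ES : Set β} (h : G.IsLink e x y)
      (hp : OPath G y z VS ES) (hx : x ∉ VS) : OPath G x z (insert x VS) (insert e ES)

/-- `G.CPath s VS ES`: there is a closed path in `G` with terminus `s`, vertex set `VS` and edge set
`ES`. -/
def CPath (G : Graph α β) (s : α) (VS : Set α) (ES : Set β) : Prop :=
  ∃ e y ES', G.IsLink e s y ∧ G.OPath y s VS ES' ∧ e ∉ ES' ∧ ES = insert e ES'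

namespace OPath

lemma left_mem (h : G.OPath s t VS ES) : s ∈ VS := by
  cases h <;> simp

lemma right_mem (h : G.OPath s t VS ES) : t ∈ VS := by
  induction h with
  | nil => simp
  | cons _ _ _ ih => exact Or.inr ih

lemma finite (h : G.OPath s t VS ES) : ES.Finite := by
  induction h with
  | nil => simp
  | cons _ _ _ ih => exact ih.insert _

lemma subset_vertexSet (h : G.OPath s t VS ES) : VS ⊆ V(G) := by
  induction h with
  | nil hx => simpa
  | cons h _ _ ih => exact Set.insert_subset h.left_mem ih

lemma subset_edgeSet (h : G.OPath s t VS ES) : ES ⊆ E(G) := by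
  induction h with
  | nil => simp
  | cons h _ _ ih => exact Set.insert_subset h.edge_mem ih

lemma inc_mem (h : G.OPath s t VS ES) (he : e ∈ ES) (hi : G.Inc e x) : x ∈ VS := by
  induction h with
  | nil => simp at he
  | cons h hp _ ih =>
    rcases he with rfl | he
    · rcases hi.eq_or_eq_of_isLink h with rfl | rfl
      · simp
      · exact Or.inr hp.left_mem
    · exact Or.inr (ih he)

lemma mono (h : H.OPath s t VS ES) (hHG : H ≤ G) : G.OPath s t VS ES := by
  induction h with
  | nil hx => exact nil (hHG.vertexSet_mono hx)
  | cons h _ hx ih => exact cons (h.mono hHG) ih hx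

lemma anti (h : G.OPath s t VS ES) (hHG : H ≤ G) (hV : VS ⊆ V(H)) (hE : ES ⊆ E(H)) :
    H.OPath s t VS ES := by
  induction h with
  | nil hx => exact nil (by simpa using hV)
  | cons h _ hx ih =>
    exact cons ((IsSubgraph.isLink_iff hHG (hE (by simp))).2 h)
      (ih ((Set.subset_insert _ _).trans hV) ((Set.subset_insert _ _).trans hE)) hx

lemma snoc (h : G.OPath s y VS ES) (he : G.IsLink e y z) (hz : z ∉ VS) :
    G.OPath s z (insert z VS) (insert e ES) := by
  induction h with
  | nil hx =>
    rw [Set.pair_comm]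
    exact cons he (nil he.right_mem) (by simpa [eq_comm] using hz)
  | cons h' _ hx ih =>
    simp only [Set.mem_insert_iff, not_or] at hz
    rw [Set.insert_comm, Set.insert_comm e]
    exact cons h' (ih he hz.2) (by simp [hx, Ne.symm hz.1])

lemma symm (h : G.OPath s t VS ES) : G.OPath t s VS ES := by
  induction h with
  | nil hx => exact nil hx
  | cons h _ hx ih => exact ih.snoc h.symm hx

lemma append {V₁ V₂ : Set α} {E₁ E₂ : Set β} (h₁ : G.OPath x y V₁ E₁) (h₂ : G.OPath y z V₂ E₂)
    (h : V₁ ∩ V₂ ⊆ {y}) : G.OPath x z (V₁ ∪ V₂) (E₁ ∪ E₂) := by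
  induction h₁ with
  | nil hx => simpa [Set.insert_eq_of_mem h₂.left_mem] using h₂
  | @cons e a b c V E hl hp hx ih =>
    rw [Set.insert_union, Set.insert_union]
    refine cons hl (ih h₂ ((Set.inter_subset_inter_left _ (Set.subset_insert _ _)).trans h)) ?_
    rintro (ha | ha)
    · exact hx ha
    · have : a = c := h ⟨by simp, ha⟩
      exact hx (this ▸ hp.right_mem)

lemma exists_prefix (h : G.OPath s t VS ES) (hz : z ∈ VS) :
    ∃ V₁ E₁, V₁ ⊆ VS ∧ E₁ ⊆ ES ∧ G.OPath s z V₁ E₁ := by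
  induction h with
  | nil hx =>
    obtain rfl : z = _ := hz
    exact ⟨_, _, subset_rfl, subset_rfl, nil hx⟩
  | @cons e a b c V E hl hp hx ih =>
    by_cases hza : z = a
    · subst hza
      exact ⟨{z}, ∅, by simp, by simp, nil hl.left_mem⟩
    · obtain ⟨V₁, E₁, hV, hE, hp'⟩ := ih (hz.resolve_left hza)
      exact ⟨_, _, Set.insert_subset_insert hV, Set.insert_subset_insert hE,
        cons hl hp' fun ha => hx (hV ha)⟩

-- The corrections at the two ends are added on the left, so that one formula without subtraction
-- also covers the trivial path, where both corrections fall on the same vertex.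
open Classical in
lemma degIn_add (h : G.OPath s t VS ES) (x : α) :
    G.degIn ES x + (if x = s then 1 else 0) + (if x = t then 1 else 0) =
      if x ∈ VS then 2 else 0 := by
  induction h with
  | @nil a => by_cases hx : x = a <;> simp [hx]
  | @cons e a b c V E hl hp ha ih =>
    have he : e ∉ E := fun he => ha (hp.inc_mem he hl.inc_left)
    rw [degIn_insert hp.finite he, hl.mult_eq]
    by_cases hxa : x = a
    · subst hxa
      simp only [ha, if_false] at ih
      simp only [if_true, Set.mem_insert_iff, true_or]
      omega
    · simp only [hxa, if_false, Set.mem_insert_iff, false_or]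
      omega

lemma degIn_internal (h : G.OPath s t VS ES) (hx : x ∈ VS) (hs : x ≠ s) (ht : x ≠ t) :
    G.degIn ES x = 2 := by
  have := h.degIn_add x
  simpa [hx, hs, ht] using this

lemma degIn_left (h : G.OPath s t VS ES) (hst : s ≠ t) : G.degIn ES s = 1 := by
  have := h.degIn_add s
  simp [h.left_mem, hst] at this
  omega

lemma eq_empty (h : G.OPath s s VS ES) : ES = ∅ ∧ VS = {s} := by
  cases h with
  | nil => simp
  | cons _ hp hx => exact absurd hp.right_mem hx

lemma ne_of_nonempty (h : G.OPath s t VS ES) (hne : ES.Nonempty) : s ≠ t := by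
  rintro rfl
  exact hne.ne_empty h.eq_empty.1

lemma exists_inc_left (h : G.OPath s t VS ES) (hst : s ≠ t) : ∃ e ∈ ES, G.Inc e s :=
  (degIn_pos_iff h.finite).1 (by rw [h.degIn_left hst]; simp)

lemma joined_left (h : G.OPath s t VS ES) (hx : x ∈ VS) : G.Joined s x := by
  induction h with
  | nil => rw [Set.mem_singleton_iff.1 hx]; exact Relation.ReflTransGen.refl
  | @cons e a b c V E hl hp ha ih =>
    rcases hx with rfl | hx
    · exact Relation.ReflTransGen.refl
    · exact Relation.ReflTransGen.head hl.adj (ih hx)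

/-- Consecutive edges share an internal vertex, so what is handed on there spreads along the whole
path. The main use is with `Q` the membership in a circle or an even set. -/
lemma propagate {Q : β → Prop} (h : G.OPath s t VS ES)
    (hQ : ∀ x ∈ VS, x ≠ s → x ≠ t → ∀ e ∈ ES, ∀ f ∈ ES, G.Inc e x → G.Inc f x → Q e → Q f) :
    ∀ e ∈ ES, ∀ f ∈ ES, Q e → Q f := by
  induction h with
  | nil => simp
  | @cons e₀ a b c V E hl hp ha ih =>
    have ih' := ih fun x hx hb hc e he f hf =>
      hQ x (Or.inr hx) (fun h => ha (h ▸ hx)) hc e (Or.inr he) f (Or.inr hf)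
    by_cases hbc : b = c
    · subst hbc
      obtain ⟨rfl, -⟩ := hp.eq_empty
      simp only [Set.mem_insert_iff, Set.mem_empty_iff_false, or_false]
      rintro e rfl f rfl h
      exact h
    obtain ⟨g, hg, hgi⟩ := hp.exists_inc_left hbc
    have hab : b ≠ a := fun h => ha (h ▸ hp.left_mem)
    have h1 := hQ b (Or.inr hp.left_mem) hab hbc e₀ (Or.inl rfl) g (Or.inr hg) hl.inc_right hgi
    have h2 := hQ b (Or.inr hp.left_mem) hab hbc g (Or.inr hg) e₀ (Or.inl rfl) hgi hl.inc_right
    rintro e (rfl | he) f (rfl | hf) h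
    · exact h
    · exact ih' g hg f hf (h1 h)
    · exact h2 (ih' e he g hg h)
    · exact ih' e he f hf h

end OPath

lemma Joined.symm (h : G.Joined x y) : G.Joined y x := by
  unfold Joined at *
  induction h with
  | refl => exact Relation.ReflTransGen.refl
  | tail _ hab ih => exact Relation.ReflTransGen.head hab.symm ih

lemma Joined.mono (h : H.Joined x y) (hHG : H ≤ G) : G.Joined x y :=
  Relation.ReflTransGen.mono (fun _ _ h => Adj.mono hHG h) _ _ h

/-- The path is extended along the walk; when the next vertex has already been visited, it is cut
back to the prefix ending there. -/
lemma Joined.exists_oPath (h : G.Joined x y) (hx : x ∈ V(G)) : ∃ VS ES, G.OPath x y VS ES := by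
  unfold Joined at h
  induction h with
  | refl => exact ⟨_, _, OPath.nil hx⟩
  | @tail b c _ hab ih =>
    obtain ⟨VS, ES, hp⟩ := ih
    by_cases hc : c ∈ VS
    · obtain ⟨V₁, E₁, -, -, hp'⟩ := hp.exists_prefix hc
      exact ⟨_, _, hp'⟩
    · obtain ⟨e, he⟩ := hab
      exact ⟨_, _, hp.snoc he hc⟩

namespace CPath

lemma left_mem (h : G.CPath s VS ES) : s ∈ VS := by
  obtain ⟨e, y, ES', -, hp, -, -⟩ := h
  exact hp.right_mem

lemma finite (h : G.CPath s VS ES) : ES.Finite := by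
  obtain ⟨e, y, ES', -, hp, -, rfl⟩ := h
  exact hp.finite.insert _

lemma nonempty (h : G.CPath s VS ES) : ES.Nonempty := by
  obtain ⟨e, y, ES', -, hp, -, rfl⟩ := h
  exact Set.insert_nonempty _ _

lemma subset_vertexSet (h : G.CPath s VS ES) : VS ⊆ V(G) := by
  obtain ⟨e, y, ES', -, hp, -, rfl⟩ := h
  exact hp.subset_vertexSet

lemma subset_edgeSet (h : G.CPath s VS ES) : ES ⊆ E(G) := by
  obtain ⟨e, y, ES', hl, hp, -, rfl⟩ := h
  exact Set.insert_subset hl.edge_mem hp.subset_edgeSet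

lemma inc_mem (h : G.CPath s VS ES) (he : e ∈ ES) (hi : G.Inc e x) : x ∈ VS := by
  obtain ⟨e₀, y, ES', hl, hp, -, rfl⟩ := h
  rcases he with rfl | he
  · rcases hi.eq_or_eq_of_isLink hl with rfl | rfl
    · exact hp.right_mem
    · exact hp.left_mem
  · exact hp.inc_mem he hi

lemma mono (h : H.CPath s VS ES) (hHG : H ≤ G) : G.CPath s VS ES := by
  obtain ⟨e, y, ES', hl, hp, he, rfl⟩ := h
  exact ⟨e, y, ES', hl.mono hHG, hp.mono hHG, he, rfl⟩

lemma anti (h : G.CPath s VS ES) (hHG : H ≤ G) (hV : VS ⊆ V(H)) (hE : ES ⊆ E(H)) :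
    H.CPath s VS ES := by
  obtain ⟨e, y, ES', hl, hp, he, rfl⟩ := h
  exact ⟨e, y, ES', (IsSubgraph.isLink_iff hHG (hE (by simp))).2 hl,
    hp.anti hHG hV ((Set.subset_insert _ _).trans hE), he, rfl⟩

-- The first edge supplies exactly the two ends that are missing in `OPath.degIn_add`.
open Classical in
lemma degIn_eq (h : G.CPath s VS ES) (x : α) : G.degIn ES x = if x ∈ VS then 2 else 0 := by
  obtain ⟨e, y, ES', hl, hp, he, rfl⟩ := h
  rw [degIn_insert hp.finite he, hl.mult_eq, ← hp.degIn_add]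
  omega

lemma degIn_of_mem (h : G.CPath s VS ES) (hx : x ∈ VS) : G.degIn ES x = 2 := by
  simp [h.degIn_eq, hx]

lemma joined_left (h : G.CPath s VS ES) (hx : x ∈ VS) : G.Joined s x := by
  obtain ⟨e, y, ES', hl, hp, he, rfl⟩ := h
  exact Relation.ReflTransGen.head hl.adj (hp.joined_left hx)

/-- Nothing is needed at the terminus: a closed path cut there is still a chain of edges linked at
the other vertices. -/
lemma propagate {Q : β → Prop} (h : G.CPath s VS ES)
    (hQ : ∀ x ∈ VS, x ≠ s → ∀ e ∈ ES, ∀ f ∈ ES, G.Inc e x → G.Inc f x → Q e → Q f) :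
    ∀ e ∈ ES, ∀ f ∈ ES, Q e → Q f := by
  obtain ⟨e₀, y, ES', hl, hp, he₀, rfl⟩ := h
  have ih' := hp.propagate (Q := Q) fun x hx _ hs e he f hf =>
      hQ x hx hs e (Or.inr he) f (Or.inr hf)
  by_cases hys : y = s
  · subst hys
    obtain ⟨rfl, -⟩ := hp.eq_empty
    simp only [Set.mem_insert_iff, Set.mem_empty_iff_false, or_false]
    rintro e rfl f rfl h
    exact h
  obtain ⟨g, hg, hgi⟩ := hp.exists_inc_left hys
  have h1 := hQ y hp.left_mem hys e₀ (Or.inl rfl) g (Or.inr hg) hl.inc_right hgi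
  have h2 := hQ y hp.left_mem hys g (Or.inr hg) e₀ (Or.inl rfl) hgi hl.inc_right
  rintro e (rfl | he) f (rfl | hf) h
  · exact h
  · exact ih' g hg f hf (h1 h)
  · exact h2 (ih' e he g hg h)
  · exact ih' e he f hf h

end CPath

/-- Two open paths with the same two distinct ends, disjoint otherwise, form a closed path. -/
lemma OPath.close {V₁ V₂ : Set α} {E₁ E₂ : Set β} (h₁ : G.OPath x y V₁ E₁)
    (h₂ : G.OPath y x V₂ E₂) (hxy : x ≠ y) (hV : V₁ ∩ V₂ ⊆ {x, y}) (hE : Disjoint E₁ E₂) :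
    G.CPath x (V₁ ∪ V₂) (E₁ ∪ E₂) := by
  cases h₁ with
  | nil => exact absurd rfl hxy
  | @cons e _ b _ V E hl hp hx =>
    refine ⟨e, b, E ∪ E₂, hl, ?_, ?_, by rw [Set.insert_union]⟩
    · rw [Set.insert_union, Set.insert_eq_of_mem (show x ∈ V ∪ V₂ from Or.inr h₂.right_mem)]
      refine hp.append h₂ ?_
      rintro z ⟨h1, h2⟩
      rcases hV ⟨Or.inr h1, h2⟩ with rfl | h
      · exact absurd h1 hx
      · exact h
    · rintro (he | he)
      · exact hx (hp.inc_mem he hl.inc_left)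
      · exact Set.disjoint_left.1 hE (by simp) he

/-! ### Comparison with the definitions by sequences -/

lemma oPath_of_seq (n : ℕ) (x : Fin (n + 1) → α) (e : Fin n → β) (hx : Function.Injective x)
    (hV : ∀ i, x i ∈ V(G)) (hl : ∀ i : Fin n, G.IsLink (e i) (x i.castSucc) (x i.succ)) :
    G.OPath (x 0) (x (Fin.last n)) (Set.range x) (Set.range e) := by
  induction n with
  | zero =>
    have h1 : Set.range x = {x 0} := by
      ext a; simp [Fin.exists_fin_one, eq_comm]
    have h2 : Set.range e = ∅ := Set.range_eq_empty e
    rw [h1, h2]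
    exact OPath.nil (hV 0)
  | succ n ih =>
    have h1 := ih (fun i => x i.succ) (fun i => e i.succ)
      (fun a b h => Fin.succ_injective _ (hx h)) (fun i => hV _) fun i => by
        simpa using hl i.succ
    have h2 : Set.range x = insert (x 0) (Set.range fun i : Fin (n + 1) => x i.succ) := by
      ext a; simp [Fin.exists_fin_succ, eq_comm]
    have h3 : Set.range e = insert (e 0) (Set.range fun i : Fin n => e i.succ) := by
      ext a; simp [Fin.exists_fin_succ, eq_comm]
    rw [h2, h3]
    refine OPath.cons (hl 0) h1 ?_
    rintro ⟨i, hi⟩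
    exact Fin.succ_ne_zero i (hx hi)

lemma OPath.exists_seq (h : G.OPath s t VS ES) :
    ∃ (n : ℕ) (x : Fin (n + 1) → α) (e : Fin n → β), Function.Injective x ∧ x 0 = s ∧
      x (Fin.last n) = t ∧ VS = Set.range x ∧ ES = Set.range e ∧
      ∀ i : Fin n, G.IsLink (e i) (x i.castSucc) (x i.succ) := by
  induction h with
  | @nil a ha =>
    refine ⟨0, fun _ => a, Fin.elim0, fun i j _ => Fin.ext (by omega), rfl, rfl, ?_, ?_,
      fun i => i.elim0⟩
    · simp
    · simp
  | @cons e a b c V E hl hp ha ih =>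
    obtain ⟨n, x, e', hx, h0, hn, rfl, rfl, hlk⟩ := ih
    refine ⟨n + 1, Fin.cons a x, Fin.cons e e', ?_, by simp, ?_, ?_, ?_, ?_⟩
    · exact Fin.cons_injective_iff.2 ⟨ha, hx⟩
    · rw [← Fin.succ_last]; simpa using hn
    · rw [Fin.range_cons]
    · rw [Fin.range_cons]
    · intro i
      induction i using Fin.cases with
      | zero => simpa [h0] using hl
      | succ j => simpa using hlk j

lemma isOpenPath_iff {P : Graph α β} : P.IsOpenPath s t ↔ P.OPath s t V(P) E(P) := by
  constructor
  · rintro ⟨n, x, e, hx, rfl, rfl, hV, hE, hl⟩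
    rw [hV, hE]
    exact oPath_of_seq n x e hx (fun i => hV ▸ ⟨i, rfl⟩) hl
  · intro h
    exact h.exists_seq

lemma OPath.edge_injective {n : ℕ} {x : Fin (n + 1) → α} {e : Fin n → β}
    (hx : Function.Injective x) (hl : ∀ i : Fin n, G.IsLink (e i) (x i.castSucc) (x i.succ)) :
    Function.Injective e := by
  intro i j hij
  rcases (hij ▸ hl i : G.IsLink (e j) _ _).eq_and_eq_or_eq_and_eq (hl j) with ⟨h, -⟩ | ⟨h1, h2⟩
  · exact Fin.castSucc_injective _ (hx h)
  -- One edge traversed in opposite directions would give both `i = j + 1` and `j = i + 1`.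
  · have h1 := congrArg Fin.val (hx h1)
    have h2 := congrArg Fin.val (hx h2)
    simp at h1 h2
    omega

lemma isClosedPath_iff {P : Graph α β} : P.IsClosedPath s ↔ P.CPath s V(P) E(P) := by
  constructor
  · rintro ⟨n, x, e, hn, rfl, hlast, hx, he, hV, hE, hl⟩
    obtain ⟨n, rfl⟩ : ∃ m, n = m + 1 := ⟨n - 1, by omega⟩
    -- Listing the vertices from the second one on moves the terminus to the end, so the closed path
    -- minus its first edge is an open path back to the terminus.
    have hinj : Function.Injective fun i : Fin (n + 1) => x i.succ := by
      intro i j hij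
      induction i using Fin.lastCases with
      | last =>
        induction j using Fin.lastCases with
        | last => rfl
        | cast j =>
          simp only [Fin.succ_last, hlast, Fin.succ_castSucc] at hij
          exact absurd (hx (a₁ := 0) (a₂ := j.succ) (by simpa using hij)) (Fin.succ_ne_zero j).symm
      | cast i =>
        induction j using Fin.lastCases with
        | last =>
          simp only [Fin.succ_last, hlast, Fin.succ_castSucc] at hij
          exact absurd (hx (a₁ := i.succ) (a₂ := 0) (by simpa using hij)) (Fin.succ_ne_zero i)
        | cast j =>
          simp only [Fin.succ_castSucc] at hij
          rw [Fin.succ_injective _ (hx hij)]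
    have h1 := oPath_of_seq n (fun i => x i.succ) (fun i => e i.succ) hinj
      (fun i => hV.symm.subset (Set.mem_range_self _)) fun i => by simpa using hl i.succ
    have h2 : Set.range x = Set.range fun i : Fin (n + 1) => x i.succ := by
      ext a
      constructor
      · rintro ⟨i, rfl⟩
        induction i using Fin.cases with
        | zero => exact ⟨Fin.last n, by simpa using hlast⟩
        | succ i => exact ⟨i, rfl⟩
      · rintro ⟨i, rfl⟩
        exact ⟨_, rfl⟩
    have h3 : Set.range e = insert (e 0) (Set.range fun i : Fin n => e i.succ) := by
      ext a; simp [Fin.exists_fin_succ, eq_comm]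
    refine ⟨e 0, x (Fin.succ 0), _, by simpa using hl 0, ?_, ?_, by rw [hE, h3]⟩
    · rw [hV, h2]
      simpa [hlast] using h1
    · rintro ⟨i, hi⟩
      exact Fin.succ_ne_zero i (he hi)
  · rintro ⟨e, y, ES', hl, hp, he, hE⟩
    obtain ⟨n, x, e', hx, h0, hn, hV, rfl, hlk⟩ := hp.exists_seq
    have hn' : ∀ i : Fin n, s ≠ x i.castSucc := by
      rintro i rfl
      exact (Fin.castSucc_lt_last i).ne (hx hn).symm
    have hl' : ∀ i : Fin (n + 1), P.IsLink ((Fin.cons e e' : Fin (n + 1) → β) i)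
        ((Fin.cons s x : Fin (n + 2) → α) i.castSucc)
        ((Fin.cons s x : Fin (n + 2) → α) i.succ) := by
      intro i
      induction i using Fin.cases with
      | zero => simpa [h0] using hl
      | succ j => simpa using hlk j
    refine ⟨n + 1, Fin.cons s x, Fin.cons e e', by simp, by simp, ?_, ?_, ?_, ?_, ?_, hl'⟩
    · rw [← Fin.succ_last]; simpa using hn
    · intro i j hij
      induction i using Fin.cases with
      | zero =>
        induction j using Fin.cases with
        | zero => rfl
        | succ j => exact absurd (by simpa using hij) (hn' j)
      | succ i =>
        induction j using Fin.cases with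
        | zero => exact absurd (by simpa using hij.symm) (hn' i)
        | succ j =>
          have := Fin.castSucc_injective _ (hx (a₁ := i.castSucc) (a₂ := j.castSucc) (by simpa using hij))
          rw [this]
    · exact Fin.cons_injective_iff.2 ⟨he, OPath.edge_injective hx hlk⟩
    · rw [Fin.range_cons, ← hV, Set.insert_eq_of_mem hp.right_mem]
    · rw [Fin.range_cons, hE]

end Graph

namespace Graph

variable {α : Type u} {β : Type v} {G H C : Graph α β} {e f g : β} {x y z s t : α}
  {X Y ES : Set β} {VS : Set α}

/-! ### Subgraphs that are paths or circles -/

/-- Restricting to `ES` and then inducing on `VS` loses no edge, because both ends of every edge of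
`ES` lie in `VS`. -/
lemma OPath.exists_subgraph (h : G.OPath s t VS ES) :
    ∃ P ≤ G, V(P) = VS ∧ E(P) = ES ∧ P.IsOpenPath s t := by
  have hle : (G.restrict ES).induce VS ≤ G :=
    (induce_le (by simpa using h.subset_vertexSet)).trans restrict_le
  have hE : E((G.restrict ES).induce VS) = ES := by
    ext e
    constructor
    · rintro ⟨a, b, hl, -⟩
      exact hl.1
    · intro he
      obtain ⟨a, b, hl⟩ := exists_isLink_of_mem_edgeSet (h.subset_edgeSet he)
      exact ⟨a, b, ⟨he, hl⟩, h.inc_mem he hl.inc_left, h.inc_mem he hl.inc_right⟩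
  refine ⟨_, hle, rfl, hE, isOpenPath_iff.2 ?_⟩
  rw [hE]
  exact h.anti hle subset_rfl hE.superset

lemma CPath.exists_subgraph (h : G.CPath s VS ES) :
    ∃ P ≤ G, V(P) = VS ∧ E(P) = ES ∧ P.IsClosedPath s := by
  have hle : (G.restrict ES).induce VS ≤ G :=
    (induce_le (by simpa using h.subset_vertexSet)).trans restrict_le
  have hE : E((G.restrict ES).induce VS) = ES := by
    ext e
    constructor
    · rintro ⟨a, b, hl, -⟩
      exact hl.1
    · intro he
      obtain ⟨a, b, hl⟩ := exists_isLink_of_mem_edgeSet (h.subset_edgeSet he)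
      exact ⟨a, b, ⟨he, hl⟩, h.inc_mem he hl.inc_left, h.inc_mem he hl.inc_right⟩
  refine ⟨_, hle, rfl, hE, isClosedPath_iff.2 ?_⟩
  rw [hE]
  exact h.anti hle subset_rfl hE.superset

lemma IsCircle.exists_cPath (hC : C.IsCircle) (hle : C ≤ G) : ∃ s, G.CPath s V(C) E(C) := by
  obtain ⟨s, hs⟩ := hC
  exact ⟨s, (isClosedPath_iff.1 hs).mono hle⟩

lemma IsCircle.finite (hC : C.IsCircle) : E(C).Finite := by
  obtain ⟨s, hs⟩ := hC
  exact (isClosedPath_iff.1 hs).finite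

lemma IsCircle.nonempty (hC : C.IsCircle) : E(C).Nonempty := by
  obtain ⟨s, hs⟩ := hC
  exact (isClosedPath_iff.1 hs).nonempty

lemma IsCircle.degIn_of_mem (hC : C.IsCircle) (hle : C ≤ G) (hx : x ∈ V(C)) :
    G.degIn E(C) x = 2 := by
  obtain ⟨s, hs⟩ := hC.exists_cPath hle
  exact hs.degIn_of_mem hx

lemma inc_mem_vertexSet_of_le (hle : H ≤ G) (he : e ∈ E(H)) (hi : G.Inc e x) : x ∈ V(H) :=
  ((IsSubgraph.inc_congr hle he).2 hi).vertex_mem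

lemma IsCircle.isConnected (hC : C.IsCircle) : C.IsConnected := by
  obtain ⟨s, hs⟩ := hC
  have h := isClosedPath_iff.1 hs
  exact ⟨⟨s, h.left_mem⟩, fun x hx y hy => (h.joined_left hx).symm.trans (h.joined_left hy)⟩

lemma IsOpenPath.isConnected {P : Graph α β} (hP : P.IsOpenPath s t) : P.IsConnected := by
  have h := isOpenPath_iff.1 hP
  exact ⟨⟨s, h.left_mem⟩, fun x hx y hy => (h.joined_left hx).symm.trans (h.joined_left hy)⟩

/-! ### Even edge sets -/

/-- A finite set of edges in which every vertex has even degree. -/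
structure IsEvenSet (G : Graph α β) (X : Set β) : Prop where
  subset : X ⊆ E(G)
  finite : X.Finite
  even : ∀ x, Even (G.degIn X x)

lemma IsEvenSet.mono (h : H.IsEvenSet X) (hle : H ≤ G) : G.IsEvenSet X where
  subset := h.subset.trans (IsSubgraph.edgeSet_mono hle)
  finite := h.finite
  even x := degIn_congr hle h.subset ▸ h.even x

lemma IsEvenSet.symmDiff (hX : G.IsEvenSet X) (hY : G.IsEvenSet Y) :
    G.IsEvenSet (symmDiff X Y) where
  subset := by
    rw [Set.symmDiff_def]
    exact Set.union_subset (Set.sdiff_subset.trans hX.subset) (Set.sdiff_subset.trans hY.subset)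
  finite := by
    rw [Set.symmDiff_def]
    exact (hX.finite.subset Set.sdiff_subset).union (hY.finite.subset Set.sdiff_subset)
  even x := by
    have h1 := degIn_diff (G := G) (x := x) hX.finite (Set.inter_subset_left (t := Y))
    have h2 := degIn_diff (G := G) (x := x) hY.finite (Set.inter_subset_right (s := X))
    rw [Set.sdiff_self_inter] at h1
    rw [Set.inter_comm, Set.sdiff_self_inter, Set.inter_comm] at h2
    have h3 := hX.even x
    have h4 := hY.even x
    rw [Set.symmDiff_def, degIn_union (hX.finite.subset Set.sdiff_subset)
      (hY.finite.subset Set.sdiff_subset) disjoint_sdiff_sdiff]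
    rw [Nat.even_iff] at *
    omega

lemma IsEvenSet.sdiff (hX : G.IsEvenSet X) (hY : G.IsEvenSet Y) (h : Y ⊆ X) :
    G.IsEvenSet (X \ Y) := by
  have := hX.symmDiff hY
  rwa [Set.symmDiff_def, Set.sdiff_eq_empty.2 h, Set.union_empty] at this

lemma CPath.isEvenSet (h : G.CPath s VS ES) : G.IsEvenSet ES where
  subset := h.subset_edgeSet
  finite := h.finite
  even x := by
    rw [h.degIn_eq]
    split_ifs <;> simp

lemma IsCircle.isEvenSet (hC : C.IsCircle) (hle : C ≤ G) : G.IsEvenSet E(C) := by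
  obtain ⟨s, hs⟩ := hC.exists_cPath hle
  exact hs.isEvenSet

lemma IsLink.finite_setOf_inc (h : G.IsLink e x y) : {z | G.Inc e z}.Finite :=
  ((Set.finite_singleton y).insert x).subset fun _ hz => hz.eq_or_eq_of_isLink h

/-- The ends of an edge of an even set are still joined, within the even set, after deletion of
that edge. -/
lemma IsEvenSet.joined (hX : G.IsEvenSet X) (he : e ∈ X) (hl : G.IsLink e x y) :
    (G.restrict (X \ {e})).Joined x y := by
  classical
  by_contra hc
  set K := G.restrict (X \ {e}) with hK
  have hfin : (⋃ f ∈ X, {z | G.Inc f z}).Finite := hX.finite.biUnion fun f hf => by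
    obtain ⟨a, b, hab⟩ := exists_isLink_of_mem_edgeSet (hX.subset hf)
    exact hab.finite_setOf_inc
  -- The ends of edges of `X` in the component of `x` after deletion of `e`; only these are taken
  -- because the vertex set need not be finite. The degree sum over `U` is even, every other edge
  -- has both or neither of its ends in `U`, and `e` has exactly one there: a contradiction.
  set U : Finset α := {z ∈ hfin.toFinset | K.Joined x z} with hU
  have hmem : ∀ f ∈ X, ∀ z, G.Inc f z → (z ∈ U ↔ K.Joined x z) := by
    intro f hf z hz
    simp only [hU, Finset.mem_filter, Set.Finite.mem_toFinset, Set.mem_iUnion, and_iff_right_iff_imp]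
    exact fun _ => ⟨f, hf, hz⟩
  have hsum : ∀ f a b, G.IsLink f a b →
      ∑ z ∈ U, G.mult f z = (if a ∈ U then 1 else 0) + if b ∈ U then 1 else 0 := by
    intro f a b hab
    simp_rw [hab.mult_eq, Finset.sum_add_distrib, Finset.sum_ite_eq']
  have h1 : Even (∑ z ∈ U, G.degIn X z) := Finset.even_sum _ fun z _ => hX.even z
  have h2 : ∀ z, G.degIn X z = ∑ f ∈ hX.finite.toFinset, G.mult f z := fun z =>
    finsum_mem_eq_finite_toFinset_sum _ hX.finite
  simp_rw [h2] at h1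
  rw [Finset.sum_comm, ← Finset.add_sum_erase _ _ ((Set.Finite.mem_toFinset _).2 he), hsum e x y hl,
    if_pos ((hmem e he x hl.inc_left).2 Relation.ReflTransGen.refl),
    if_neg (mt (hmem e he y hl.inc_right).1 hc)] at h1
  have h3 : Even (∑ f ∈ hX.finite.toFinset.erase e, ∑ z ∈ U, G.mult f z) := by
    refine Finset.even_sum _ fun f hf => ?_
    simp only [Finset.mem_erase, Set.Finite.mem_toFinset] at hf
    obtain ⟨a, b, hab⟩ := exists_isLink_of_mem_edgeSet (hX.subset hf.2)
    have hadj : K.Adj a b := ⟨f, ⟨hf.2, by simpa using hf.1⟩, hab⟩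
    rw [hsum f a b hab]
    have : a ∈ U ↔ b ∈ U := by
      rw [hmem f hf.2 a hab.inc_left, hmem f hf.2 b hab.inc_right]
      exact ⟨fun h => Relation.ReflTransGen.tail h hadj,
        fun h => Relation.ReflTransGen.tail h hadj.symm⟩
    by_cases ha : a ∈ U
    · simp [ha, this.1 ha]
    · simp [ha, mt this.2 ha]
  rw [Nat.even_iff] at h1 h3
  omega

/-- Each edge of an even set lies in a circle contained in the even set. -/
lemma IsEvenSet.exists_isCircle (hX : G.IsEvenSet X) (he : e ∈ X) :
    ∃ C ≤ G, C.IsCircle ∧ e ∈ E(C) ∧ E(C) ⊆ X := by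
  obtain ⟨x, y, hl⟩ := exists_isLink_of_mem_edgeSet (hX.subset he)
  obtain ⟨VS, ES, hp⟩ := (hX.joined he hl).symm.exists_oPath hl.right_mem
  have hES : ES ⊆ X \ {e} := hp.subset_edgeSet.trans (by simp [edgeSet_restrict])
  have hc : G.CPath x VS (insert e ES) :=
    ⟨e, y, ES, hl, hp.mono restrict_le, fun h => (hES h).2 rfl, rfl⟩
  obtain ⟨C, hC, -, hE, hcl⟩ := hc.exists_subgraph
  refine ⟨C, hC, ⟨x, hcl⟩, hE ▸ Set.mem_insert _ _, ?_⟩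
  rw [hE]
  exact Set.insert_subset he (hES.trans Set.sdiff_subset)

/-- A path joining the ends of `e` and avoiding `e` closes with `e` to an even set; conversely
`IsEvenSet.joined` gives such a path. With even sets in place of circles the criterion passes
directly through subdivisions. -/
lemma isIsthmus_iff : G.IsIsthmus e ↔ e ∈ E(G) ∧ ∀ X, G.IsEvenSet X → e ∉ X := by
  constructor
  · rintro ⟨he, h⟩
    refine ⟨he, fun X hX heX => ?_⟩
    obtain ⟨x, y, hl⟩ := exists_isLink_of_mem_edgeSet he
    refine h x y hl ((hX.joined heX hl).mono ?_)
    rw [← restrict_edgeSet_sdiff_eq_deleteEdges]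
    exact restrict_mono_right _ (Set.sdiff_subset_sdiff_left hX.subset)
  · rintro ⟨he, h⟩
    refine ⟨he, fun x y hl hj => ?_⟩
    obtain ⟨VS, ES, hp⟩ := hj.symm.exists_oPath (by simpa using hl.right_mem)
    refine h _ (CPath.isEvenSet
      ⟨e, y, ES, hl, hp.mono deleteEdges_le, fun h => ?_, rfl⟩) (Set.mem_insert _ _)
    simpa using (hp.subset_edgeSet h)

lemma IsIsthmus.notMem (h : G.IsIsthmus e) (hX : G.IsEvenSet X) : e ∉ X :=
  (isIsthmus_iff.1 h).2 X hX

lemma exists_isEvenSet_of_not_isIsthmus (he : e ∈ E(G)) (h : ¬ G.IsIsthmus e) :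
    ∃ X, G.IsEvenSet X ∧ e ∈ X := by
  by_contra! hc
  exact h (isIsthmus_iff.2 ⟨he, hc⟩)

lemma IsEvenSet.two_le (hX : G.IsEvenSet X) (he : e ∈ X) (hi : G.Inc e x) :
    2 ≤ G.degIn X x := by
  have h1 : 0 < G.degIn X x := (degIn_pos_iff hX.finite).2 ⟨e, he, hi⟩
  obtain ⟨k, hk⟩ := hX.even x
  omega

/-- If the degree of `x` in `Y` is `2`, then an even set contained in `Y` contains both or none of
the edges of `Y` at `x`. -/
lemma IsEvenSet.mem_of_degIn (hX : G.IsEvenSet X) (hY : Y.Finite) (h : X ⊆ Y)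
    (hd : G.degIn Y x ≤ 2) (he : e ∈ X) (hei : G.Inc e x) (hf : f ∈ Y) (hfi : G.Inc f x) : f ∈ X :=
  mem_of_degIn_le hY h (hd.trans (hX.two_le he hei)) hf hfi

/-- Circles are minimal nonempty even sets. -/
lemma IsCircle.eq_of_subset (hC : C.IsCircle) (hle : C ≤ G) (hX : G.IsEvenSet X)
    (hne : X.Nonempty) (h : X ⊆ E(C)) : X = E(C) := by
  obtain ⟨s, hs⟩ := hC.exists_cPath hle
  obtain ⟨e, he⟩ := hne
  refine h.antisymm fun f hf => ?_
  refine hs.propagate (Q := fun e => e ∈ X) (fun x hx _ e _ f hf hei hfi he => ?_) e (h he) f hf he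
  exact hX.mem_of_degIn hC.finite h (hs.degIn_of_mem hx).le he hei hf hfi

lemma IsCircle.mem_vertexSet_iff (hC : C.IsCircle) (hle : C ≤ G) :
    x ∈ V(C) ↔ ∃ e ∈ E(C), G.Inc e x := by
  constructor
  · intro hx
    rw [← degIn_pos_iff hC.finite, hC.degIn_of_mem hle hx]
    simp
  · rintro ⟨e, he, hi⟩
    exact inc_mem_vertexSet_of_le hle he hi

/-- A circle is determined by its edge set. -/
lemma IsCircle.ext {C' : Graph α β} (hC : C.IsCircle) (hC' : C'.IsCircle) (hle : C ≤ G)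
    (hle' : C' ≤ G) (h : E(C) = E(C')) : C = C' := by
  refine (Compatible.of_le_le hle hle').ext ?_ h
  ext x
  rw [hC.mem_vertexSet_iff hle, hC'.mem_vertexSet_iff hle', h]

lemma IsCircle.eq_of_edgeSet_subset {C' : Graph α β} (hC : C.IsCircle) (hC' : C'.IsCircle)
    (hle : C ≤ G) (hle' : C' ≤ G) (h : E(C) ⊆ E(C')) : C = C' :=
  hC.ext hC' hle hle' (hC'.eq_of_subset hle' (hC.isEvenSet hle) hC.nonempty h)

/-- Lying in a common circle is a transitive relation. -/
lemma exists_common_isCircle {C₁ C₂ : Graph α β} (h₁ : C₁ ≤ G)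
    (hC₁ : C₁.IsCircle) (h₂ : C₂ ≤ G) (hC₂ : C₂.IsCircle) (he : e ∈ E(C₁)) (hg : g ∈ E(C₂))
    (hne : (E(C₁) ∩ E(C₂)).Nonempty) : ∃ C ≤ G, C.IsCircle ∧ e ∈ E(C) ∧ g ∈ E(C) := by
  induction hn : (E(C₁) ∪ E(C₂)).ncard using Nat.strong_induction_on generalizing C₁ C₂ with
  | _ n ih =>
  have hfin : (E(C₁) ∪ E(C₂)).Finite := hC₁.finite.union hC₂.finite
  by_cases hg1 : g ∈ E(C₁)
  · exact ⟨C₁, h₁, hC₁, he, hg1⟩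
  by_cases he2 : e ∈ E(C₂)
  · exact ⟨C₂, h₂, hC₂, he2, hg⟩
  obtain ⟨f, hf1, hf2⟩ := hne
  -- The symmetric difference contains `e` and `g` but not `f`. By minimality of circles, a circle
  -- in it through `e` cannot lie inside `C₁` and so meets `C₂`; likewise one through `g` meets
  -- `C₁`.
  have hX : G.IsEvenSet (symmDiff E(C₁) E(C₂)) := (hC₁.isEvenSet h₁).symmDiff (hC₂.isEvenSet h₂)
  have hfX : f ∉ symmDiff E(C₁) E(C₂) := by simp [Set.mem_symmDiff, hf1, hf2]
  have hXsub : symmDiff E(C₁) E(C₂) ⊆ E(C₁) ∪ E(C₂) := fun a ha => by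
    rw [Set.mem_symmDiff] at ha
    exact ha.imp And.left And.left
  obtain ⟨C₃, h₃, hC₃, he3, hs3⟩ :=
    hX.exists_isCircle (e := e) (Set.mem_symmDiff.2 (Or.inl ⟨he, he2⟩))
  obtain ⟨C₄, h₄, hC₄, hg4, hs4⟩ :=
    hX.exists_isCircle (e := g) (Set.mem_symmDiff.2 (Or.inr ⟨hg, hg1⟩))
  have hmeet3 : (E(C₃) ∩ E(C₂)).Nonempty := by
    by_contra hc
    rw [Set.not_nonempty_iff_eq_empty] at hc
    have hsub : E(C₃) ⊆ E(C₁) := fun a ha => (hXsub (hs3 ha)).resolve_right fun h =>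
      Set.notMem_empty a (hc ▸ ⟨ha, h⟩)
    have := hC₁.eq_of_subset h₁ (hC₃.isEvenSet h₃) hC₃.nonempty hsub
    exact hfX (hs3 (this ▸ hf1))
  have hmeet4 : (E(C₄) ∩ E(C₁)).Nonempty := by
    by_contra hc
    rw [Set.not_nonempty_iff_eq_empty] at hc
    have hsub : E(C₄) ⊆ E(C₂) := fun a ha => (hXsub (hs4 ha)).resolve_left fun h =>
      Set.notMem_empty a (hc ▸ ⟨ha, h⟩)
    have := hC₂.eq_of_subset h₂ (hC₄.isEvenSet h₄) hC₄.nonempty hsub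
    exact hfX (hs4 (this ▸ hf2))
  have hsub32 : E(C₃) ∪ E(C₂) ⊆ E(C₁) ∪ E(C₂) :=
    Set.union_subset (hs3.trans hXsub) Set.subset_union_right
  -- If `C₃` and `C₂` cover less than `C₁` and `C₂`, induct on this pair. Otherwise `C₃` contains
  -- all of `C₁` outside `C₂`, so it meets `C₄`, and the pair `C₃`, `C₄` is smaller because it omits
  -- `f`.
  by_cases heq : E(C₃) ∪ E(C₂) = E(C₁) ∪ E(C₂)
  · obtain ⟨a, ha4, ha1⟩ := hmeet4
    have ha2 : a ∉ E(C₂) := by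
      have := hs4 ha4
      rw [Set.mem_symmDiff] at this
      tauto
    have ha3 : a ∈ E(C₃) := by
      have : a ∈ E(C₃) ∪ E(C₂) := heq ▸ Or.inl ha1
      exact this.resolve_right ha2
    refine ih _ ?_ h₃ hC₃ h₄ hC₄ he3 hg4 ⟨a, ha3, ha4⟩ rfl
    rw [← hn]
    refine Set.ncard_lt_ncard ⟨(Set.union_subset hs3 hs4).trans hXsub, fun h => ?_⟩ hfin
    exact hfX (Set.union_subset hs3 hs4 (h (Or.inl hf1)))
  · refine ih _ ?_ h₃ hC₃ h₂ hC₂ he3 hg hmeet3 rfl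
    rw [← hn]
    exact Set.ncard_lt_ncard (hsub32.ssubset_of_ne heq) hfin

/-- If the product of the signs is `1` on the circles in an even set, then so it is on the even
set. -/
lemma IsEvenSet.finprod_eq_one (σ : β → ℤˣ) (hX : G.IsEvenSet X)
    (h : ∀ C ≤ G, C.IsCircle → E(C) ⊆ X → ∏ᶠ e ∈ E(C), σ e = 1) : ∏ᶠ e ∈ X, σ e = 1 := by
  induction hn : X.ncard using Nat.strong_induction_on generalizing X with
  | _ n ih =>
  rcases X.eq_empty_or_nonempty with rfl | ⟨e, he⟩
  · exact finprod_mem_empty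
  · obtain ⟨C, hC, hcirc, heC, hCX⟩ := hX.exists_isCircle he
    have h1 : ∏ᶠ e ∈ X \ E(C), σ e = 1 := by
      refine ih _ ?_ (hX.sdiff (hcirc.isEvenSet hC) hCX)
        (fun C' h1 h2 h3 => h C' h1 h2 (h3.trans Set.sdiff_subset)) rfl
      rw [← hn]
      exact Set.ncard_lt_ncard ⟨Set.sdiff_subset, fun h => (h he).2 heC⟩ hX.finite
    rw [← Set.union_sdiff_cancel hCX, finprod_mem_union Set.disjoint_sdiff_right hcirc.finite
      (hX.finite.subset Set.sdiff_subset), h1, h C hC hcirc hCX, one_mul]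

end Graph

namespace SignedGraph

open Graph

variable {α : Type u} {β : Type v} {S : SignedGraph α β} {X : Set β}

lemma Balanced.finprod_eq_one (h : S.Balanced) (hX : S.graph.IsEvenSet X) :
    ∏ᶠ e ∈ X, S.sign e = 1 :=
  hX.finprod_eq_one _ fun C hC hcirc _ => h C hC hcirc

end SignedGraph

namespace Graph

variable {α : Type u} {β : Type v} {G H B C : Graph α β} {e f g : β} {x y z s t : α}
  {X Y ES : Set β} {VS : Set α}

/-! ### Blocks -/

lemma exists_union {H₁ H₂ : Graph α β} (h₁ : H₁ ≤ G) (h₂ : H₂ ≤ G) :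
    ∃ U ≤ G, V(U) = V(H₁) ∪ V(H₂) ∧ E(U) = E(H₁) ∪ E(H₂) ∧ H₁ ≤ U ∧ H₂ ≤ U := by
  have hU : (G.restrict (E(H₁) ∪ E(H₂))).induce (V(H₁) ∪ V(H₂)) ≤ G :=
    (induce_le (by simpa using ⟨h₁.vertexSet_mono, h₂.vertexSet_mono⟩)).trans restrict_le
  have hE : E((G.restrict (E(H₁) ∪ E(H₂))).induce (V(H₁) ∪ V(H₂))) = E(H₁) ∪ E(H₂) := by
    ext e
    constructor
    · rintro ⟨a, b, hl, -⟩
      exact hl.1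
    · rintro (he | he)
      · obtain ⟨a, b, hl⟩ := exists_isLink_of_mem_edgeSet he
        exact ⟨a, b, ⟨Or.inl he, hl.mono h₁⟩, Or.inl hl.left_mem, Or.inl hl.right_mem⟩
      · obtain ⟨a, b, hl⟩ := exists_isLink_of_mem_edgeSet he
        exact ⟨a, b, ⟨Or.inr he, hl.mono h₂⟩, Or.inr hl.left_mem, Or.inr hl.right_mem⟩
  refine ⟨_, hU, rfl, hE, ?_, ?_⟩
  · exact (Compatible.of_le_le h₁ hU).le_iff.2 ⟨Set.subset_union_left, by
      rw [hE]; exact Set.subset_union_left⟩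
  · exact (Compatible.of_le_le h₂ hU).le_iff.2 ⟨Set.subset_union_right, by
      rw [hE]; exact Set.subset_union_right⟩

lemma IsConnected.union {H₁ H₂ U : Graph α β} (hc₁ : H₁.IsConnected) (hc₂ : H₂.IsConnected)
    (h₁ : H₁ ≤ U) (h₂ : H₂ ≤ U) (hV : V(U) = V(H₁) ∪ V(H₂)) (hx₁ : x ∈ V(H₁)) (hx₂ : x ∈ V(H₂)) :
    U.IsConnected := by
  have key : ∀ y ∈ V(U), U.Joined x y := by
    intro y hy
    rw [hV] at hy
    rcases hy with hy | hy
    · exact (hc₁.2 x hx₁ y hy).mono h₁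
    · exact (hc₂.2 x hx₂ y hy).mono h₂
  exact ⟨⟨x, h₁.vertexSet_mono hx₁⟩, fun y hy z hz => (key y hy).symm.trans (key z hz)⟩

lemma IsConnected.exists_inc (hc : H.IsConnected) (hne : E(H).Nonempty) (hx : x ∈ V(H)) :
    ∃ e ∈ E(H), H.Inc e x := by
  obtain ⟨e, he⟩ := hne
  obtain ⟨a, b, hl⟩ := exists_isLink_of_mem_edgeSet he
  rcases Relation.ReflTransGen.cases_head (hc.2 x hx a hl.left_mem) with rfl | ⟨c, ⟨f, hf⟩, -⟩
  · exact ⟨e, he, hl.inc_left⟩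
  · exact ⟨f, hf.edge_mem, hf.inc_left⟩

/-- Ensures that maximal subgraphs, hence blocks, exist; a subgraph is determined by its vertex set
and edge set. -/
lemma finite_setOf_le (hV : V(G).Finite) (hE : E(G).Finite) : {H | H ≤ G}.Finite := by
  have hfin : (V(G).powerset ×ˢ E(G).powerset).Finite := hV.powerset.prod hE.powerset
  refine Set.Finite.of_finite_image (f := fun H : Graph α β => (V(H), E(H)))
    (hfin.subset ?_) ?_
  · rintro _ ⟨H, hH, rfl⟩
    exact ⟨IsSubgraph.vertexSet_mono hH, IsSubgraph.edgeSet_mono hH⟩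
  · intro H hH H' hH' h
    simp only [Prod.mk.injEq] at h
    exact (Compatible.of_le_le hH hH').ext h.1 h.2

lemma IsBlock.le (hB : G.IsBlock B) : B ≤ G := (Maximal.prop hB).1

lemma IsBlock.isConnected (hB : G.IsBlock B) : B.IsConnected := (Maximal.prop hB).2.1

lemma IsBlock.exists_isCircle (hB : G.IsBlock B) (he : e ∈ E(B)) (hf : f ∈ E(B)) (hef : e ≠ f) :
    ∃ C ≤ G, C.IsCircle ∧ e ∈ E(C) ∧ f ∈ E(C) := (Maximal.prop hB).2.2 e he f hf hef

/-- Every circle is contained in a nontrivial block. -/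
lemma IsCircle.exists_isNontrivialBlock (hV : V(G).Finite) (hE : E(G).Finite) (hC : C.IsCircle)
    (hle : C ≤ G) : ∃ B, G.IsNontrivialBlock B ∧ C ≤ B := by
  have hfin : {H : Graph α β | H ≤ G ∧ H.IsConnected ∧ ∀ e ∈ E(H), ∀ f ∈ E(H), e ≠ f →
      ∃ C ≤ G, C.IsCircle ∧ e ∈ E(C) ∧ f ∈ E(C)}.Finite :=
    (finite_setOf_le hV hE).subset fun H hH => hH.1
  have hmem : C ∈ {H : Graph α β | H ≤ G ∧ H.IsConnected ∧ ∀ e ∈ E(H), ∀ f ∈ E(H), e ≠ f →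
      ∃ C ≤ G, C.IsCircle ∧ e ∈ E(C) ∧ f ∈ E(C)} :=
    ⟨hle, hC.isConnected, fun e he f hf _ => ⟨C, hle, hC, he, hf⟩⟩
  obtain ⟨B, hCB, hB⟩ := hfin.exists_le_maximal hmem
  exact ⟨B, ⟨hB, C, hCB, hC⟩, hCB⟩

/-- A block contains every circle with which it has a common edge. -/
lemma IsBlock.circle_le (hB : G.IsBlock B) (hC : C.IsCircle) (hle : C ≤ G)
    (he : e ∈ E(B)) (heC : e ∈ E(C)) : C ≤ B := by
  obtain ⟨U, hU, hVU, hEU, hBU, hCU⟩ := exists_union hB.le hle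
  obtain ⟨x, y, hl⟩ := exists_isLink_of_mem_edgeSet he
  have hxC : x ∈ V(C) := inc_mem_vertexSet_of_le hle heC (hl.mono hB.le).inc_left
  -- Transitivity of the common-circle relation, through `e`, makes the union of `B` and `C` satisfy
  -- the block condition; maximality of `B` then absorbs `C`.
  have hmix : ∀ f ∈ E(B), ∀ g ∈ E(C), ∃ C' ≤ G, C'.IsCircle ∧ f ∈ E(C') ∧ g ∈ E(C') := by
    intro f hf g hg
    by_cases hfe : f = e
    · subst hfe
      exact ⟨C, hle, hC, heC, hg⟩
    · obtain ⟨D, hD, hDc, hfD, heD⟩ := hB.exists_isCircle hf he hfe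
      exact exists_common_isCircle hD hDc hle hC hfD hg ⟨e, heD, heC⟩
  refine hCU.trans (Maximal.le_of_ge hB ⟨hU,
    hB.isConnected.union hC.isConnected hBU hCU hVU hl.left_mem hxC, ?_⟩ hBU)
  rw [hEU]
  rintro f (hf | hf) g (hg | hg) hfg
  · exact hB.exists_isCircle hf hg hfg
  · exact hmix f hf g hg
  · obtain ⟨C', h1, h2, h3, h4⟩ := hmix g hg f hf
    exact ⟨C', h1, h2, h4, h3⟩
  · exact ⟨C, hle, hC, hf, hg⟩

/-- The block condition speaks of distinct edges only. The circle contained in the block either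
contains `e` or supplies a second edge to pair with it. -/
lemma IsNontrivialBlock.exists_isCircle (hB : G.IsNontrivialBlock B) (he : e ∈ E(B)) :
    ∃ C ≤ G, C.IsCircle ∧ e ∈ E(C) := by
  obtain ⟨hB, C, hC, hcirc⟩ := hB
  obtain ⟨f, hf⟩ := hcirc.nonempty
  by_cases hef : e = f
  · exact ⟨C, hC.trans hB.le, hcirc, hef ▸ hf⟩
  · obtain ⟨D, hD, hDc, h1, -⟩ := hB.exists_isCircle he (IsSubgraph.edgeSet_mono hC hf) hef
    exact ⟨D, hD, hDc, h1⟩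

/-- Any two edges of a nontrivial block lie in a common circle. -/
lemma IsNontrivialBlock.exists_common_isCircle (hB : G.IsNontrivialBlock B) (he : e ∈ E(B))
    (hf : f ∈ E(B)) : ∃ C ≤ G, C.IsCircle ∧ e ∈ E(C) ∧ f ∈ E(C) := by
  by_cases hef : e = f
  · subst hef
    obtain ⟨C, h1, h2, h3⟩ := hB.exists_isCircle he
    exact ⟨C, h1, h2, h3, h3⟩
  · exact hB.1.exists_isCircle he hf hef

end Graph

/-! ### Paths and circles with their termini inside an ambient graph -/

namespace PathOrCircle

open Graph

variable {α : Type u} {β : Type v} {G : Graph α β} {P : PathOrCircle α β} {x : α}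

lemma IsOpenPath.exists_oPath (h : P.IsOpenPath) (hle : P.graph ≤ G) :
    ∃ s t, G.OPath s t V(P.graph) E(P.graph) ∧ P.termini = {s, t} := by
  obtain ⟨s, t, h, ht⟩ := h
  exact ⟨s, t, (isOpenPath_iff.1 h).mono hle, ht⟩

lemma IsClosedPath.exists_cPath (h : P.IsClosedPath) (hle : P.graph ≤ G) :
    ∃ s, G.CPath s V(P.graph) E(P.graph) ∧ P.termini = {s} := by
  obtain ⟨s, h, ht⟩ := h
  exact ⟨s, (isClosedPath_iff.1 h).mono hle, ht⟩

lemma IsClosedPath.isCircle_graph (h : P.IsClosedPath) : P.graph.IsCircle := by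
  obtain ⟨s, h, -⟩ := h
  exact ⟨s, h⟩

lemma termini_subset (h : P.IsPath ∨ P.IsCircle) : P.termini ⊆ V(P.graph) := by
  rcases h with (h | h) | h
  · obtain ⟨s, t, h, ht⟩ := h.exists_oPath le_rfl
    rw [ht]
    exact Set.insert_subset h.left_mem (Set.singleton_subset_iff.2 h.right_mem)
  · obtain ⟨s, h, ht⟩ := h.exists_cPath le_rfl
    rw [ht]
    exact Set.singleton_subset_iff.2 h.left_mem
  · rw [h.2]
    exact Set.empty_subset _

lemma edge_finite (h : P.IsPath ∨ P.IsCircle) : E(P.graph).Finite := by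
  rcases h with (h | h) | h
  · obtain ⟨s, t, h, ht⟩ := h.exists_oPath le_rfl
    exact h.finite
  · exact h.isCircle_graph.finite
  · exact h.1.finite

lemma degIn_internal (h : P.IsPath ∨ P.IsCircle) (hle : P.graph ≤ G) (hx : x ∈ P.internal) :
    G.degIn E(P.graph) x = 2 := by
  rcases h with (h | h) | h
  · obtain ⟨s, t, h, ht⟩ := h.exists_oPath hle
    have h1 := hx.2
    rw [ht, Set.mem_insert_iff, Set.mem_singleton_iff, not_or] at h1
    exact h.degIn_internal hx.1 h1.1 h1.2
  · exact h.isCircle_graph.degIn_of_mem hle hx.1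
  · exact h.1.degIn_of_mem hle hx.1

/-- A predicate on edges that is preserved at internal vertices is constant along a path or
circle. -/
lemma propagate {Q : β → Prop} (h : P.IsPath ∨ P.IsCircle) (hle : P.graph ≤ G)
    (hQ : ∀ x ∈ P.internal, ∀ e ∈ E(P.graph), ∀ f ∈ E(P.graph), G.Inc e x → G.Inc f x → Q e → Q f) :
    ∀ e ∈ E(P.graph), ∀ f ∈ E(P.graph), Q e → Q f := by
  rcases h with (h | h) | h
  · obtain ⟨s, t, h, ht⟩ := h.exists_oPath hle
    exact h.propagate fun x hx hs ht' => hQ x ⟨hx, by simp [ht, hs, ht']⟩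
  · obtain ⟨s, h, ht⟩ := h.exists_cPath hle
    exact h.propagate fun x hx hs => hQ x ⟨hx, by simp [ht, hs]⟩
  · obtain ⟨s, hs⟩ := h.1.exists_cPath hle
    exact hs.propagate fun x hx _ => hQ x ⟨hx, by simp [h.2]⟩

lemma exists_inc (h : (P.IsPath ∧ P.Nontrivial) ∨ P.IsCircle) (hx : x ∈ V(P.graph)) :
    ∃ e ∈ E(P.graph), P.graph.Inc e x := by
  rcases h with ⟨⟨s, t, h, ht⟩ | h, hn⟩ | h
  · exact h.isConnected.exists_inc hn hx
  · exact h.isCircle_graph.isConnected.exists_inc hn hx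
  · exact h.1.isConnected.exists_inc h.1.nonempty hx

end PathOrCircle

namespace Graph

variable {α : Type u} {β : Type v} {G H : Graph α β} {e f : β} {x y z s t w : α}
  {W : Set α} {T : α → Set β} {D : Set (PathOrCircle α β)} {P Q : PathOrCircle α β}

/-! ### Decomposition into paths and circles -/

/-- `D` is a decomposition of `H` into nontrivial paths and circles. At the internal vertices, which
belong to `W`, these pass through the edges prescribed by `T`, and at a terminus in `W` they do not
use these edges. -/
structure IsDecomposition (H : Graph α β) (W : Set α) (T : α → Set β)
    (D : Set (PathOrCircle α β)) : Prop where
  le : ∀ P ∈ D, P.graph ≤ H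
  path_or_circle : ∀ P ∈ D, (P.IsPath ∧ P.Nontrivial) ∨ P.IsCircle
  disjoint : D.PairwiseDisjoint fun P => E(P.graph)
  cover : (⋃ P ∈ D, E(P.graph)) = E(H)
  internal : ∀ P ∈ D, ∀ x ∈ P.internal, x ∈ W ∧ ∀ e ∈ E(P.graph), H.Inc e x → e ∈ T x
  terminus : ∀ P ∈ D, ∀ x ∈ P.termini, x ∈ W → ∀ e ∈ E(P.graph), H.Inc e x → e ∉ T x

/-- The edges prescribed at the vertices of `W` form pairs of edge ends, and an edge at a vertex of
`W` that is not prescribed lies in no circle. -/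
structure IsTransition (H : Graph α β) (W : Set α) (T : α → Set β) : Prop where
  inc : ∀ w ∈ W, ∀ e ∈ T w, H.Inc e w
  degIn_eq : ∀ w ∈ W, H.degIn (T w) w = 2
  notMem : ∀ w ∈ W, ∀ c, H.Inc c w → c ∉ T w → ∀ X, H.IsEvenSet X → c ∉ X

lemma IsTransition.mono {W' : Set α} (h : H.IsTransition W T) (hW : W' ⊆ W) :
    H.IsTransition W' T :=
  ⟨fun w hw => h.inc w (hW hw), fun w hw => h.degIn_eq w (hW hw),
    fun w hw => h.notMem w (hW hw)⟩

lemma IsTransition.finite (h : H.IsTransition W T) (hw : w ∈ W) : (T w).Finite := by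
  by_contra hc
  have hsupp : (T w ∩ Function.support fun e => H.mult e w) = T w := by
    rw [Set.inter_eq_left]
    intro e he
    exact (h.inc w hw e he).mult_pos.ne'
  -- All terms are nonzero, so for infinite `T w` the finite-support sum takes its default value 0,
  -- not 2.
  have h0 : H.degIn (T w) w = 0 := finsum_mem_eq_zero_of_infinite (by rwa [hsupp])
  rw [h.degIn_eq w hw] at h0
  omega

lemma IsTransition.nonempty (h : H.IsTransition W T) (hw : w ∈ W) : (T w).Nonempty := by
  rw [Set.nonempty_iff_ne_empty]
  intro h0
  have := h.degIn_eq w hw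
  simp [h0] at this

namespace IsDecomposition

lemma path_or_circle' (hD : H.IsDecomposition W T D) (hP : P ∈ D) : P.IsPath ∨ P.IsCircle :=
  (hD.path_or_circle P hP).imp And.left id

/-- The member uses two edge ends at `x`, all of them prescribed, and only two are prescribed. -/
lemma subset_of_internal (hD : H.IsDecomposition W T D) (hT : H.IsTransition W T) (hP : P ∈ D)
    (hx : x ∈ P.internal) : T x ⊆ E(P.graph) := by
  obtain ⟨hxW, h⟩ := hD.internal P hP x hx
  intro e he
  have h1 : H.degIn (E(P.graph) ∩ T x) x = H.degIn E(P.graph) x :=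
    degIn_congr_set fun e hi => ⟨And.left, fun he => ⟨he, h e he hi⟩⟩
  rw [PathOrCircle.degIn_internal (hD.path_or_circle' hP) (hD.le P hP) hx] at h1
  exact (mem_of_degIn_le (hT.finite hxW) Set.inter_subset_right
    (by rw [h1, hT.degIn_eq x hxW]) he (hT.inc x hxW e he)).1

lemma eq_of_mem (hD : H.IsDecomposition W T D) (hP : P ∈ D) (hQ : Q ∈ D) (heP : e ∈ E(P.graph))
    (heQ : e ∈ E(Q.graph)) : P = Q := by
  by_contra h
  exact Set.disjoint_left.1 (hD.disjoint hP hQ h) heP heQ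

/-- At an internal vertex of one member, no other member is internal. -/
lemma eq_of_internal (hD : H.IsDecomposition W T D) (hT : H.IsTransition W T) (hP : P ∈ D)
    (hQ : Q ∈ D) (hxP : x ∈ P.internal) (hxQ : x ∈ Q.internal) : P = Q := by
  obtain ⟨e, he⟩ := hT.nonempty (hD.internal P hP x hxP).1
  exact hD.eq_of_mem hP hQ (hD.subset_of_internal hT hP hxP he)
    (hD.subset_of_internal hT hQ hxQ he)

lemma isPath_of_mem_termini (hD : H.IsDecomposition W T D) (hP : P ∈ D) (hx : x ∈ P.termini) :
    P.IsPath := by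
  rcases hD.path_or_circle P hP with h | h
  · exact h.1
  · rw [h.2] at hx
    exact absurd hx (Set.notMem_empty x)

/-- The bookkeeping common to all gluings at `w`: the members in `A` are merged into `Q`. Since `Q`
takes all of `T w`, the other members automatically satisfy the terminus condition at the new vertex
`w`. -/
lemma replace (hD : H.IsDecomposition W T D) {A : Set (PathOrCircle α β)} (hA : A ⊆ D)
    (hle : Q.graph ≤ H) (hpc : (Q.IsPath ∧ Q.Nontrivial) ∨ Q.IsCircle)
    (hE : E(Q.graph) = ⋃ P ∈ A, E(P.graph)) (hTw : T w ⊆ E(Q.graph))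
    (hint : ∀ x ∈ Q.internal, x ∈ insert w W ∧ ∀ e ∈ E(Q.graph), H.Inc e x → e ∈ T x)
    (hterm : ∀ x ∈ Q.termini, x ∈ insert w W → ∀ e ∈ E(Q.graph), H.Inc e x → e ∉ T x) :
    H.IsDecomposition (insert w W) T (insert Q (D \ A)) := by
  have hdis : ∀ P ∈ D \ A, Disjoint E(P.graph) E(Q.graph) := by
    intro P hP
    rw [hE, Set.disjoint_iUnion₂_right]
    intro R hR
    exact hD.disjoint hP.1 (hA hR) fun h => hP.2 (h ▸ hR)
  refine ⟨?_, ?_, ?_, ?_, ?_, ?_⟩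
  · rintro P (rfl | hP)
    exacts [hle, hD.le P hP.1]
  · rintro P (rfl | hP)
    exacts [hpc, hD.path_or_circle P hP.1]
  · refine Set.PairwiseDisjoint.insert (hD.disjoint.subset Set.sdiff_subset) fun P hP _ => ?_
    exact (hdis P hP).symm
  · rw [Set.biUnion_insert, hE, ← Set.biUnion_union, Set.union_sdiff_cancel hA, hD.cover]
  · rintro P (rfl | hP) x hx
    · exact hint x hx
    · exact (hD.internal P hP.1 x hx).imp_left Or.inr
  · rintro P (rfl | hP) x hx hxW e he hi
    · exact hterm x hx hxW e he hi
    · rcases hxW with rfl | hxW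
      · exact fun hT => Set.disjoint_left.1 (hdis P hP) he (hTw hT)
      · exact hD.terminus P hP.1 x hx hxW e he hi

/-- The start of the gluing process: each edge is a path of its own, closed if it is a loop, with no
internal vertex. -/
lemma singletons (H : Graph α β) (T : α → Set β) : ∃ D, H.IsDecomposition ∅ T D := by
  have key : ∀ e : E(H), ∃ P : PathOrCircle α β, P.graph ≤ H ∧ P.IsPath ∧ E(P.graph) = {e.1} ∧
      V(P.graph) ⊆ P.termini := by
    rintro ⟨e, he⟩
    obtain ⟨x, y, hl⟩ := exists_isLink_of_mem_edgeSet he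
    by_cases hxy : x = y
    · subst hxy
      have hc : H.CPath x {x} {e} :=
        ⟨e, x, ∅, hl, OPath.nil hl.left_mem, by simp, by simp⟩
      obtain ⟨P, hP, hV, hE, hcl⟩ := hc.exists_subgraph
      exact ⟨⟨P, {x}⟩, hP, Or.inr ⟨x, hcl, rfl⟩, hE, hV.subset⟩
    · have hp := OPath.cons hl (OPath.nil hl.right_mem) (by simpa using hxy)
      obtain ⟨P, hP, hV, hE, hop⟩ := hp.exists_subgraph
      exact ⟨⟨P, {x, y}⟩, hP, Or.inl ⟨x, y, hop, rfl⟩, by simpa using hE, hV.subset⟩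
  choose f hle hpath hE hV using key
  refine ⟨Set.range f, ?_, ?_, ?_, ?_, ?_, ?_⟩
  · rintro _ ⟨e, rfl⟩
    exact hle e
  · rintro _ ⟨e, rfl⟩
    exact Or.inl ⟨hpath e, by rw [PathOrCircle.Nontrivial, hE]; simp⟩
  · rintro _ ⟨e, rfl⟩ _ ⟨e', rfl⟩ hne
    change Disjoint E((f e).graph) E((f e').graph)
    rw [hE, hE, Set.disjoint_singleton]
    exact fun h => hne (congrArg f (Subtype.ext h))
  · ext e
    simp [hE]
  · rintro _ ⟨e, rfl⟩ x hx
    exact absurd (hV e hx.1) hx.2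
  · rintro _ ⟨e, rfl⟩ x hx h
    exact absurd h (Set.notMem_empty x)

/-- The end of one member cannot be an internal vertex of another if both start at the same
vertex. -/
lemma ne_terminus_of_internal (hD : H.IsDecomposition W T D) (hT : H.IsTransition W T)
    (hP : P ∈ D) (hQ : Q ∈ D) (hPQ : P ≠ Q) (hpP : H.OPath w t V(P.graph) E(P.graph))
    (hpQ : H.OPath w s V(Q.graph) E(Q.graph)) (hw : w ≠ s) (hz : s ∈ P.internal) : False := by
  obtain ⟨hsW, -⟩ := hD.internal P hP s hz
  obtain ⟨c, hc, hci⟩ := hpQ.symm.exists_inc_left hw.symm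
  have hcT : c ∉ T s := fun h => hPQ (hD.eq_of_mem hP hQ (hD.subset_of_internal hT hP hz h) hc)
  obtain ⟨V₁, E₁, -, hE₁, hp₁⟩ := hpP.exists_prefix hz.1
  have hdis : Disjoint E₁ E(Q.graph) := (hD.disjoint hP hQ hPQ).mono_left hE₁
  -- The part of `P` from `w` to `s` and the whole of `Q` have the same ends and no common edge.
  -- Their union is even, even if they meet elsewhere, and contains the edge `c` at `s` that is not
  -- prescribed.
  refine hT.notMem s hsW c hci hcT (E₁ ∪ E(Q.graph)) ⟨?_, ?_, fun x => ?_⟩ (Or.inr hc)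
  · exact Set.union_subset hp₁.subset_edgeSet hpQ.subset_edgeSet
  · exact hp₁.finite.union hpQ.finite
  · rw [degIn_union hp₁.finite hpQ.finite hdis]
    have h1 := hp₁.degIn_add x
    have h2 := hpQ.degIn_add x
    rw [Nat.even_iff]
    split_ifs at h1 h2 <;> omega

/-- This makes the union of `P` and `Q` a path: besides `w`, they can share only their far ends. A
vertex internal to both would put the same prescribed edges into both, and one internal to just one
is excluded by `ne_terminus_of_internal`. -/
lemma eq_termini_of_common (hD : H.IsDecomposition W T D) (hT : H.IsTransition W T)
    (hP : P ∈ D) (hQ : Q ∈ D) (hPQ : P ≠ Q) (hpP : H.OPath w t V(P.graph) E(P.graph))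
    (htP : P.termini = {w, t}) (hpQ : H.OPath w s V(Q.graph) E(Q.graph)) (htQ : Q.termini = {w, s})
    (hzP : z ∈ V(P.graph)) (hzQ : z ∈ V(Q.graph)) (hzw : z ≠ w) : z = t ∧ z = s := by
  by_cases h1 : z = t <;> by_cases h2 : z = s
  · exact ⟨h1, h2⟩
  · subst h1
    exact (hD.ne_terminus_of_internal hT hQ hP hPQ.symm hpQ hpP hzw.symm
      ⟨hzQ, by simp [htQ, hzw, h2]⟩).elim
  · subst h2
    exact (hD.ne_terminus_of_internal hT hP hQ hPQ hpP hpQ hzw.symm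
      ⟨hzP, by simp [htP, hzw, h1]⟩).elim
  · exact absurd (hD.eq_of_internal hT hP hQ ⟨hzP, by simp [htP, hzw, h1]⟩
      ⟨hzQ, by simp [htQ, hzw, h2]⟩) hPQ

/-- A member that passes a vertex of `W` twice becomes a circle. -/
lemma exists_insert_of_closed (hD : H.IsDecomposition W T D) (hT : H.IsTransition (insert w W) T)
    (hP : P ∈ D) (hcl : H.CPath w V(P.graph) E(P.graph)) (ht : P.termini = {w}) :
    ∃ D', H.IsDecomposition (insert w W) T D' := by
  -- A closed path is an even set, so none of its edges at `w` can be unprescribed.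
  have hwT : ∀ c ∈ E(P.graph), H.Inc c w → c ∈ T w := by
    intro c hc hi
    by_contra hcT
    exact hT.notMem w (Set.mem_insert _ _) c hi hcT _ hcl.isEvenSet hc
  have h1 : H.degIn (E(P.graph) ∩ T w) w = H.degIn E(P.graph) w :=
    degIn_congr_set fun e hi => ⟨And.left, fun he => ⟨he, hwT e he hi⟩⟩
  rw [hcl.degIn_of_mem hcl.left_mem] at h1
  have hTsub : T w ⊆ E(P.graph) := fun c hc =>
    (mem_of_degIn_le (hT.finite (Set.mem_insert _ _)) Set.inter_subset_right
      (by rw [h1, hT.degIn_eq w (Set.mem_insert _ _)]) hc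
      (hT.inc w (Set.mem_insert _ _) c hc)).1
  -- The graph stays the same; only the terminus is forgotten.
  refine ⟨_, hD.replace (A := {P}) (Q := ⟨P.graph, ∅⟩) (by simpa using hP) (hD.le P hP)
    (Or.inr ⟨⟨w, isClosedPath_iff.2 (hcl.anti (hD.le P hP) subset_rfl subset_rfl)⟩, rfl⟩)
    (by simp) hTsub ?_ ?_⟩
  · rintro x ⟨hx, -⟩
    by_cases hxw : x = w
    · subst hxw
      exact ⟨Or.inl rfl, hwT⟩
    · exact (hD.internal P hP x ⟨hx, by simpa [ht] using hxw⟩).imp_left Or.inr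
  · intro x hx
    exact absurd hx (Set.notMem_empty x)

/-- Two members ending at `w` in different prescribed edges are concatenated there. -/
lemma exists_insert_of_open (hD : H.IsDecomposition W T D) (hT : H.IsTransition (insert w W) T)
    (hwW : w ∉ W) (hP : P ∈ D) (hQ : Q ∈ D) (hPQ : P ≠ Q)
    (hpP : H.OPath w t V(P.graph) E(P.graph)) (htP : P.termini = {w, t})
    (hpQ : H.OPath w s V(Q.graph) E(Q.graph)) (htQ : Q.termini = {w, s}) (hwt : w ≠ t) (hws : w ≠ s)
    (he : e ∈ T w) (heP : e ∈ E(P.graph)) (hf : f ∈ T w) (hfQ : f ∈ E(Q.graph)) :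
    ∃ D', H.IsDecomposition (insert w W) T D' := by
  have hw := Set.mem_insert w W
  have hT' := hT.mono (Set.subset_insert w W)
  have hdis : Disjoint E(P.graph) E(Q.graph) := hD.disjoint hP hQ hPQ
  have hef : e ≠ f := fun h => hPQ (hD.eq_of_mem hP hQ heP (h ▸ hfQ))
  have hcommon := fun z hzP hzQ hzw =>
    hD.eq_termini_of_common hT' hP hQ hPQ hpP htP hpQ htQ (z := z) hzP hzQ hzw
  have hei := hT.inc w hw e he
  have hfi := hT.inc w hw f hf
  have hTw : T w = {e, f} := by
    have hsub : {e, f} ⊆ T w := Set.insert_subset he (Set.singleton_subset_iff.2 hf)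
    refine subset_antisymm (fun c hc => ?_) hsub
    refine mem_of_degIn_le (hT.finite hw) hsub ?_ hc (hT.inc w hw c hc)
    rw [hT.degIn_eq w hw, degIn_pair hef]
    exact Nat.add_le_add hei.mult_pos hfi.mult_pos
  have hwP : ∀ c ∈ E(P.graph), H.Inc c w → c = e := by
    intro c hc hi
    refine mem_of_degIn_le (X := {e}) hpP.finite (by simpa using heP) ?_ hc hi
    rw [hpP.degIn_left hwt, degIn_singleton]
    exact hei.mult_pos
  have hwQ : ∀ c ∈ E(Q.graph), H.Inc c w → c = f := by
    intro c hc hi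
    refine mem_of_degIn_le (X := {f}) hpQ.finite (by simpa using hfQ) ?_ hc hi
    rw [hpQ.degIn_left hws, degIn_singleton]
    exact hfi.mult_pos
  have hA : ({P, Q} : Set (PathOrCircle α β)) ⊆ D :=
    Set.insert_subset hP (Set.singleton_subset_iff.2 hQ)
  obtain ⟨R, hR, hVR, hER, htR, hpR⟩ : ∃ R : PathOrCircle α β, R.graph ≤ H ∧
      V(R.graph) = V(P.graph) ∪ V(Q.graph) ∧ E(R.graph) = E(P.graph) ∪ E(Q.graph) ∧
      R.termini = {t, s} ∧ R.IsPath := by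
    -- If the far ends agree, the result is a closed path that keeps its terminus `t`; a gluing at
    -- `t`, if any, is left to the step for `t`.
    by_cases hts : t = s
    · subst hts
      have hcl := hpP.symm.close hpQ hwt.symm (by
        rintro z ⟨hzP, hzQ⟩
        by_cases hzw : z = w
        · exact Or.inr hzw
        · exact Or.inl (hcommon z hzP hzQ hzw).1) hdis
      obtain ⟨R, hR, hVR, hER, hclR⟩ := hcl.exists_subgraph
      exact ⟨⟨R, {t, t}⟩, hR, hVR, hER, rfl, Or.inr ⟨t, hclR, by simp⟩⟩
    · have hop := hpP.symm.append hpQ (by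
        rintro z ⟨hzP, hzQ⟩
        by_contra hzw
        obtain ⟨h1, h2⟩ := hcommon z hzP hzQ hzw
        exact hts (h1 ▸ h2))
      obtain ⟨R, hR, hVR, hER, hopR⟩ := hop.exists_subgraph
      exact ⟨⟨R, {t, s}⟩, hR, hVR, hER, rfl, Or.inl ⟨t, s, hopR, rfl⟩⟩
  have hmemP : ∀ c ∈ E(P.graph), ∀ x, H.Inc c x → x ∈ V(P.graph) := fun c hc x hi =>
    hpP.inc_mem hc hi
  have hmemQ : ∀ c ∈ E(Q.graph), ∀ x, H.Inc c x → x ∈ V(Q.graph) := fun c hc x hi =>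
    hpQ.inc_mem hc hi
  refine ⟨_, hD.replace hA hR (Or.inl ⟨hpR, ?_⟩) ?_ ?_ ?_ ?_⟩
  · exact ⟨e, by rw [hER]; exact Or.inl heP⟩
  · rw [hER, Set.biUnion_pair]
  · rw [hTw, hER]
    rintro c (rfl | rfl)
    exacts [Or.inl heP, Or.inr hfQ]
  · rintro x ⟨hx, hxt⟩
    rw [htR, Set.mem_insert_iff, Set.mem_singleton_iff, not_or] at hxt
    rw [hVR] at hx
    rw [hER]
    by_cases hxw : x = w
    · subst hxw
      refine ⟨hw, ?_⟩
      rintro c (hc | hc) hi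
      · rw [hwP c hc hi]; exact he
      · rw [hwQ c hc hi]; exact hf
    · rcases hx with hx | hx
      · obtain ⟨h1, h2⟩ := hD.internal P hP x ⟨hx, by simp [htP, hxw, hxt.1]⟩
        refine ⟨Or.inr h1, ?_⟩
        rintro c (hc | hc) hi
        · exact h2 c hc hi
        · exact absurd (hcommon x hx (hmemQ c hc x hi) hxw).1 hxt.1
      · obtain ⟨h1, h2⟩ := hD.internal Q hQ x ⟨hx, by simp [htQ, hxw, hxt.2]⟩
        refine ⟨Or.inr h1, ?_⟩
        rintro c (hc | hc) hi
        · exact absurd (hcommon x (hmemP c hc x hi) hx hxw).1 hxt.1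
        · exact h2 c hc hi
  · intro x hx hxW c hc hi
    rw [htR, Set.mem_insert_iff, Set.mem_singleton_iff] at hx
    have hxw : x ≠ w := by
      rcases hx with rfl | rfl
      exacts [hwt.symm, hws.symm]
    have hxW' := hxW.resolve_left hxw
    rw [hER] at hc
    rcases hc with hc | hc
    · refine hD.terminus P hP x ?_ hxW' c hc hi
      rw [htP]
      rcases hx with rfl | rfl
      · exact Or.inr rfl
      · exact Or.inr (hcommon x (hmemP c hc x hi) hpQ.right_mem hxw).1
    · refine hD.terminus Q hQ x ?_ hxW' c hc hi
      rw [htQ]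
      rcases hx with rfl | rfl
      · exact Or.inr (hcommon x hpP.right_mem (hmemQ c hc x hi) hxw).2
      · exact Or.inr rfl

/-- A member at `w ∉ W` using a prescribed edge is either closed with terminus `w` or open with end
`w`. -/
lemma closed_or_open (hD : H.IsDecomposition W T D) (hwW : w ∉ W) (hP : P ∈ D)
    (heP : e ∈ E(P.graph)) (hi : H.Inc e w) :
    (H.CPath w V(P.graph) E(P.graph) ∧ P.termini = {w}) ∨
      ∃ t, w ≠ t ∧ H.OPath w t V(P.graph) E(P.graph) ∧ P.termini = {w, t} := by
  have hwP : w ∈ V(P.graph) := inc_mem_vertexSet_of_le (hD.le P hP) heP hi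
  have hwt : w ∈ P.termini := by
    by_contra h
    exact hwW (hD.internal P hP w ⟨hwP, h⟩).1
  rcases hD.isPath_of_mem_termini hP hwt with h | h
  · right
    obtain ⟨s, t, h, ht⟩ := h.exists_oPath (hD.le P hP)
    have hst := h.ne_of_nonempty ⟨e, heP⟩
    rw [ht] at hwt
    rcases hwt with rfl | rfl
    · exact ⟨t, hst, h, ht⟩
    · exact ⟨s, hst.symm, h.symm, by rw [ht, Set.pair_comm]⟩
  · left
    obtain ⟨s, h, ht⟩ := h.exists_cPath (hD.le P hP)
    rw [ht] at hwt
    obtain rfl : w = s := hwt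
    exact ⟨h, ht⟩

end IsDecomposition

/-- Induction on `W`, gluing at one vertex at a time. A member with a prescribed edge at the new
vertex `w` has `w` as a terminus. If it is closed, it becomes a circle. If it is open, it uses one
edge end at `w`, so another prescribed edge belongs to a second member; this one is closed, or the
two are joined at `w`. -/
theorem IsTransition.exists_isDecomposition (hW : W.Finite) (hT : H.IsTransition W T) :
    ∃ D, H.IsDecomposition W T D := by
  induction W, hW using Set.Finite.induction_on with
  | empty => exact IsDecomposition.singletons H T
  | @insert w W hwW _ ih =>
    obtain ⟨D, hD⟩ := ih (hT.mono (Set.subset_insert _ _))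
    have hw := Set.mem_insert w W
    have hmem : ∀ e ∈ T w, ∃ P ∈ D, e ∈ E(P.graph) := by
      intro e he
      have := (hT.inc w hw e he).edge_mem
      rw [← hD.cover] at this
      simpa using this
    obtain ⟨e, he⟩ := hT.nonempty hw
    obtain ⟨P, hP, heP⟩ := hmem e he
    rcases hD.closed_or_open hwW hP heP (hT.inc w hw e he) with ⟨hcl, ht⟩ | ⟨t, hwt, hp, ht⟩
    · exact hD.exists_insert_of_closed hT hP hcl ht
    · obtain ⟨f, hf, hfP⟩ : ∃ f ∈ T w, f ∉ E(P.graph) := by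
        by_contra! hc
        have h1 : H.degIn (T w) w ≤ H.degIn E(P.graph) w := degIn_mono hp.finite hc
        rw [hT.degIn_eq w hw, hp.degIn_left hwt] at h1
        omega
      obtain ⟨Q, hQ, hfQ⟩ := hmem f hf
      rcases hD.closed_or_open hwW hQ hfQ (hT.inc w hw f hf) with ⟨hcl, ht⟩ | ⟨s, hws, hq, hs⟩
      · exact hD.exists_insert_of_closed hT hQ hcl ht
      · exact hD.exists_insert_of_open hT hwW hP hQ (fun h => hfP (h ▸ hfQ)) hp ht hq hs hwt hws
          he heP hf hfQ

end Graph

namespace SignedGraph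

open Graph

variable {α : Type u} {β : Type v} {S : SignedGraph α β} {e f : β} {x : α} {X : Set β}
  {C : Graph α β}

/-! ### The local property and paths and circles of negative edges -/

lemma neg_le : S.neg ≤ S.graph := restrict_le

lemma mem_neg : e ∈ E(S.neg) ↔ e ∈ E(S.graph) ∧ S.sign e = -1 := Iff.rfl

lemma neg_inc_iff : S.neg.Inc e x ↔ S.graph.Inc e x ∧ S.sign e = -1 := restrict_inc

lemma neg_finite (hE : E(S.graph).Finite) : E(S.neg).Finite :=
  hE.subset (IsSubgraph.edgeSet_mono neg_le)

lemma neg_degree (hE : E(S.graph).Finite) : S.neg.degree x = S.graph.degIn E(S.neg) x :=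
  degree_eq_degIn_of_le hE neg_le

lemma neg_degree_le (hE : E(S.graph).Finite) : S.neg.degree x ≤ S.graph.degree x := by
  rw [neg_degree hE, degree_eq_degIn hE]
  exact degIn_mono hE (IsSubgraph.edgeSet_mono neg_le)

namespace LocalProperty

lemma neg_degree_le_two (h : S.LocalProperty) (hE : E(S.graph).Finite) (hx : x ∈ V(S.graph)) :
    S.neg.degree x ≤ 2 := by
  have h1 := (h x hx).1
  have h2 := (h x hx).2.1
  have h3 := neg_degree_le (x := x) hE
  omega

lemma degree_le_three (h : S.LocalProperty) (hx : x ∈ V(S.graph)) (hpos : 0 < S.neg.degree x) :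
    S.graph.degree x ≤ 3 := by
  have h1 := (h x hx).1
  omega

lemma mem_of_isCircle (h : S.LocalProperty) (hd : S.neg.degree x = 2) (hC : C ≤ S.graph)
    (hcirc : C.IsCircle) (hx : x ∈ V(C)) (he : S.neg.Inc e x) : e ∈ E(C) :=
  (h x (hC.vertexSet_mono hx)).2.2 hd C hC hcirc hx e he

/-- The property of circles through a vertex extends to even sets. -/
lemma mem_of_isEvenSet (h : S.LocalProperty) (hd : S.neg.degree x = 2)
    (hX : S.graph.IsEvenSet X) (heX : e ∈ X) (hi : S.graph.Inc e x) (hf : S.neg.Inc f x) :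
    f ∈ X := by
  obtain ⟨C, hC, hcirc, heC, hCX⟩ := hX.exists_isCircle heX
  exact hCX (h.mem_of_isCircle hd hC hcirc (inc_mem_vertexSet_of_le hC heC hi) hf)

end LocalProperty

/-- The negative edges form a decomposition into paths and circles that is also vertex-disjoint. -/
lemma LocalProperty.exists_isDecomposition (h : S.LocalProperty) (hV : V(S.graph).Finite)
    (hE : E(S.graph).Finite) :
    ∃ D, S.neg.IsDecomposition {x | x ∈ V(S.graph) ∧ S.neg.degree x = 2}
      (fun x => {e | S.neg.Inc e x}) D ∧
      (D.PairwiseDisjoint fun P => V(P.graph)) ∧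
      ∀ P ∈ D, ∀ x ∈ P.termini, S.neg.degree x ≠ 2 := by
  have hEN := neg_finite hE
  -- All negative edges at the vertex are prescribed, so the condition on unprescribed edges is
  -- vacuous.
  have hT : S.neg.IsTransition {x | x ∈ V(S.graph) ∧ S.neg.degree x = 2}
      (fun x => {e | S.neg.Inc e x}) := by
    refine ⟨fun w _ e he => he, fun w hw => ?_, fun w _ c hc hcT => absurd hc hcT⟩
    rw [← hw.2, degree_eq_degIn hEN]
    exact degIn_congr_set fun e hi => ⟨fun _ => hi.edge_mem, fun _ => hi⟩
  obtain ⟨D, hD⟩ := hT.exists_isDecomposition (hV.subset fun x hx => hx.1)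
  have hterm : ∀ P ∈ D, ∀ x ∈ P.termini, S.neg.degree x ≠ 2 := by
    intro P hP x hx hd
    have hxV := PathOrCircle.termini_subset (hD.path_or_circle' hP) hx
    obtain ⟨e, he, hi⟩ := PathOrCircle.exists_inc (hD.path_or_circle P hP) hxV
    exact hD.terminus P hP x hx ⟨(hD.le P hP).vertexSet_mono hxV, hd⟩ e he (hi.mono (hD.le P hP))
      (hi.mono (hD.le P hP))
  refine ⟨D, hD, fun P hP Q hQ hPQ => ?_, hterm⟩
  refine Set.disjoint_left.2 fun x hxP hxQ => ?_
  have hxV : x ∈ V(S.graph) := (hD.le P hP).vertexSet_mono hxP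
  obtain ⟨e, he, hei⟩ := PathOrCircle.exists_inc (hD.path_or_circle P hP) hxP
  obtain ⟨f, hf, hfi⟩ := PathOrCircle.exists_inc (hD.path_or_circle Q hQ) hxQ
  replace hei := hei.mono (hD.le P hP)
  replace hfi := hfi.mono (hD.le Q hQ)
  have hef : e ≠ f := fun h => hPQ (hD.eq_of_mem hP hQ he (h ▸ hf))
  -- Two members meeting at `x` force negative degree 2. Then `x` is internal to `P`, which
  -- therefore takes all negative edges at `x`, including one of `Q`.
  have h2 : 2 ≤ S.neg.degree x := by
    rw [degree_eq_degIn hEN]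
    refine le_trans ?_ (degIn_mono hEN
      (Set.insert_subset hei.edge_mem (Set.singleton_subset_iff.2 hfi.edge_mem)))
    rw [degIn_pair hef]
    exact Nat.add_le_add hei.mult_pos hfi.mult_pos
  have hd : S.neg.degree x = 2 := le_antisymm (h.neg_degree_le_two hE hxV) h2
  have hxP' : x ∈ P.internal := ⟨hxP, fun hx => hterm P hP x hx hd⟩
  exact hPQ (hD.eq_of_mem hP hQ (hD.subset_of_internal hT hP hxP' hfi) hf)

/-- A circle of negative edges in which every vertex has negative degree two is a megablock. -/
lemma LocalProperty.isMegablock (h : S.LocalProperty) (hV : V(S.graph).Finite)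
    (hE : E(S.graph).Finite) (hC : C ≤ S.neg) (hcirc : C.IsCircle)
    (hd : ∀ x ∈ V(C), S.neg.degree x = 2) : S.graph.IsMegablock C := by
  have hCG : C ≤ S.graph := hC.trans neg_le
  -- A circle that meets `C` in a vertex contains the negative edges there and so, spreading along
  -- `C`, all of `C`.
  have huniq : ∀ C' ≤ S.graph, C'.IsCircle → ∀ x ∈ V(C), x ∈ V(C') → C' = C := by
    intro C' hC' hcirc' x hx hx'
    obtain ⟨e, he, hi⟩ := (hcirc.mem_vertexSet_iff le_rfl).1 hx
    have heC' := h.mem_of_isCircle (hd x hx) hC' hcirc' hx' (hi.mono hC)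
    obtain ⟨s, hs⟩ := hcirc.exists_cPath hCG
    refine (hcirc.eq_of_edgeSet_subset hcirc' hCG hC' fun f hf => ?_).symm
    refine hs.propagate (Q := fun e => e ∈ E(C')) (fun y hy _ a ha b hb hai hbi haC => ?_)
      e he f hf heC'
    exact h.mem_of_isCircle (hd y hy) hC' hcirc' (inc_mem_vertexSet_of_le hC' haC hai)
      (((IsSubgraph.inc_congr hCG hb).2 hbi).mono hC)
  have hmem : ∀ B, S.graph.IsNontrivialBlock B → ∀ e ∈ E(B), ∀ x ∈ V(C), S.graph.Inc e x →
      e ∈ E(C) := by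
    intro B hB e he x hx hi
    obtain ⟨D, hD, hDc, heD⟩ := hB.exists_isCircle he
    rw [← huniq D hD hDc x hx (inc_mem_vertexSet_of_le hD heD hi)]
    exact heD
  -- A connected subgraph containing `C` whose edges all lie in nontrivial blocks cannot leave `C`:
  -- its edges at vertices of `C` lie on circles meeting `C`. This serves both for the block
  -- containing `C` and for maximality as a megablock.
  have hcl : ∀ H, H ≤ S.graph → H.IsConnected → C ≤ H →
      (∀ e ∈ E(H), ∃ B, S.graph.IsNontrivialBlock B ∧ e ∈ E(B)) → H ≤ C := by
    intro H hH hconn hCH hb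
    have hedge : ∀ e ∈ E(H), ∀ x ∈ V(C), S.graph.Inc e x → e ∈ E(C) := by
      intro e he x hx hi
      obtain ⟨B, hB, heB⟩ := hb e he
      exact hmem B hB e heB x hx hi
    have hVH : V(H) ⊆ V(C) := by
      obtain ⟨x₀, hx₀⟩ := hcirc.isConnected.1
      intro y hy
      have hj := hconn.2 x₀ (hCH.vertexSet_mono hx₀) y hy
      unfold Graph.Joined at hj
      induction hj with
      | refl => exact hx₀
      | @tail b c _ hbc ih =>
        obtain ⟨e, he⟩ := hbc
        have heC := hedge e he.edge_mem b (ih he.left_mem) (he.mono hH).inc_left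
        exact inc_mem_vertexSet_of_le hCG heC (he.mono hH).inc_right
    refine (Compatible.of_le_le hH hCG).le_iff.2 ⟨hVH, fun e he => ?_⟩
    obtain ⟨a, b, hl⟩ := exists_isLink_of_mem_edgeSet he
    exact hedge e he a (hVH hl.left_mem) (hl.mono hH).inc_left
  obtain ⟨B, hB, hCB⟩ := hcirc.exists_isNontrivialBlock hV hE hCG
  obtain rfl : C = B := le_antisymm hCB (hcl B hB.1.le hB.1.isConnected hCB
    fun e he => ⟨B, hB, he⟩)
  refine ⟨⟨hCG, hcirc.isConnected, {C}, Set.singleton_nonempty C, by simpa using hB, by simp,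
    by simp⟩, ?_⟩
  rintro H ⟨hH, hconn, 𝓑, -, h𝓑, -, hEH⟩ hCH
  refine hcl H hH hconn hCH fun e he => ?_
  rw [hEH] at he
  simp only [Set.mem_iUnion] at he
  obtain ⟨B, hB, heB⟩ := he
  exact ⟨B, h𝓑 B hB, heB⟩

/-- Along a member every internal vertex has negative degree 2, so a circle with one edge of the
member contains all of it. If some edge of a path is not an isthmus, the path thus lies in a circle
and hence in a nontrivial block. -/
theorem LocalProperty.constructionA (h : S.LocalProperty) (hV : V(S.graph).Finite)
    (hE : E(S.graph).Finite) : S.ConstructionA := by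
  obtain ⟨D, hD, hdisj, hterm⟩ := h.exists_isDecomposition hV hE
  have hle : ∀ P ∈ D, P.graph ≤ S.graph := fun P hP => (hD.le P hP).trans neg_le
  have hinc : ∀ P ∈ D, ∀ x ∈ V(P.graph), ∃ e ∈ E(P.graph), S.graph.Inc e x ∧ S.neg.Inc e x := by
    intro P hP x hx
    obtain ⟨e, he, hi⟩ := PathOrCircle.exists_inc (hD.path_or_circle P hP) hx
    exact ⟨e, he, hi.mono (hle P hP), hi.mono (hD.le P hP)⟩
  have hpos : ∀ P ∈ D, ∀ x ∈ V(P.graph), 0 < S.neg.degree x := by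
    intro P hP x hx
    obtain ⟨e, he, -, hi⟩ := hinc P hP x hx
    rw [degree_eq_degIn (neg_finite hE), degIn_pos_iff (neg_finite hE)]
    exact ⟨e, hi.edge_mem, hi⟩
  have hthree : ∀ P ∈ D, ∀ x ∈ V(P.graph), S.graph.degree x ≤ 3 := fun P hP x hx =>
    h.degree_le_three ((hle P hP).vertexSet_mono hx) (hpos P hP x hx)
  -- At a terminus the negative degree is positive but not 2, which Property 2 forbids at degree 3.
  have htwo : ∀ P ∈ D, ∀ x ∈ P.termini, S.graph.degree x ≤ 2 := by
    intro P hP x hx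
    have hxV := PathOrCircle.termini_subset (hD.path_or_circle' hP) hx
    have hxG := (hle P hP).vertexSet_mono hxV
    have h1 := hterm P hP x hx
    have h2 := hpos P hP x hxV
    have h3 := hthree P hP x hxV
    have h4 := (h x hxG).2.1
    omega
  refine ⟨D, hdisj, fun P hP => ?_, fun e he => ?_⟩
  · rcases hD.path_or_circle P hP with ⟨hpath, hne⟩ | hcirc
    · by_cases hall : ∀ e ∈ E(P.graph), S.graph.IsIsthmus e
      · exact Or.inr (Or.inl ⟨hpath, hle P hP, hall, hthree P hP, htwo P hP⟩)
      left
      push Not at hall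
      obtain ⟨e, he, hne'⟩ := hall
      obtain ⟨X, hX, heX⟩ :=
        exists_isEvenSet_of_not_isIsthmus (IsSubgraph.edgeSet_mono (hle P hP) he) hne'
      obtain ⟨C, hC, hcirc, heC, -⟩ := hX.exists_isCircle heX
      have hsub : E(P.graph) ⊆ E(C) := by
        intro f hf
        refine PathOrCircle.propagate (Q := fun e => e ∈ E(C)) (Or.inl hpath) (hle P hP)
          (fun x hx a ha b hb hai hbi haC => ?_) e he f hf heC
        exact h.mem_of_isCircle (hD.internal P hP x hx).1.2 hC hcirc
          (inc_mem_vertexSet_of_le hC haC hai)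
          (((IsSubgraph.inc_congr (hle P hP) hb).2 hbi).mono (hD.le P hP))
      have hVsub : V(P.graph) ⊆ V(C) := by
        intro x hx
        obtain ⟨f, hf, hfi, -⟩ := hinc P hP x hx
        exact inc_mem_vertexSet_of_le hC (hsub hf) hfi
      obtain ⟨B, hB, hCB⟩ := hcirc.exists_isNontrivialBlock hV hE hC
      have hPB : P.graph ≤ B :=
        ((Compatible.of_le_le (hle P hP) hC).le_iff.2 ⟨hVsub, hsub⟩).trans hCB
      refine ⟨B, hB, ⟨hpath, hne, hPB, fun x hx => ?_⟩, hthree P hP, fun x hx => ?_⟩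
      · have hd := PathOrCircle.degIn_internal (Or.inl hpath) (hle P hP) hx
        have hBfin := hE.subset (IsSubgraph.edgeSet_mono hB.1.le)
        rw [degree_eq_degIn_of_le hE hB.1.le]
        refine le_antisymm ?_ (hd ▸ degIn_mono hBfin (IsSubgraph.edgeSet_mono hPB))
        rw [← hd]
        -- An edge `f` of `B` at `x` lies in a circle with an edge of `P` at `x`. This circle
        -- contains both edge ends of `P` at `x`, so `f` is one of these edges.
        refine degIn_le_of_forall (PathOrCircle.edge_finite (Or.inl hpath)) fun f hf hfi => ?_
        obtain ⟨g, hg, hgi, -⟩ := hinc P hP x hx.1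
        obtain ⟨D', hD', hDc, hfD, hgD⟩ :=
          hB.exists_common_isCircle hf (IsSubgraph.edgeSet_mono hPB hg)
        have hxD : x ∈ V(D') := inc_mem_vertexSet_of_le hD' hgD hgi
        have hX : S.graph.degIn (E(P.graph) ∩ E(D')) x = S.graph.degIn E(P.graph) x :=
          degIn_congr_set fun a hai => ⟨And.left, fun ha => ⟨ha, h.mem_of_isCircle
            (hD.internal P hP x hx).1.2 hD' hDc hxD
            (((IsSubgraph.inc_congr (hle P hP) ha).2 hai).mono (hD.le P hP))⟩⟩
        exact (mem_of_degIn_le hDc.finite Set.inter_subset_right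
          (by rw [hX, hd, hDc.degIn_of_mem hD' hxD]) hfD hfi).1
      · have hxV := PathOrCircle.termini_subset (hD.path_or_circle' hP) hx
        refine le_antisymm (htwo P hP x hx) ?_
        rw [degree_eq_degIn hE, ← hcirc.degIn_of_mem hC (hVsub hxV)]
        exact degIn_mono hE (IsSubgraph.edgeSet_mono hC)
    · exact Or.inr (Or.inr ⟨hcirc, h.isMegablock hV hE (hD.le P hP) hcirc.1 (fun x hx =>
        (hD.internal P hP x ⟨hx, by simp [hcirc.2]⟩).1.2), hthree P hP⟩)
  · have h1 : S.sign e = -1 ↔ e ∈ E(S.neg) := by simp [mem_neg, he]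
    rw [h1, ← hD.cover]
    simp

/-- By disjointness the negative edges at `x` are those of the only chosen member through `x`. A
vertex of degree 3 on it cannot be a terminus, so it is internal and has negative degree 2. -/
theorem ConstructionA.localProperty (h : S.ConstructionA) (hV : V(S.graph).Finite)
    (hE : E(S.graph).Finite) : S.LocalProperty := by
  obtain ⟨A, hdisj, htype, hsign⟩ := h
  have hle : ∀ P ∈ A, P.graph ≤ S.graph := by
    intro P hP
    rcases htype P hP with ⟨B, hB, hP, -⟩ | ⟨-, hP, -⟩ | ⟨-, hP, -⟩
    · exact hP.2.2.1.trans hB.1.le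
    · exact hP
    · exact hP.1.1
  have hpc : ∀ P ∈ A, P.IsPath ∨ P.IsCircle := by
    intro P hP
    rcases htype P hP with ⟨B, hB, hP, -⟩ | ⟨hP, -⟩ | ⟨hP, -⟩
    · exact Or.inl hP.1
    · exact Or.inl hP
    · exact Or.inr hP
  intro x hx
  by_cases hex : ∃ P ∈ A, x ∈ V(P.graph)
  · obtain ⟨P, hP, hxP⟩ := hex
    have hneg : ∀ e, S.graph.Inc e x → (e ∈ E(S.neg) ↔ e ∈ E(P.graph)) := by
      intro e hi
      rw [mem_neg, hsign e hi.edge_mem]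
      constructor
      · rintro ⟨-, Q, hQ, heQ⟩
        have hxQ := inc_mem_vertexSet_of_le (hle Q hQ) heQ hi
        by_contra heP
        refine Set.disjoint_left.1 (hdisj hP hQ ?_) hxP hxQ
        rintro rfl
        exact heP heQ
      · exact fun heP => ⟨hi.edge_mem, P, hP, heP⟩
    have hdeg : S.neg.degree x = S.graph.degIn E(P.graph) x := by
      rw [neg_degree hE]
      exact degIn_congr_set hneg
    have hthree : S.graph.degree x ≤ 3 := by
      rcases htype P hP with ⟨B, -, -, h, -⟩ | ⟨-, -, -, h, -⟩ | ⟨-, -, h⟩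
      all_goals exact h x hxP
    have htwo : x ∈ P.termini → S.graph.degree x ≤ 2 := by
      intro hxt
      rcases htype P hP with ⟨B, -, -, -, h⟩ | ⟨-, -, -, -, h⟩ | ⟨h, -, -⟩
      · exact (h x hxt).le
      · exact h x hxt
      · rw [h.2] at hxt
        exact absurd hxt (Set.notMem_empty x)
    refine ⟨fun h => by omega, fun h => Or.inr ?_, ?_⟩
    · rw [hdeg]
      exact PathOrCircle.degIn_internal (hpc P hP) (hle P hP) ⟨hxP, fun h => by
        have := htwo h
        omega⟩
    · intro hd C hC hcirc hxC e he
      rw [hdeg] at hd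
      have hei : S.graph.Inc e x := he.mono neg_le
      have heP : e ∈ E(P.graph) := (hneg e hei).1 he.edge_mem
      have hdC := hcirc.degIn_of_mem hC hxC
      have hCfin := hcirc.finite
      have hPfin := PathOrCircle.edge_finite (hpc P hP)
      -- Otherwise `C` and `P` would occupy four edge ends at `x`, where the degree is at most 3.
      obtain ⟨g, hgC, hgP, hgi⟩ : ∃ g ∈ E(C), g ∈ E(P.graph) ∧ S.graph.Inc g x := by
        by_contra! hc
        have h1 : S.graph.degIn (E(P.graph) \ E(C)) x = S.graph.degIn E(P.graph) x :=
          degIn_congr_set fun a hai => ⟨And.left, fun ha => ⟨ha, fun haC => hc a haC ha hai⟩⟩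
        have h2 := degIn_mono (G := S.graph) (x := x) hE
          (Set.union_subset (IsSubgraph.edgeSet_mono hC)
            (Set.sdiff_subset.trans (IsSubgraph.edgeSet_mono (hle P hP))) :
            E(C) ∪ E(P.graph) \ E(C) ⊆ E(S.graph))
        rw [degIn_union hCfin (hPfin.subset Set.sdiff_subset) Set.disjoint_sdiff_right, h1, hd, hdC,
          ← degree_eq_degIn hE] at h2
        omega
      rcases htype P hP with ⟨B, hB, hdiv, -, h2⟩ | ⟨-, -, h, -⟩ | ⟨hPc, hM, -⟩
      · by_cases hxt : x ∈ P.termini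
        · refine mem_of_degIn_le hE (IsSubgraph.edgeSet_mono hC) ?_ hei.edge_mem hei
          rw [← degree_eq_degIn hE, h2 x hxt, hdC]
        · have hCB : C ≤ B :=
            hB.1.circle_le hcirc hC (IsSubgraph.edgeSet_mono hdiv.2.2.1 hgP) hgC
          refine mem_of_degIn_le (hE.subset (IsSubgraph.edgeSet_mono hB.1.le))
            (IsSubgraph.edgeSet_mono hCB) ?_ (IsSubgraph.edgeSet_mono hdiv.2.2.1 heP) hei
          rw [← degree_eq_degIn_of_le hE hB.1.le, hdiv.2.2.2 x ⟨hxP, hxt⟩, hdC]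
      · exact absurd hgC ((h g hgP).notMem (hcirc.isEvenSet hC))
      -- Adjoining the block of `C` to the megablock keeps it connected, since both contain `x`. By
      -- maximality `C` lies in the circle `P` and equals it.
      · obtain ⟨B, hB, hCB⟩ := hcirc.exists_isNontrivialBlock hV hE hC
        obtain ⟨-, hconn, 𝓑, -, h𝓑, hV𝓑, hE𝓑⟩ := hM.1
        obtain ⟨U, hU, hVU, hEU, hPU, hBU⟩ := exists_union hM.1.1 hB.1.le
        have hUP : U ≤ P.graph := hM.2 ⟨hU, hconn.union hB.1.isConnected hPU hBU hVU hxP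
          (hCB.vertexSet_mono hxC), insert B 𝓑, Set.insert_nonempty _ _, by
            rintro B' (rfl | hB')
            exacts [hB, h𝓑 B' hB'], by
            rw [hVU, hV𝓑, Set.biUnion_insert, Set.union_comm], by
            rw [hEU, hE𝓑, Set.biUnion_insert, Set.union_comm]⟩ hPU
        have hsub : E(C) ⊆ E(P.graph) := IsSubgraph.edgeSet_mono (hCB.trans (hBU.trans hUP))
        rw [hcirc.eq_of_edgeSet_subset hPc.1 hC (hle P hP) hsub]
        exact heP
  · have h0 : S.neg.degree x = 0 := by
      rw [neg_degree hE, degIn_eq_zero_iff (neg_finite hE)]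
      intro e he hi
      obtain ⟨P, hP, heP⟩ := (hsign e hi.edge_mem).1 he.2
      exact hex ⟨P, hP, inc_mem_vertexSet_of_le (hle P hP) heP hi⟩
    exact ⟨fun _ => h0, fun _ => Or.inl h0, fun h => by omega⟩

end SignedGraph

namespace IsSubdivision

open Graph

variable {α : Type u} {β γ : Type v} {G' : Graph α γ} {G : Graph α β} {p : γ → Graph α β}
  {e f : β} {e' f' : γ} {x y : α} {X' : Set γ} {X : Set β}

/-! ### Subdivisions -/

lemma edge_nonempty (h : IsSubdivision G' G p) (he' : e' ∈ E(G')) : E(p e').Nonempty := by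
  obtain ⟨x, y, hl⟩ := exists_isLink_of_mem_edgeSet he'
  exact (h.path e' x y hl).2.1

lemma vertexSet_subset (h : IsSubdivision G' G p) : V(G') ⊆ V(G) := by
  rw [h.vertexSet_eq]
  exact Set.subset_union_left

lemma eq_of_mem (h : IsSubdivision G' G p) (he' : e' ∈ E(G')) (hf' : f' ∈ E(G'))
    (he : e ∈ E(p e')) (hf : e ∈ E(p f')) : e' = f' := by
  by_contra hne
  exact Set.disjoint_left.1 (h.edge_disjoint e' he' f' hf' hne) he hf

lemma exists_mem (h : IsSubdivision G' G p) (he : e ∈ E(G)) : ∃ e' ∈ E(G'), e ∈ E(p e') := by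
  rw [h.edgeSet_eq] at he
  simpa using he

lemma edgeSet_subset (h : IsSubdivision G' G p) (he' : e' ∈ E(G')) : E(p e') ⊆ E(G) :=
  IsSubgraph.edgeSet_mono (h.path_le e' he')

lemma edge_finite (h : IsSubdivision G' G p) (hE : E(G).Finite) : E(G').Finite := by
  have key : ∀ e' : E(G'), ∃ e : E(G), e.1 ∈ E(p e'.1) := fun e' => by
    obtain ⟨e, he⟩ := h.edge_nonempty e'.2
    exact ⟨⟨e, h.edgeSet_subset e'.2 he⟩, he⟩
  choose f hf using key
  have := hE.to_subtype
  have : Finite E(G') := Finite.of_injective f fun a b hab =>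
    Subtype.ext (h.eq_of_mem a.2 b.2 (hf a) (hab ▸ hf b))
  exact Set.toFinite _

lemma exists_pathOrCircle (h : IsSubdivision G' G p) (hl : G'.IsLink e' x y) :
    (PathOrCircle.mk (p e') {x, y}).IsPath := by
  rcases (h.path e' x y hl).1 with hp | ⟨rfl, hp⟩
  · exact Or.inl ⟨x, y, hp, rfl⟩
  · exact Or.inr ⟨x, hp, by simp⟩

lemma path_finite (h : IsSubdivision G' G p) (he' : e' ∈ E(G')) : E(p e').Finite := by
  obtain ⟨x, y, hl⟩ := exists_isLink_of_mem_edgeSet he'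
  exact PathOrCircle.edge_finite (Or.inl (h.exists_pathOrCircle hl))

lemma inc_iff (h : IsSubdivision G' G p) (he' : e' ∈ E(G')) (hx : x ∈ V(G')) :
    x ∈ V(p e') ↔ G'.Inc e' x := by
  obtain ⟨a, b, hl⟩ := exists_isLink_of_mem_edgeSet he'
  have hV := (h.path e' a b hl).2.2
  have h1 : x ∈ V(p e') ↔ x = a ∨ x = b := by
    constructor
    · intro hxp
      have : x ∈ V(p e') ∩ V(G') := ⟨hxp, hx⟩
      rw [hV] at this
      simpa using this
    · intro hxab
      have : x ∈ V(p e') ∩ V(G') := by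
        rw [hV]
        simpa using hxab
      exact this.1
  rw [h1]
  exact ⟨by rintro (rfl | rfl); exacts [hl.inc_left, hl.inc_right],
    fun hi => hi.eq_or_eq_of_isLink hl⟩

lemma inc_of_inc (h : IsSubdivision G' G p) (he' : e' ∈ E(G')) (hx : x ∈ V(G')) (he : e ∈ E(p e'))
    (hi : G.Inc e x) : G'.Inc e' x :=
  (h.inc_iff he' hx).1 (inc_mem_vertexSet_of_le (h.path_le e' he') he hi)

/-- A replacing path meets the old vertices only in its termini; for a loop, the closed path
contributes two ends at its terminus. -/
lemma degIn_path (h : IsSubdivision G' G p) (he' : e' ∈ E(G')) (hx : x ∈ V(G')) :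
    G.degIn E(p e') x = G'.mult e' x := by
  obtain ⟨a, b, hl⟩ := exists_isLink_of_mem_edgeSet he'
  obtain ⟨hp, hne, -⟩ := h.path e' a b hl
  have hxi := h.inc_iff he' hx
  have hi : G'.Inc e' x ↔ x = a ∨ x = b :=
    ⟨fun hi => hi.eq_or_eq_of_isLink hl,
      by rintro (rfl | rfl); exacts [hl.inc_left, hl.inc_right]⟩
  rw [hi] at hxi
  rw [hl.mult_eq]
  rcases hp with hp | ⟨rfl, hp⟩
  · have ho := (isOpenPath_iff.1 hp).mono (h.path_le e' he')
    have hab := ho.ne_of_nonempty hne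
    have hd := ho.degIn_add x
    by_cases h1 : x = a
    · subst h1
      simp [hxi, hab] at hd ⊢
      omega
    · by_cases h2 : x = b
      · subst h2
        simp [hxi, h1] at hd ⊢
        omega
      · simpa [hxi, h1, h2] using hd
  · rw [((isClosedPath_iff.1 hp).mono (h.path_le e' he')).degIn_eq]
    rw [or_self] at hxi
    by_cases h1 : x = a
    · rw [if_pos (hxi.2 h1), if_pos h1]
    · rw [if_neg (mt hxi.1 h1), if_neg h1]

lemma mem_of_notMem (h : IsSubdivision G' G p) (he' : e' ∈ E(G')) (hx : x ∉ V(G'))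
    (hxp : x ∈ V(p e')) (hi : G.Inc e x) : e ∈ E(p e') := by
  obtain ⟨f', hf', hef⟩ := h.exists_mem hi.edge_mem
  by_cases hne : e' = f'
  · exact hne ▸ hef
  · exact absurd (h.vertex_disjoint e' he' f' hf' hne
      ⟨hxp, inc_mem_vertexSet_of_le (h.path_le f' hf') hef hi⟩) hx

lemma degIn_path_of_notMem (h : IsSubdivision G' G p) (he' : e' ∈ E(G')) (hx : x ∉ V(G'))
    (hxp : x ∈ V(p e')) : G.degIn E(p e') x = 2 := by
  obtain ⟨a, b, hl⟩ := exists_isLink_of_mem_edgeSet he'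
  refine PathOrCircle.degIn_internal (P := ⟨p e', {a, b}⟩)
    (Or.inl (h.exists_pathOrCircle hl)) (h.path_le e' he') ⟨hxp, ?_⟩
  rintro (rfl | rfl)
  exacts [hx hl.left_mem, hx hl.right_mem]

lemma exists_mem_path (h : IsSubdivision G' G p) (hx : x ∈ V(G)) (hx' : x ∉ V(G')) :
    ∃ e' ∈ E(G'), x ∈ V(p e') := by
  rw [h.vertexSet_eq] at hx
  simpa using hx.resolve_left hx'

/-- The new vertices of a subdivision have degree two. -/
lemma degree_of_notMem (h : IsSubdivision G' G p) (hE : E(G).Finite) (hx : x ∈ V(G))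
    (hx' : x ∉ V(G')) : G.degree x = 2 := by
  obtain ⟨e', he', hxp⟩ := h.exists_mem_path hx hx'
  rw [degree_eq_degIn hE, ← h.degIn_path_of_notMem he' hx' hxp]
  exact degIn_congr_set fun e hi =>
    ⟨fun _ => h.mem_of_notMem he' hx' hxp hi, fun _ => hi.edge_mem⟩

/-- The edges of the paths that replace the edges in `X'`. -/
def lift (p : γ → Graph α β) (X' : Set γ) : Set β := ⋃ e' ∈ X', E(p e')

lemma mem_lift (h : IsSubdivision G' G p) (hX' : X' ⊆ E(G')) (he' : e' ∈ E(G'))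
    (he : e ∈ E(p e')) : e ∈ lift p X' ↔ e' ∈ X' := by
  simp only [lift, Set.mem_iUnion, exists_prop]
  exact ⟨fun ⟨f', hf', hef⟩ => h.eq_of_mem he' (hX' hf') he hef ▸ hf', fun h' => ⟨e', h', he⟩⟩

lemma finprod_lift {M : Type*} [CommMonoid M] (σ : β → M) (h : IsSubdivision G' G p)
    (hX' : X' ⊆ E(G')) (hfin : X'.Finite) :
    ∏ᶠ e ∈ lift p X', σ e = ∏ᶠ e' ∈ X', ∏ᶠ e ∈ E(p e'), σ e :=
  finprod_mem_biUnion
    (fun e' he' f' hf' hne => h.edge_disjoint e' (hX' he') f' (hX' hf') hne)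
    hfin fun _ he' => h.path_finite (hX' he')

lemma finsum_lift {M : Type*} [AddCommMonoid M] (σ : β → M) (h : IsSubdivision G' G p)
    (hX' : X' ⊆ E(G')) (hfin : X'.Finite) :
    ∑ᶠ e ∈ lift p X', σ e = ∑ᶠ e' ∈ X', ∑ᶠ e ∈ E(p e'), σ e :=
  finsum_mem_biUnion
    (fun e' he' f' hf' hne => h.edge_disjoint e' (hX' he') f' (hX' hf') hne)
    hfin fun _ he' => h.path_finite (hX' he')

lemma degIn_lift (h : IsSubdivision G' G p) (hX' : X' ⊆ E(G')) (hfin : X'.Finite)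
    (hx : x ∈ V(G')) : G.degIn (lift p X') x = G'.degIn X' x := by
  rw [degIn, h.finsum_lift _ hX' hfin]
  exact finsum_mem_congr rfl fun e' he' => h.degIn_path (hX' he') hx

lemma lift_edgeSet (h : IsSubdivision G' G p) : lift p E(G') = E(G) := h.edgeSet_eq.symm

lemma degree_eq (h : IsSubdivision G' G p) (hE : E(G).Finite) (hx : x ∈ V(G')) :
    G.degree x = G'.degree x := by
  have hE' := h.edge_finite hE
  rw [degree_eq_degIn hE, degree_eq_degIn hE', ← h.lift_edgeSet, h.degIn_lift subset_rfl hE' hx]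

lemma lift_finite (h : IsSubdivision G' G p) (hX' : X' ⊆ E(G')) (hfin : X'.Finite) :
    (lift p X').Finite := hfin.biUnion fun _ he' => h.path_finite (hX' he')

/-- Old vertices keep their degree, and at a new vertex all edges belong to one replacing path,
which has degree 2 there. -/
lemma isEvenSet_lift (h : IsSubdivision G' G p) (hX' : G'.IsEvenSet X') :
    G.IsEvenSet (lift p X') where
  subset := Set.iUnion₂_subset fun _ he' => h.edgeSet_subset (hX'.subset he')
  finite := h.lift_finite hX'.subset hX'.finite
  even x := by
    by_cases hx : x ∈ V(G')
    · rw [h.degIn_lift hX'.subset hX'.finite hx]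
      exact hX'.even x
    · rcases Nat.eq_zero_or_pos (G.degIn (lift p X') x) with h0 | h0
      · simp [h0]
      · rw [gt_iff_lt, degIn_pos_iff (h.lift_finite hX'.subset hX'.finite)] at h0
        obtain ⟨e, he, hi⟩ := h0
        simp only [lift, Set.mem_iUnion, exists_prop] at he
        obtain ⟨e', he', hee'⟩ := he
        have hxp := inc_mem_vertexSet_of_le (h.path_le e' (hX'.subset he')) hee' hi
        have : G.degIn (lift p X') x = G.degIn E(p e') x := degIn_congr_set fun f hf => by
          have hfe := h.mem_of_notMem (hX'.subset he') hx hxp hf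
          exact ⟨fun _ => hfe, fun _ => (h.mem_lift hX'.subset (hX'.subset he') hfe).2 he'⟩
        rw [this, h.degIn_path_of_notMem (hX'.subset he') hx hxp]
        exact even_two

/-- An even set contains all or none of the edges of a subdividing path. -/
lemma subset_of_isEvenSet (h : IsSubdivision G' G p) (hE : E(G).Finite) (hX : G.IsEvenSet X)
    (he' : e' ∈ E(G')) (he : e ∈ E(p e')) (heX : e ∈ X) : E(p e') ⊆ X := by
  obtain ⟨a, b, hl⟩ := exists_isLink_of_mem_edgeSet he'
  intro f hf
  refine PathOrCircle.propagate (P := ⟨p e', {a, b}⟩) (Q := fun e => e ∈ X)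
    (Or.inl (h.exists_pathOrCircle hl)) (h.path_le e' he')
    (fun x hx c hc d hd hci hdi hcX => ?_) e he f hf heX
  have hx' : x ∉ V(G') := fun hxV => hx.2 ((h.path e' a b hl).2.2 ▸ ⟨hx.1, hxV⟩)
  have hxG : x ∈ V(G) := (h.path_le e' he').vertexSet_mono hx.1
  exact hX.mem_of_degIn hE hX.subset
    (by rw [← degree_eq_degIn hE, h.degree_of_notMem hE hxG hx']) hcX hci
    (h.edgeSet_subset he' hd) hdi

/-- The even sets of a subdivision are those that arise from even sets of the initial graph. -/
lemma exists_isEvenSet (h : IsSubdivision G' G p) (hE : E(G).Finite) (hX : G.IsEvenSet X) :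
    ∃ X', G'.IsEvenSet X' ∧ X = lift p X' := by
  have hE' := h.edge_finite hE
  set X' : Set γ := {e' | e' ∈ E(G') ∧ ∃ e ∈ E(p e'), e ∈ X} with hX'def
  have hX' : X' ⊆ E(G') := fun e' he' => he'.1
  have hfin := hE'.subset hX'
  have heq : X = lift p X' := by
    ext e
    constructor
    · intro he
      obtain ⟨e', he', hee'⟩ := h.exists_mem (hX.subset he)
      exact (h.mem_lift hX' he' hee').2 ⟨he', e, hee', he⟩
    · simp only [lift, Set.mem_iUnion, exists_prop]
      rintro ⟨e', ⟨he', f, hf, hfX⟩, he⟩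
      exact h.subset_of_isEvenSet hE hX he' hf hfX he
  refine ⟨X', ⟨hX', hfin, fun x => ?_⟩, heq⟩
  by_cases hx : x ∈ V(G')
  · rw [← h.degIn_lift hX' hfin hx, ← heq]
    exact hX.even x
  · rw [(degIn_eq_zero_iff hfin).2 fun e' _ hi => hx hi.vertex_mem]
    simp

/-- Subdividing an isthmus yields isthmi. -/
lemma isIsthmus (h : IsSubdivision G' G p) (hE : E(G).Finite) (he' : G'.IsIsthmus e')
    (he : e ∈ E(p e')) : G.IsIsthmus e := by
  refine isIsthmus_iff.2 ⟨h.edgeSet_subset he'.1 he, fun X hX heX => ?_⟩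
  obtain ⟨X', hX', rfl⟩ := h.exists_isEvenSet hE hX
  exact he'.notMem hX' ((h.mem_lift hX'.subset he'.1 he).1 heX)

end IsSubdivision

namespace Graph

variable {α : Type u} {β γ : Type v} {G H : Graph α β} {e f : β} {x y z s t w : α}

/-! ### Suppression of divalent vertices -/

lemma IsPathBetween.symm {P : Graph α β} (h : P.IsPathBetween s t) : P.IsPathBetween t s := by
  rcases h with h | ⟨rfl, h⟩
  · exact Or.inl (isOpenPath_iff.2 (isOpenPath_iff.1 h).symm)
  · exact Or.inr ⟨rfl, h⟩

/-- Every finite graph is a subdivision of a graph in which each divalent vertex supports a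
loop. -/
theorem exists_isSubdivision (hV : V(G).Finite) (hE : E(G).Finite) :
    ∃ (G' : Graph α β) (p : β → Graph α β), IsSubdivision G' G p ∧
      ∀ x ∈ V(G'), G'.degree x = 2 → ∃ e', G'.IsLoopAt e' x := by
  set W : Set α := {x | x ∈ V(G) ∧ G.degree x = 2} with hWdef
  -- Prescribing all edges at the divalent vertices makes every divalent vertex internal to the
  -- member through it; the members will be the replacing paths.
  have hT : G.IsTransition W (fun x => {e | G.Inc e x}) := by
    refine ⟨fun w _ e he => he, fun w hw => ?_, fun w _ c hc hcT => absurd hc hcT⟩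
    rw [← hw.2, degree_eq_degIn hE]
    exact degIn_congr_set fun e hi => ⟨fun _ => hi.edge_mem, fun _ => hi⟩
  obtain ⟨D, hD⟩ := hT.exists_isDecomposition (hV.subset fun x hx => hx.1)
  have hterm : ∀ P ∈ D, ∀ x ∈ P.termini, x ∉ W := by
    intro P hP x hx hxW
    have hxV := PathOrCircle.termini_subset (hD.path_or_circle' hP) hx
    obtain ⟨e, he, hi⟩ := PathOrCircle.exists_inc (hD.path_or_circle P hP) hxV
    exact hD.terminus P hP x hx hxW e he (hi.mono (hD.le P hP)) (hi.mono (hD.le P hP))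
  have hint : ∀ P ∈ D, ∀ x ∈ V(P.graph), x ∈ W → x ∈ P.internal := fun P hP x hx hxW =>
    ⟨hx, fun h => hterm P hP x h hxW⟩
  -- A circle has no terminus, so a vertex `s = t` on it is chosen to carry a loop. The edge `r` of
  -- each member serves as the name of the new edge.
  have key : ∀ P : D, ∃ s t r, P.1.graph.IsPathBetween s t ∧ s ∈ V(P.1.graph) ∧
      t ∈ V(P.1.graph) ∧ r ∈ E(P.1.graph) ∧
      (P.1.termini = {s, t} ∨ (P.1.termini = ∅ ∧ s = t)) := by
    rintro ⟨P, hP⟩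
    rcases hD.path_or_circle P hP with ⟨hpath, r, hr⟩ | ⟨⟨s, h⟩, ht⟩
    · rcases hpath with ⟨s, t, h, ht⟩ | ⟨s, h, ht⟩
      · have ho := isOpenPath_iff.1 h
        exact ⟨s, t, r, Or.inl h, ho.left_mem, ho.right_mem, hr, Or.inl ht⟩
      · have hc := isClosedPath_iff.1 h
        exact ⟨s, s, r, Or.inr ⟨rfl, h⟩, hc.left_mem, hc.left_mem, hr, Or.inl (by simp [ht])⟩
    · have hc := isClosedPath_iff.1 h
      obtain ⟨r, hr⟩ := hc.nonempty
      exact ⟨s, s, r, Or.inr ⟨rfl, h⟩, hc.left_mem, hc.left_mem, hr, Or.inr ⟨ht, rfl⟩⟩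
  choose s t r hst hs ht hr hterm_eq using key
  have hrinj : Function.Injective r := fun P Q h =>
    Subtype.ext (hD.eq_of_mem P.2 Q.2 (hr P) (h ▸ hr Q))
  have hleV : ∀ P : D, V(P.1.graph) ⊆ V(G) := fun P => (hD.le P.1 P.2).vertexSet_mono
  set V' : Set α := {x | x ∈ V(G) ∧ (x ∉ W ∨ ∃ Q : D, x = s Q ∧ Q.1.termini = ∅)} with hV'
  have hsV : ∀ P : D, s P ∈ V' := fun P => ⟨hleV P (hs P), by
    rcases hterm_eq P with h | ⟨h, -⟩
    · exact Or.inl (hterm P.1 P.2 _ (by simp [h]))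
    · exact Or.inr ⟨P, rfl, h⟩⟩
  have htV : ∀ P : D, t P ∈ V' := fun P => ⟨hleV P (ht P), by
    rcases hterm_eq P with h | ⟨h, h'⟩
    · exact Or.inl (hterm P.1 P.2 _ (by simp [h]))
    · exact Or.inr ⟨P, h'.symm, h⟩⟩
  let G' : Graph α β :=
    { vertexSet := V'
      IsLink := fun e x y => ∃ P : D, e = r P ∧ ((x = s P ∧ y = t P) ∨ (x = t P ∧ y = s P))
      isLink_symm := fun e _ => ⟨by
        rintro x y ⟨P, h, h'⟩
        exact ⟨P, h, h'.symm.imp And.symm And.symm⟩⟩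
      eq_or_eq_of_isLink_of_isLink := by
        rintro e x y v w ⟨P, rfl, h⟩ ⟨Q, hQ, h'⟩
        obtain rfl := hrinj hQ
        rcases h with ⟨rfl, -⟩ | ⟨rfl, -⟩ <;> rcases h' with ⟨rfl, rfl⟩ | ⟨rfl, rfl⟩ <;> simp
      left_mem_of_isLink := by
        rintro e x y ⟨P, -, ⟨rfl, -⟩ | ⟨rfl, -⟩⟩
        exacts [hsV P, htV P] }
  -- The value `G` off the range of `r` is a dummy: such names are not edges of `G'`.
  have hp : ∀ P : D, Function.extend r (fun P : D => P.1.graph) (fun _ => G) (r P) = P.1.graph :=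
    fun P => hrinj.extend_apply _ _ P
  have hE' : ∀ e', e' ∈ E(G') ↔ ∃ P : D, e' = r P := by
    intro e'
    constructor
    · rintro ⟨x, y, P, h, -⟩
      exact ⟨P, h⟩
    · rintro ⟨P, h⟩
      exact ⟨s P, t P, P, h, Or.inl ⟨rfl, rfl⟩⟩
  have hmemP : ∀ e ∈ E(G), ∃ P : D, e ∈ E(P.1.graph) := by
    intro e he
    rw [← hD.cover] at he
    simpa using he
  have hVP : ∀ P : D, V(P.1.graph) ∩ V' = {s P, t P} := by
    intro P
    ext z
    constructor
    · rintro ⟨hzP, hzG, hz⟩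
      by_cases hzW : z ∈ W
      · obtain ⟨Q, rfl, hQ⟩ := hz.resolve_left (not_not.2 hzW)
        have : P.1 = Q.1 := hD.eq_of_internal hT P.2 Q.2 (hint P.1 P.2 _ hzP hzW)
          ⟨hs Q, by simp [hQ]⟩
        rw [Subtype.ext this]
        simp
      · have hzt : z ∈ P.1.termini := by
          by_contra h
          exact hzW (hD.internal P.1 P.2 z ⟨hzP, h⟩).1
        rcases hterm_eq P with h | ⟨h, -⟩
        · exact h ▸ hzt
        · rw [h] at hzt
          exact absurd hzt (Set.notMem_empty z)
    · rintro (rfl | rfl)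
      exacts [⟨hs P, hsV P⟩, ⟨ht P, htV P⟩]
  have hsub : IsSubdivision G' G (Function.extend r (fun P : D => P.1.graph) (fun _ => G)) := by
    refine ⟨?_, ?_, ?_, ?_, ?_, ?_⟩
    · rintro e' x y ⟨P, rfl, ⟨rfl, rfl⟩ | ⟨rfl, rfl⟩⟩
      · rw [hp]
        exact ⟨hst P, ⟨_, hr P⟩, hVP P⟩
      · rw [hp]
        exact ⟨(hst P).symm, ⟨_, hr P⟩, by rw [Set.pair_comm]; exact hVP P⟩
    · intro e' he'
      obtain ⟨P, rfl⟩ := (hE' e').1 he'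
      rw [hp]
      exact hD.le P.1 P.2
    · intro e' he' f' hf' hne
      obtain ⟨P, rfl⟩ := (hE' e').1 he'
      obtain ⟨Q, rfl⟩ := (hE' f').1 hf'
      rw [hp, hp]
      rintro z ⟨hzP, hzQ⟩
      refine ⟨hleV P hzP, Or.inl fun hzW => hne ?_⟩
      rw [Subtype.ext (hD.eq_of_internal hT P.2 Q.2 (hint P.1 P.2 z hzP hzW)
        (hint Q.1 Q.2 z hzQ hzW))]
    · intro e' he' f' hf' hne
      obtain ⟨P, rfl⟩ := (hE' e').1 he'
      obtain ⟨Q, rfl⟩ := (hE' f').1 hf'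
      rw [hp, hp]
      exact hD.disjoint P.2 Q.2 fun h => hne (congrArg r (Subtype.ext h))
    · ext z
      constructor
      · intro hz
        by_cases hzW : z ∈ W
        · right
          have h2 : 0 < G.degIn E(G) z := by
            rw [← degree_eq_degIn hE, hzW.2]
            simp
          obtain ⟨e, he, hi⟩ := (degIn_pos_iff hE).1 h2
          obtain ⟨P, hP⟩ := hmemP e he
          refine Set.mem_iUnion₂.2 ⟨r P, (hE' _).2 ⟨P, rfl⟩, ?_⟩
          rw [hp]
          exact inc_mem_vertexSet_of_le (hD.le P.1 P.2) hP hi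
        · exact Or.inl ⟨hz, Or.inl hzW⟩
      · rintro (hz | hz)
        · exact hz.1
        · obtain ⟨e', he', hz⟩ := Set.mem_iUnion₂.1 hz
          obtain ⟨P, rfl⟩ := (hE' e').1 he'
          rw [hp] at hz
          exact hleV P hz
    · ext e
      constructor
      · intro he
        obtain ⟨P, hP⟩ := hmemP e he
        refine Set.mem_iUnion₂.2 ⟨r P, (hE' _).2 ⟨P, rfl⟩, ?_⟩
        rwa [hp]
      · intro he
        obtain ⟨e', he', he⟩ := Set.mem_iUnion₂.1 he
        obtain ⟨P, rfl⟩ := (hE' e').1 he'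
        rw [hp] at he
        exact IsSubgraph.edgeSet_mono (hD.le P.1 P.2) he
  refine ⟨G', _, hsub, fun x hx hd => ?_⟩
  rw [← hsub.degree_eq hE hx] at hd
  -- A divalent vertex is retained only as the chosen vertex of a circle, which has become a loop
  -- there.
  obtain ⟨Q, rfl, hQ⟩ := hx.2.resolve_left (not_not.2 ⟨hx.1, hd⟩)
  refine ⟨r Q, Q, rfl, Or.inl ⟨rfl, ?_⟩⟩
  rcases hterm_eq Q with h | ⟨-, h⟩
  · rw [h] at hQ
    exact absurd hQ (Set.insert_nonempty _ _).ne_empty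
  · exact h

end Graph

namespace SignedGraph

open Graph IsSubdivision

variable {α : Type u} {β γ : Type v} {S : SignedGraph α β} {e f : β} {e' f' : γ} {x : α}
  {X : Set β} {X' : Set γ} {G' : Graph α γ} {p : γ → Graph α β} {F' : Set γ}
  {D' : Set (PathOrCircle α γ)}

/-! ### From the local property to a subdivision -/

/-- At a vertex of degree three and negative degree two, an even set consists of negative edges. -/
lemma LocalProperty.mem_neg_of_isEvenSet (h : S.LocalProperty) (hE : E(S.graph).Finite)
    (h3 : S.graph.degree x = 3) (h2 : S.neg.degree x = 2) (hX : S.graph.IsEvenSet X) (he : e ∈ X)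
    (hi : S.graph.Inc e x) : e ∈ E(S.neg) := by
  by_contra hne
  have h1 : S.graph.degIn (X ∩ E(S.neg)) x = 2 := by
    rw [← h2, neg_degree hE]
    exact degIn_congr_set fun f hf => ⟨And.right, fun hfn =>
      ⟨h.mem_of_isEvenSet h2 hX he hi (neg_inc_iff.2 ⟨hf, hfn.2⟩), hfn⟩⟩
  -- The negative edges give `X` degree 2 at `x`; with `e` the degree would be exactly 3, which is
  -- odd.
  have h4 := degIn_diff (G := S.graph) (x := x) hX.finite
    (Set.inter_subset_left : X ∩ E(S.neg) ⊆ X)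
  have h5 : 0 < S.graph.degIn (X \ (X ∩ E(S.neg))) x :=
    (degIn_pos_iff (hX.finite.subset Set.sdiff_subset)).2 ⟨e, ⟨he, fun h => hne h.2⟩, hi⟩
  have h6 := degIn_mono (G := S.graph) (x := x) hE hX.subset
  rw [← degree_eq_degIn hE] at h6
  obtain ⟨k, hk⟩ := hX.even x
  omega

lemma exists_inc_path (hsub : IsSubdivision G' S.graph p) (hi : G'.Inc e' x) :
    ∃ e ∈ E(p e'), S.graph.Inc e x := by
  rw [← degIn_pos_iff (hsub.path_finite hi.edge_mem), hsub.degIn_path hi.edge_mem hi.vertex_mem]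
  exact hi.mult_pos

/-- At a vertex of negative degree two, a replacing path that has a negative edge there has only
negative edges there. -/
lemma LocalProperty.mem_neg_of_path (h : S.LocalProperty) (hE : E(S.graph).Finite)
    (hsub : IsSubdivision G' S.graph p) (hx : x ∈ V(G')) (h2 : S.neg.degree x = 2)
    (he' : e' ∈ E(G')) (he : e ∈ E(p e')) (hen : S.neg.Inc e x) (hf : f ∈ E(p e'))
    (hfi : S.graph.Inc f x) : f ∈ E(S.neg) := by
  have hfin := hsub.path_finite he'
  have hd := hsub.degIn_path he' hx
  have hei : S.graph.Inc e x := hen.mono neg_le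
  have hi := hsub.inc_of_inc he' hx he hei
  -- The path that replaces a loop is an even set, so its two edge ends at `x` are the two negative
  -- ones. Any other replacing path has a single edge at `x`.
  rcases hi.isLoopAt_or_isNonloopAt with hl | hl
  · have hcp : G'.CPath x {x} {e'} := ⟨e', x, ∅, hl, OPath.nil hx, by simp, by simp⟩
    have hev := hsub.isEvenSet_lift hcp.isEvenSet
    have hlift : lift p {e'} = E(p e') := by simp [lift]
    rw [hlift] at hev
    rw [mult_eq_two_iff.2 hl] at hd
    have h1 : S.graph.degIn (E(S.neg) ∩ E(p e')) x = 2 := by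
      rw [← h2, neg_degree hE]
      exact degIn_congr_set fun g hg => ⟨And.left, fun hgn =>
        ⟨hgn, h.mem_of_isEvenSet h2 hev he hei (neg_inc_iff.2 ⟨hg, hgn.2⟩)⟩⟩
    exact (mem_of_degIn_le hfin Set.inter_subset_right (by rw [h1, hd]) hf hfi).1
  · rw [mult_eq_one_iff.2 hl] at hd
    have hfe : f ∈ ({e} : Set β) := by
      refine mem_of_degIn_le hfin (Set.singleton_subset_iff.2 he) ?_ hf hfi
      rw [hd, degIn_singleton]
      exact hei.mult_pos
    rw [Set.mem_singleton_iff.1 hfe]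
    exact hen.edge_mem

/-- The edges of the initial graph whose replacing paths have negative edges. -/
def negPaths (S : SignedGraph α β) (G' : Graph α γ) (p : γ → Graph α β) : Set γ :=
  {e' | e' ∈ E(G') ∧ ∃ e ∈ E(p e'), e ∈ E(S.neg)}

/-- The vertices at which the elements of the partition are to be continued. -/
def through (S : SignedGraph α β) (G' : Graph α γ) (p : γ → Graph α β) : Set α :=
  {x | x ∈ V(G') ∧ ((S.graph.degree x = 3 ∧ S.neg.degree x = 2) ∨
    (S.graph.degree x = 2 ∧ ∃ e' ∈ S.negPaths G' p, G'.Inc e' x))}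

/-- The edges through which the elements of the partition are to be continued at `x`. -/
def transition (S : SignedGraph α β) (G' : Graph α γ) (p : γ → Graph α β) (x : α) : Set γ :=
  {e' | e' ∈ S.negPaths G' p ∧ G'.Inc e' x ∧
    (S.graph.degree x = 3 → ∃ e ∈ E(p e'), S.neg.Inc e x)}

/-- At a vertex of degree three and negative degree two, an even set uses only edges whose replacing
paths start with a negative edge. -/
lemma LocalProperty.mem_transition (h : S.LocalProperty) (hE : E(S.graph).Finite)
    (hsub : IsSubdivision G' S.graph p) (h3 : S.graph.degree x = 3) (h2 : S.neg.degree x = 2)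
    (hX : G'.IsEvenSet X') (he : e' ∈ X') (hi : G'.Inc e' x) : e' ∈ S.transition G' p x := by
  obtain ⟨e, hee', hei⟩ := exists_inc_path hsub hi
  have hmem : e ∈ lift p X' := (hsub.mem_lift hX.subset hi.edge_mem hee').2 he
  have hneg := h.mem_neg_of_isEvenSet hE h3 h2 (hsub.isEvenSet_lift hX) hmem hei
  exact ⟨⟨hi.edge_mem, e, hee', hneg⟩, hi, fun _ => ⟨e, hee', neg_inc_iff.2 ⟨hei, hneg.2⟩⟩⟩

/-- At degree 3 the prescribed edges lift to edge sets whose ends at `x` are the negative ones, two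
in number. At a divalent vertex the only edge is a loop, which counts twice. -/
lemma degIn_transition (h : S.LocalProperty) (hE : E(S.graph).Finite)
    (hsub : IsSubdivision G' S.graph p)
    (hdiv : ∀ x ∈ V(G'), G'.degree x = 2 → ∃ e', G'.IsLoopAt e' x)
    (hx : x ∈ S.through G' p) : G'.degIn (S.transition G' p x) x = 2 := by
  have hE' := hsub.edge_finite hE
  have hsubT : S.transition G' p x ⊆ E(G') := fun e' he' => he'.1.1
  obtain ⟨hxV, ⟨h3, h2⟩ | ⟨h2, f', hf', hfi⟩⟩ := hx
  · rw [← hsub.degIn_lift hsubT (hE'.subset hsubT) hxV, ← h2, neg_degree hE]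
    refine degIn_congr_set fun e hi => ?_
    obtain ⟨e', he', hee'⟩ := hsub.exists_mem hi.edge_mem
    rw [hsub.mem_lift hsubT he' hee']
    constructor
    · rintro ⟨-, -, hneg⟩
      obtain ⟨g, hg, hgn⟩ := hneg h3
      exact h.mem_neg_of_path hE hsub hxV h2 he' hg hgn hee' hi
    · intro hen
      exact ⟨⟨he', e, hee', hen⟩, hsub.inc_of_inc he' hxV hee' hi,
        fun _ => ⟨e, hee', neg_inc_iff.2 ⟨hi, hen.2⟩⟩⟩
  · rw [hsub.degree_eq hE hxV] at h2
    obtain ⟨l, hl⟩ := hdiv x hxV h2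
    have hall : ∀ e', G'.Inc e' x → e' = l := by
      intro e' hi
      refine mem_of_degIn_le (X := {l}) hE' (Set.singleton_subset_iff.2 hl.edge_mem) ?_
        hi.edge_mem hi
      rw [← degree_eq_degIn hE', h2, degIn_singleton, mult_eq_two_iff.2 hl]
    rw [← mult_eq_two_iff.2 hl, ← degIn_singleton]
    refine degIn_congr_set fun e' hi => ?_
    rw [hall e' hi, ← hall f' hfi]
    refine ⟨fun _ => rfl, fun _ => ⟨hf', hfi, fun h3 => ?_⟩⟩
    rw [hsub.degree_eq hE hxV] at h3
    omega

/-- An unprescribed edge of `F'` at a vertex to be passed can occur only at degree 3, and then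
`mem_transition` keeps it out of all even sets. -/
lemma LocalProperty.exists_partition (h : S.LocalProperty) (hV : V(S.graph).Finite)
    (hE : E(S.graph).Finite) (hsub : IsSubdivision G' S.graph p)
    (hdiv : ∀ x ∈ V(G'), G'.degree x = 2 → ∃ e', G'.IsLoopAt e' x) :
    ∃ D, (G'.restrict (S.negPaths G' p)).IsDecomposition (S.through G' p) (S.transition G' p) D ∧
      (G'.restrict (S.negPaths G' p)).IsTransition (S.through G' p) (S.transition G' p) := by
  have hsubT : ∀ x, S.transition G' p x ⊆ E(G'.restrict (S.negPaths G' p)) :=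
    fun x e' he' => ⟨he'.1.1, he'.1⟩
  have hT : (G'.restrict (S.negPaths G' p)).IsTransition (S.through G' p)
      (S.transition G' p) := by
    refine ⟨fun w _ e' he' => restrict_inc.2 ⟨he'.2.1, he'.1⟩, fun w hw => ?_,
      fun w hw c hci hcT X hX hcX => ?_⟩
    · rw [degIn_congr restrict_le (hsubT w)]
      exact degIn_transition h hE hsub hdiv hw
    · rw [restrict_inc] at hci
      rcases hw.2 with ⟨h3, h2⟩ | ⟨h2, -⟩
      · exact hcT (h.mem_transition hE hsub h3 h2 (hX.mono restrict_le) hcX hci.1)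
      · exact hcT ⟨hci.2, hci.1, fun h3 => by omega⟩
  obtain ⟨D, hD⟩ := hT.exists_isDecomposition
    (hV.subset fun x hx => hsub.vertexSet_subset hx.1)
  exact ⟨D, hD, hT⟩

/-- An open path of the partition lies in a nontrivial block or consists of isthmi. -/
lemma LocalProperty.block_or_isthmi (h : S.LocalProperty) (hV : V(S.graph).Finite)
    (hE : E(S.graph).Finite) (hsub : IsSubdivision G' S.graph p)
    {D : Set (PathOrCircle α γ)} {P : PathOrCircle α γ}
    (hD : (G'.restrict (S.negPaths G' p)).IsDecomposition (S.through G' p) (S.transition G' p) D)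
    (hP : P ∈ D) :
    (∃ B, G'.IsNontrivialBlock B ∧ P.graph ≤ B) ∨ ∀ e' ∈ E(P.graph), G'.IsIsthmus e' := by
  have hE' := hsub.edge_finite hE
  have hV' := hV.subset hsub.vertexSet_subset
  have hle : P.graph ≤ G' := (hD.le P hP).trans restrict_le
  by_cases hall : ∀ e' ∈ E(P.graph), G'.IsIsthmus e'
  · exact Or.inr hall
  left
  push Not at hall
  obtain ⟨e', he', hne⟩ := hall
  obtain ⟨X, hX, heX⟩ := exists_isEvenSet_of_not_isIsthmus (IsSubgraph.edgeSet_mono hle he') hne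
  obtain ⟨C, hC, hcirc, heC, -⟩ := hX.exists_isCircle heX
  have hCev := hcirc.isEvenSet hC
  have hEC : E(P.graph) ⊆ E(C) := by
    intro f' hf'
    refine PathOrCircle.propagate (Q := fun e => e ∈ E(C)) (hD.path_or_circle' hP) hle
      (fun x hx a ha b hb hai hbi haC => ?_) e' he' f' hf' heC
    obtain ⟨hxW, hxT⟩ := hD.internal P hP x hx
    have hTa := hxT a ha ((IsSubgraph.inc_congr restrict_le
      (IsSubgraph.edgeSet_mono (hD.le P hP) ha)).2 hai)
    have hTb := hxT b hb ((IsSubgraph.inc_congr restrict_le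
      (IsSubgraph.edgeSet_mono (hD.le P hP) hb)).2 hbi)
    rcases hxW.2 with ⟨h3, h2⟩ | ⟨h2, -⟩
    · obtain ⟨g₁, hg₁, hgn₁⟩ := hTa.2.2 h3
      obtain ⟨g₂, hg₂, hgn₂⟩ := hTb.2.2 h3
      have h1 := h.mem_of_isEvenSet h2 (hsub.isEvenSet_lift hCev)
        ((hsub.mem_lift hCev.subset hai.edge_mem hg₁).2 haC) (hgn₁.mono neg_le) hgn₂
      exact (hsub.mem_lift hCev.subset hbi.edge_mem hg₂).1 h1
    · refine hCev.mem_of_degIn hE' hCev.subset ?_ haC hai hbi.edge_mem hbi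
      rw [← degree_eq_degIn hE', ← hsub.degree_eq hE hxW.1, h2]
  have hVC : V(P.graph) ⊆ V(C) := by
    intro x hx
    obtain ⟨f', hf', hfi⟩ := PathOrCircle.exists_inc (hD.path_or_circle P hP) hx
    exact inc_mem_vertexSet_of_le hC (hEC hf') (hfi.mono hle)
  obtain ⟨B, hB, hCB⟩ := hcirc.exists_isNontrivialBlock hV' hE' hC
  exact ⟨B, hB, ((Compatible.of_le_le hle hC).le_iff.2 ⟨hVC, hEC⟩).trans hCB⟩

/-- Choosing `F'` as the set of edges whose paths are not all positive settles the positivity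
conditions. The rest follows from where the decomposition passes and where it stops. -/
theorem LocalProperty.exists_arisesBySubdivision (h : S.LocalProperty) (hV : V(S.graph).Finite)
    (hE : E(S.graph).Finite) (hsub : IsSubdivision G' S.graph p)
    (hdiv : ∀ x ∈ V(G'), G'.degree x = 2 → ∃ e', G'.IsLoopAt e' x) :
    ∃ D, S.ArisesBySubdivision G' (S.negPaths G' p) D p := by
  obtain ⟨D, hD, hT⟩ := h.exists_partition hV hE hsub hdiv
  have hle : ∀ P ∈ D, P.graph ≤ G' := fun P hP => (hD.le P hP).trans restrict_le
  have hEP : ∀ P ∈ D, E(P.graph) ⊆ S.negPaths G' p := fun P hP e' he' =>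
    (IsSubgraph.edgeSet_mono (hD.le P hP) he').2
  have hinc : ∀ P ∈ D, ∀ e' ∈ E(P.graph), ∀ x, G'.Inc e' x →
      (G'.restrict (S.negPaths G' p)).Inc e' x := fun P hP e' he' x hi =>
    restrict_inc.2 ⟨hi, hEP P hP he'⟩
  have hterm2 : ∀ P ∈ D, ∀ x ∈ P.termini, S.graph.degree x ≠ 2 := by
    intro P hP x hx hd
    have hxP := PathOrCircle.termini_subset (hD.path_or_circle' hP) hx
    obtain ⟨e', he', hi⟩ := PathOrCircle.exists_inc (hD.path_or_circle P hP) hxP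
    replace hi := hi.mono (hle P hP)
    exact hD.terminus P hP x hx ⟨hi.vertex_mem, Or.inr ⟨hd, e', hEP P hP he', hi⟩⟩ e' he'
      (hinc P hP e' he' x hi) ⟨hEP P hP he', hi, fun h3 => by omega⟩
  refine ⟨D, hdiv, fun e' he' => he'.1, ⟨hle, hD.path_or_circle, ?_, hD.disjoint, ?_, ?_, ?_, ?_⟩,
    hsub, ?_, ?_, ?_, ?_⟩
  · rw [hD.cover, edgeSet_restrict]
    exact Set.inter_eq_right.2 fun e' he' => he'.1
  · intro P hP x hx
    have hxW := (hD.internal P hP x hx).1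
    rw [← hsub.degree_eq hE hxW.1]
    have := hxW.2
    omega
  · intro P hP x hx h3 e' hi he'
    have hxW := (hD.internal P hP x hx).1
    rw [← hsub.degree_eq hE hxW.1] at h3
    rcases hxW.2 with ⟨-, h2⟩ | ⟨h2, -⟩
    · refine isIsthmus_iff.2 ⟨hi.edge_mem, fun X hX heX => he' ?_⟩
      exact hD.subset_of_internal hT hP hx (h.mem_transition hE hsub h3 h2 hX heX hi)
    · omega
  · intro P hP _
    exact h.block_or_isthmi hV hE hsub hD hP
  · intro P hP x hx hd
    have hxP := PathOrCircle.termini_subset (hD.path_or_circle' hP) hx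
    rw [← hsub.degree_eq hE ((hle P hP).vertexSet_mono hxP)] at hd
    exact hterm2 P hP x hx hd
  · intro e' he' heF e he
    refine (Int.units_eq_one_or _).resolve_right fun hs => heF ⟨he', e, he, ?_, hs⟩
    exact hsub.edgeSet_subset he' he
  · intro P hP f' hf'
    obtain ⟨-, e, he, -, hs⟩ := hEP P hP hf'
    exact ⟨e, he, by rw [hs]; decide⟩
  · intro P hP x hx hd1 f' hf' e he hi
    -- A negative edge at a terminus whose degree is neither 1 nor 2 forces degree 3 and negative
    -- degree 2; the member would then have been continued through this edge.
    refine (Int.units_eq_one_or _).resolve_right fun hs => ?_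
    have hxP := PathOrCircle.termini_subset (hD.path_or_circle' hP) hx
    have hxV := (hle P hP).vertexSet_mono hxP
    have hf'E := IsSubgraph.edgeSet_mono (hle P hP) hf'
    have hneg : S.neg.Inc e x := neg_inc_iff.2 ⟨hi, hs⟩
    have hpos : 0 < S.neg.degree x := by
      rw [degree_eq_degIn (neg_finite hE), degIn_pos_iff (neg_finite hE)]
      exact ⟨e, hneg.edge_mem, hneg⟩
    have hxG := hsub.vertexSet_subset hxV
    have h3 := h.degree_le_three hxG hpos
    have h2 := hterm2 P hP x hx
    have hle' := neg_degree_le (x := x) hE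
    have h3' : S.graph.degree x = 3 := by omega
    have hd2 : S.neg.degree x = 2 := by
      have := (h x hxG).2.1 h3'
      omega
    have hfi := hsub.inc_of_inc hf'E hxV he hi
    exact hD.terminus P hP x hx ⟨hxV, Or.inl ⟨h3', hd2⟩⟩ f' hf' (hinc P hP f' hf' x hfi)
      ⟨hEP P hP hf', hfi, fun _ => ⟨e, he, hneg⟩⟩
  · intro P hP x hx h3 f' hf' e he hi
    have hf'E := IsSubgraph.edgeSet_mono (hle P hP) hf'
    -- New vertices have degree 2.
    have hxV : x ∈ V(G') := by
      by_contra hxV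
      have := hsub.degree_of_notMem hE hi.vertex_mem hxV
      omega
    have hfi := hsub.inc_of_inc hf'E hxV he hi
    have hxP := inc_mem_vertexSet_of_le (hle P hP) hf' hfi
    obtain ⟨hxW, hxT⟩ := hD.internal P hP x ⟨hxP, hx⟩
    obtain ⟨g, hg, hgn⟩ := (hxT f' hf' (hinc P hP f' hf' x hfi)).2.2 h3
    have h2 : S.neg.degree x = 2 := by
      have := hxW.2
      omega
    exact (h.mem_neg_of_path hE hsub hxV h2 hf'E hg hgn he hi).2

theorem LocalProperty.constructionC (h : S.LocalProperty) (hV : V(S.graph).Finite)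
    (hE : E(S.graph).Finite) : S.ConstructionC := by
  obtain ⟨G', p, hsub, hdiv⟩ := exists_isSubdivision hV hE
  obtain ⟨D, hD⟩ := h.exists_arisesBySubdivision hV hE hsub hdiv
  exact ⟨β, ⟨G', fun e' => S.signOf (p e')⟩, _, D, p, hD, fun _ _ => rfl⟩

/-! ### From a subdivision to the local property -/

namespace ArisesBySubdivision

lemma exists_mem_partition (h : S.ArisesBySubdivision G' F' D' p) (hneg : S.neg.Inc e x) :
    ∃ P ∈ D', ∃ e' ∈ E(P.graph), e ∈ E(p e') := by
  have hi := neg_inc_iff.1 hneg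
  obtain ⟨e', he', hee'⟩ := h.subdivision.exists_mem hi.1.edge_mem
  have hF : e' ∈ F' := by
    by_contra hF
    have := h.positive e' he' hF e hee'
    rw [hi.2] at this
    exact absurd this (by decide)
  rw [← h.partition.cover] at hF
  obtain ⟨P, hP, heP⟩ := Set.mem_iUnion₂.1 hF
  exact ⟨P, hP, e', heP, hee'⟩

/-- At a vertex that is internal to an element of the partition and has degree three, the negative
edges are those of the derived path or circle. -/
lemma mem_neg_iff (h : S.ArisesBySubdivision G' F' D' p) (hE : E(S.graph).Finite)
    {P : PathOrCircle α γ} (hP : P ∈ D') (hx : x ∈ P.internal) (h3 : S.graph.degree x = 3)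
    (hi : S.graph.Inc e x) : e ∈ E(S.neg) ↔ e ∈ lift p E(P.graph) := by
  have hE' := h.subdivision.edge_finite hE
  have hpc : ∀ Q ∈ D', Q.IsPath ∨ Q.IsCircle := fun Q hQ =>
    (h.partition.path_or_circle Q hQ).imp And.left id
  have hxV : x ∈ V(G') := (h.partition.le P hP).vertexSet_mono hx.1
  constructor
  · intro he
    obtain ⟨Q, hQ, e', he', hee'⟩ := h.exists_mem_partition (neg_inc_iff.2 ⟨hi, he.2⟩)
    by_cases hPQ : P = Q
    · subst hPQ
      exact Set.mem_iUnion₂.2 ⟨e', he', hee'⟩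
    exfalso
    have hle := h.partition.le Q hQ
    have he'G := IsSubgraph.edgeSet_mono hle he'
    have hxQ := inc_mem_vertexSet_of_le hle he' (h.subdivision.inc_of_inc he'G hxV hee' hi)
    by_cases hxt : x ∈ Q.termini
    · have := h.terminal_edge Q hQ x hxt (by omega) e' he' e hee' hi
      rw [he.2] at this
      exact absurd this (by decide)
    · have h1 := PathOrCircle.degIn_internal (hpc P hP) (h.partition.le P hP) hx
      have h2 := PathOrCircle.degIn_internal (hpc Q hQ) hle ⟨hxQ, hxt⟩
      have h4 := degIn_mono (G := G') (x := x) hE'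
        (Set.union_subset (IsSubgraph.edgeSet_mono (h.partition.le P hP))
          (IsSubgraph.edgeSet_mono hle))
      rw [degIn_union (PathOrCircle.edge_finite (hpc P hP)) (PathOrCircle.edge_finite (hpc Q hQ))
        (h.partition.disjoint hP hQ hPQ), h1, h2, ← degree_eq_degIn hE',
        ← h.subdivision.degree_eq hE hxV] at h4
      omega
  · intro he
    obtain ⟨e', he', hee'⟩ := Set.mem_iUnion₂.1 he
    exact ⟨hi.edge_mem, h.internal_edge P hP x hx.2 h3 e' he' e hee' hi⟩

/-- At degree below 3 a circle through `x` uses all edges at `x`. Otherwise `x` is an old vertex. If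
it is internal to a member, it has degree 3, the derived path supplies the two negative ends, and
the third edge consists of isthmi, which circles avoid. If it is not, every member reaching it ends
there with a positive edge. -/
theorem localProperty (h : S.ArisesBySubdivision G' F' D' p) (hE : E(S.graph).Finite) :
    S.LocalProperty := by
  intro x hxG
  have hpc : ∀ Q ∈ D', Q.IsPath ∨ Q.IsCircle := fun Q hQ =>
    (h.partition.path_or_circle Q hQ).imp And.left id
  rcases Nat.lt_or_ge (S.graph.degree x) 3 with hlt | hge
  · refine ⟨fun h => by omega, fun h => by omega, fun hd C hC hcirc hxC e he => ?_⟩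
    refine mem_of_degIn_le hE (IsSubgraph.edgeSet_mono hC) ?_ (he.mono neg_le).edge_mem
      (he.mono neg_le)
    rw [← degree_eq_degIn hE, hcirc.degIn_of_mem hC hxC]
    omega
  have hxV : x ∈ V(G') := by
    by_contra hxV
    have := h.subdivision.degree_of_notMem hE hxG hxV
    omega
  by_cases hex : ∃ P ∈ D', x ∈ P.internal
  · obtain ⟨P, hP, hx⟩ := hex
    have hle := h.partition.le P hP
    have h3 : S.graph.degree x = 3 := by
      have := h.partition.internal_degree P hP x hx
      rw [← h.subdivision.degree_eq hE hxV] at this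
      omega
    have hPsub := IsSubgraph.edgeSet_mono hle
    have hd : S.neg.degree x = 2 := by
      rw [neg_degree hE, degIn_congr_set fun e hi => h.mem_neg_iff hE hP hx h3 hi,
        h.subdivision.degIn_lift hPsub (PathOrCircle.edge_finite (hpc P hP)) hxV]
      exact PathOrCircle.degIn_internal (hpc P hP) hle hx
    refine ⟨fun h => by omega, fun _ => Or.inr hd, fun _ C hC hcirc hxC e he => ?_⟩
    have hsub : ∀ g ∈ E(C), S.graph.Inc g x → g ∈ E(S.neg) := by
      intro g hg hgi
      rw [h.mem_neg_iff hE hP hx h3 hgi]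
      obtain ⟨e', he', hge'⟩ := h.subdivision.exists_mem hgi.edge_mem
      rw [h.subdivision.mem_lift hPsub he' hge']
      by_contra heP
      have hi := h.subdivision.inc_of_inc he' hxV hge' hgi
      have hist := h.partition.third_edge P hP x hx
        (by rw [← h.subdivision.degree_eq hE hxV, h3]) e' hi heP
      exact (h.subdivision.isIsthmus hE hist hge').notMem (hcirc.isEvenSet hC) hg
    have h1 : S.graph.degIn (E(C) ∩ E(S.neg)) x = S.graph.degIn E(C) x :=
      degIn_congr_set fun g hgi => ⟨And.left, fun hg => ⟨hg, hsub g hg hgi⟩⟩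
    refine (mem_of_degIn_le (neg_finite hE) Set.inter_subset_right ?_ he.edge_mem
      (he.mono neg_le)).1
    rw [h1, hcirc.degIn_of_mem hC hxC, ← neg_degree hE, hd]
  · have h0 : S.neg.degree x = 0 := by
      rw [neg_degree hE, degIn_eq_zero_iff (neg_finite hE)]
      intro e he hi
      obtain ⟨P, hP, e', he', hee'⟩ := h.exists_mem_partition (neg_inc_iff.2 ⟨hi, he.2⟩)
      have hle := h.partition.le P hP
      have hxP := inc_mem_vertexSet_of_le hle he'
        (h.subdivision.inc_of_inc (IsSubgraph.edgeSet_mono hle he') hxV hee' hi)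
      by_cases hxt : x ∈ P.termini
      · have := h.terminal_edge P hP x hxt (by omega) e' he' e hee' hi
        rw [he.2] at this
        exact absurd this (by decide)
      · exact hex ⟨P, hP, hxP, hxt⟩
    exact ⟨fun _ => h0, fun _ => Or.inl h0, fun h => by omega⟩

/-! ### Signs of the initial graph, balance, and the relation between Constructions B, C and D -/

lemma signOf_eq_one (h : S.ArisesBySubdivision G' F' D' p) (he' : e' ∈ E(G')) (heF : e' ∉ F') :
    S.signOf (p e') = 1 :=
  (finprod_mem_congr rfl fun e he => h.positive e' he' heF e he).trans (finprod_mem_one _)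

/-- The two ways of prescribing the signs of the initial graph agree. -/
lemma sign_eq_iff {S' : SignedGraph α γ} (h : S.ArisesBySubdivision S'.graph F' D' p) :
    (E(S'.neg) ⊆ F' ∧ ∀ P' ∈ D', ∀ f' ∈ E(P'.graph), S.signOf (p f') = S'.sign f') ↔
      ∀ e' ∈ E(S'.graph), S'.sign e' = S.signOf (p e') := by
  constructor
  · rintro ⟨h1, h2⟩ e' he'
    by_cases heF : e' ∈ F'
    · rw [← h.partition.cover] at heF
      obtain ⟨P, hP, heP⟩ := Set.mem_iUnion₂.1 heF
      exact (h2 P hP e' heP).symm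
    · rw [h.signOf_eq_one he' heF]
      exact (Int.units_eq_one_or _).resolve_right fun hs => heF (h1 ⟨he', hs⟩)
  · intro h1
    refine ⟨fun e' he' => ?_, fun P hP f' hf' =>
      (h1 f' (IsSubgraph.edgeSet_mono (h.partition.le P hP) hf')).symm⟩
    by_contra heF
    have := h1 e' he'.1
    rw [h.signOf_eq_one he'.1 heF, he'.2] at this
    exact absurd this (by decide)

lemma finprod_lift_sign {S' : SignedGraph α γ} (h : S.ArisesBySubdivision S'.graph F' D' p)
    (hs : ∀ e' ∈ E(S'.graph), S'.sign e' = S.signOf (p e')) (hX : S'.graph.IsEvenSet X') :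
    ∏ᶠ e ∈ lift p X', S.sign e = ∏ᶠ e' ∈ X', S'.sign e' := by
  rw [h.subdivision.finprod_lift _ hX.subset hX.finite]
  exact finprod_mem_congr rfl fun e' he' => (hs e' (hX.subset he')).symm

/-- The subdivided graph is balanced if and only if the nontrivial blocks of the initial graph
are. -/
lemma balanced_iff {S' : SignedGraph α γ} (h : S.ArisesBySubdivision S'.graph F' D' p)
    (hV : V(S.graph).Finite) (hE : E(S.graph).Finite)
    (hs : ∀ e' ∈ E(S'.graph), S'.sign e' = S.signOf (p e')) :
    S.Balanced ↔ ∀ B, S'.graph.IsNontrivialBlock B → (SignedGraph.mk B S'.sign).Balanced := by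
  constructor
  · intro hb B hB C hC hcirc
    have hX := hcirc.isEvenSet (hC.trans hB.1.le)
    exact (h.finprod_lift_sign hs hX).symm.trans
      (hb.finprod_eq_one (h.subdivision.isEvenSet_lift hX))
  · intro hb C hC hcirc
    obtain ⟨X', hX', hEC⟩ := h.subdivision.exists_isEvenSet hE (hcirc.isEvenSet hC)
    have hV' := hV.subset h.subdivision.vertexSet_subset
    rw [signOf, hEC, h.finprod_lift_sign hs hX']
    -- The initial even set need not be known to be a circle: it is split into circles, each inside
    -- a nontrivial block.
    refine hX'.finprod_eq_one _ fun C' hC' hcirc' _ => ?_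
    obtain ⟨B, hB, hCB⟩ :=
      hcirc'.exists_isNontrivialBlock hV' (h.subdivision.edge_finite hE) hC'
    exact hb B hB C' hCB hcirc'

end ArisesBySubdivision

lemma constructionB_iff : S.ConstructionB ↔ S.ConstructionC := by
  constructor
  · rintro ⟨γ, S', F', D', p, h, hs⟩
    exact ⟨γ, S', F', D', p, h, h.sign_eq_iff.1 hs⟩
  · rintro ⟨γ, S', F', D', p, h, hs⟩
    exact ⟨γ, S', F', D', p, h, h.sign_eq_iff.2 hs⟩

lemma constructionD_iff (hV : V(S.graph).Finite) (hE : E(S.graph).Finite) :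
    S.ConstructionD ↔ S.ConstructionC ∧ S.Balanced := by
  constructor
  · rintro ⟨γ, S', F', D', p, h, h1, h2, hb⟩
    have hs := h.sign_eq_iff.1 ⟨h1, h2⟩
    exact ⟨⟨γ, S', F', D', p, h, hs⟩, (h.balanced_iff hV hE hs).2 hb⟩
  · rintro ⟨⟨γ, S', F', D', p, h, hs⟩, hb⟩
    obtain ⟨h1, h2⟩ := h.sign_eq_iff.2 hs
    exact ⟨γ, S', F', D', p, h, h1, h2, (h.balanced_iff hV hE hs).1 hb⟩

theorem ConstructionC.localProperty (h : S.ConstructionC) (hE : E(S.graph).Finite) :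
    S.LocalProperty := by
  obtain ⟨γ, S', F', D', p, h, -⟩ := h
  exact h.localProperty hE

end SignedGraph

namespace SignedGraph

open Graph

variable {α : Type u} {β : Type v} {S : SignedGraph α β} {e f : β} {x y s t : α}
  {X ES : Set β} {VS : Set α} {C : Graph α β}

/-! ### The line graph: necessity -/

/-- In a consistent line graph, a path that is closed to a circle by one more vertex. -/
lemma LineConsistent.sign_mul_prod (h : S.LineConsistent) {a b e : E(S.graph)}
    (w : S.graph.lineGraph.Walk a b) (hw : w.IsPath) (hew : e ∉ w.support)
    (hea : S.graph.lineGraph.Adj e a) (hbe : S.graph.lineGraph.Adj b e) (hab : a ≠ b) :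
    S.sign e * (w.support.map fun e : E(S.graph) => S.sign e).prod = 1 := by
  have hcyc : (SimpleGraph.Walk.cons hbe (SimpleGraph.Walk.cons hea w)).IsCycle := by
    rw [SimpleGraph.Walk.cons_isCycle_iff, SimpleGraph.Walk.cons_isPath_iff]
    refine ⟨⟨hw, hew⟩, ?_⟩
    rw [SimpleGraph.Walk.edges_cons, List.mem_cons, not_or]
    refine ⟨fun hc => ?_, fun hc => hew (w.snd_mem_support_of_mem_edges hc)⟩
    rw [Sym2.eq_iff] at hc
    rcases hc with ⟨h1, -⟩ | ⟨h1, -⟩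
    · exact hbe.ne h1
    · exact hab h1.symm
  have := h _ _ hcyc
  simpa using this

lemma lineGraph_adj {a b : E(S.graph)} (hab : a.1 ≠ b.1) (ha : S.graph.Inc a x)
    (hb : S.graph.Inc b x) : S.graph.lineGraph.Adj a b :=
  ⟨fun h => hab (congrArg Subtype.val h), x, ha, hb⟩

/-- An open path yields a path in the line graph. -/
lemma exists_lineGraph_walk (hp : S.graph.OPath x y VS ES) (hne : ES.Nonempty) :
    ∃ (a b : E(S.graph)) (w : S.graph.lineGraph.Walk a b), w.IsPath ∧ S.graph.Inc a x ∧
      S.graph.Inc b y ∧ (∀ e, e ∈ w.support ↔ e.1 ∈ ES) ∧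
      (w.support.map fun e : E(S.graph) => S.sign e).prod = ∏ᶠ e ∈ ES, S.sign e := by
  induction hp with
  | nil => exact absurd hne Set.not_nonempty_empty
  | @cons e x y z V E hl hp hx ih =>
    have he : e ∉ E := fun he => hx (hp.inc_mem he hl.inc_left)
    rcases E.eq_empty_or_nonempty with rfl | hE
    · obtain rfl : y = z := by
        by_contra hyz
        obtain ⟨g, hg, -⟩ := hp.exists_inc_left hyz
        exact hg
      refine ⟨⟨e, hl.edge_mem⟩, ⟨e, hl.edge_mem⟩, .nil, by simp, hl.inc_left, hl.inc_right, ?_, ?_⟩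
      · intro f
        simp [Subtype.ext_iff]
      · simp
    · obtain ⟨a, b, w, hw, ha, hb, hsup, hprod⟩ := ih hE
      have haE : a.1 ∈ E := (hsup a).1 w.start_mem_support
      have hne : e ≠ a.1 := fun h => he (h ▸ haE)
      refine ⟨⟨e, hl.edge_mem⟩, b, .cons (lineGraph_adj hne hl.inc_right ha) w, ?_, hl.inc_left, hb,
        ?_, ?_⟩
      · rw [SimpleGraph.Walk.cons_isPath_iff]
        exact ⟨hw, fun h => he ((hsup _).1 h)⟩
      · intro f
        simp [Subtype.ext_iff, hsup]
      · rw [SimpleGraph.Walk.support_cons, List.map_cons, List.prod_cons, hprod,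
          finprod_mem_insert _ he hp.finite]

/-- A circle through `x`, opened at `x`. -/
lemma _root_.Graph.IsCircle.exists_oPath {G : Graph α β} (hcirc : C.IsCircle) (hC : C ≤ G)
    (hx : x ∈ V(C)) : ∃ e y VS ES, G.IsLink e x y ∧ G.OPath y x VS ES ∧ e ∉ ES ∧
      E(C) = insert e ES := by
  obtain ⟨e, he, hi⟩ := (hcirc.mem_vertexSet_iff hC).1 hx
  obtain ⟨y, hl⟩ := hi
  have hev := hcirc.isEvenSet hC
  obtain ⟨VS, ES, hp⟩ := (hev.joined he hl).symm.exists_oPath hl.right_mem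
  have hES : ES ⊆ E(C) \ {e} := hp.subset_edgeSet.trans (by simp [edgeSet_restrict])
  have heES : e ∉ ES := fun h => (hES h).2 rfl
  have hc : G.CPath x VS (insert e ES) :=
    ⟨e, y, ES, hl, hp.mono restrict_le, heES, rfl⟩
  exact ⟨e, y, VS, ES, hl, hp.mono restrict_le, heES, (hcirc.eq_of_subset hC hc.isEvenSet
    hc.nonempty (Set.insert_subset he (hES.trans Set.sdiff_subset))).symm⟩

/-- The path in the line graph that is obtained from a circle by opening it at a vertex. -/
lemma exists_lineGraph_walk_of_isCircle (hs : S.graph.Simple) (hcirc : C.IsCircle)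
    (hC : C ≤ S.graph) (hx : x ∈ V(C)) :
    ∃ (e a b : E(S.graph)) (w : S.graph.lineGraph.Walk a b), w.IsPath ∧ a ≠ b ∧
      S.graph.Inc e x ∧ S.graph.Inc b x ∧ e ∉ w.support ∧ S.graph.lineGraph.Adj e a ∧
      e.1 ∈ E(C) ∧ (∀ f, f ∈ w.support → f.1 ∈ E(C)) ∧
      S.signOf C = S.sign e * (w.support.map fun e : E(S.graph) => S.sign e).prod := by
  obtain ⟨e, y, VS, ES, hl, hp, he, hEC⟩ := hcirc.exists_oPath hC hx
  have hyx : y ≠ x := hl.ne.symm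
  obtain ⟨g, hg, -⟩ := hp.exists_inc_left hyx
  obtain ⟨a, b, w, hw, ha, hb, hsup, hprod⟩ := exists_lineGraph_walk hp ⟨g, hg⟩
  have haE : a.1 ∈ ES := (hsup a).1 w.start_mem_support
  have hea : e ≠ a.1 := fun h => he (h ▸ haE)
  refine ⟨⟨e, hl.edge_mem⟩, a, b, w, hw, ?_, hl.inc_left, hb, fun h => he ((hsup _).1 h),
    lineGraph_adj hea hl.inc_right ha, hEC ▸ Set.mem_insert _ _,
    fun f hf => hEC ▸ Or.inr ((hsup f).1 hf), ?_⟩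
  -- If `a = b`, this edge joins `x` and `y` and is parallel to `e`, contrary to simplicity.
  · rintro rfl
    refine hea ?_
    have : S.graph.IsLink a.1 x y := by
      obtain ⟨z, hz⟩ := hb
      rcases ha.eq_or_eq_of_isLink hz with rfl | rfl
      · exact absurd rfl hyx
      · exact hz
    exact hl.eq this
  · rw [hprod, signOf, hEC, finprod_mem_insert _ he hp.finite]

lemma LineConsistent.balanced (h : S.LineConsistent) (hs : S.graph.Simple) : S.Balanced := by
  intro C hC hcirc
  obtain ⟨x, hx⟩ := hcirc.isConnected.1
  obtain ⟨e, a, b, w, hw, hab, hex, hbx, hew, hea, -, -, hsign⟩ :=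
    exists_lineGraph_walk_of_isCircle hs hcirc hC hx
  rw [hsign]
  refine h.sign_mul_prod w hw hew hea (lineGraph_adj ?_ hbx hex) hab
  exact fun hbe => hew (Subtype.ext hbe ▸ w.end_mem_support)

/-- Three edges at a vertex form a triangle of the line graph. -/
lemma LineConsistent.sign_triangle (h : S.LineConsistent) {a b c : β} (ha : S.graph.Inc a x)
    (hb : S.graph.Inc b x) (hc : S.graph.Inc c x) (hab : a ≠ b) (hac : a ≠ c) (hbc : b ≠ c) :
    S.sign a * S.sign b * S.sign c = 1 := by
  have hadj : S.graph.lineGraph.Adj ⟨a, ha.edge_mem⟩ ⟨b, hb.edge_mem⟩ := lineGraph_adj hab ha hb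
  have := h.sign_mul_prod (e := ⟨c, hc.edge_mem⟩) (.cons hadj .nil)
    (by simpa using hab) (by simp [hac.symm, hbc.symm])
    (lineGraph_adj hac.symm hc ha) (lineGraph_adj hbc hb hc)
    (fun h => hab (congrArg Subtype.val h))
  simp only [SimpleGraph.Walk.support_cons, SimpleGraph.Walk.support_nil, List.map_cons,
    List.map_nil, List.prod_cons, List.prod_nil, mul_one] at this
  rw [← this]
  ac_rfl

/-- The number of negative edges at a vertex of degree three. -/
lemma neg_degree_of_degree_eq_three (hs : S.graph.Simple) (hE : E(S.graph).Finite) {a b c : β}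
    (ha : S.graph.Inc a x) (hb : S.graph.Inc b x) (hc : S.graph.Inc c x) (hab : a ≠ b)
    (hac : a ≠ c) (hbc : b ≠ c) (h3 : S.graph.degree x = 3) :
    S.neg.degree x = (if S.sign a = -1 then 1 else 0) + ((if S.sign b = -1 then 1 else 0) +
      if S.sign c = -1 then 1 else 0) := by
  have hone : ∀ e, S.graph.Inc e x → S.graph.mult e x = 1 := fun e hi =>
    mult_eq_one_iff.2 hi.isNonloopAt
  have habc : a ∉ ({b, c} : Set β) := by simp [hab, hac]
  have hall : ∀ e, S.graph.Inc e x → e ∈ ({a, b, c} : Set β) := by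
    intro e hi
    refine mem_of_degIn_le hE ?_ ?_ hi.edge_mem hi
    · rintro e (rfl | rfl | rfl)
      exacts [ha.edge_mem, hb.edge_mem, hc.edge_mem]
    · rw [← degree_eq_degIn hE, h3, degIn_insert (by simp) habc, degIn_pair hbc, hone a ha,
        hone b hb, hone c hc]
  have h1 : S.neg.degree x = ∑ᶠ e ∈ ({a, b, c} : Set β), if S.sign e = -1 then 1 else 0 := by
    rw [neg_degree hE, degIn]
    refine finsum_congr fun e => ?_
    by_cases hi : S.graph.Inc e x
    · by_cases hn : S.sign e = -1
      · simp [hall e hi, hone e hi, mem_neg, hi.edge_mem, hn]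
      · simp [mem_neg, hn]
    · have : e ∉ ({a, b, c} : Set β) := by
        rintro (rfl | rfl | rfl)
        exacts [hi ha, hi hb, hi hc]
      rw [mult_eq_zero_iff.2 hi]
      simp only [this, finsum_false]
      simp
  rw [h1, finsum_mem_insert _ habc (by simp), finsum_mem_pair hbc]

lemma ncard_setOf_inc (hs : S.graph.Simple) : {e | S.graph.Inc e x}.ncard = S.graph.degree x := by
  have h1 : {e | S.graph.IsLoopAt e x} = ∅ := by
    ext e
    simp
  have h2 : {e | S.graph.IsNonloopAt e x} = {e | S.graph.Inc e x} := by
    ext e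
    exact ⟨fun h => h.inc, fun h => h.isNonloopAt⟩
  rw [degree, h1, h2]
  simp

/-- Among four edges at a vertex all triples have product 1, so all four signs are equal, and hence
positive. At degree 3 a single triple allows no or two negative edges. -/
theorem LineConsistent.localProperty (h : S.LineConsistent) (hs : S.graph.Simple)
    (hE : E(S.graph).Finite) : S.LocalProperty := by
  have hfin : ∀ x, {e | S.graph.Inc e x}.Finite := fun x => hE.subset fun e he => he.edge_mem
  intro x hx
  refine ⟨fun hd => ?_, fun hd => ?_, fun hd C hC hcirc hxC e he => ?_⟩
  · rw [neg_degree hE, degIn_eq_zero_iff (neg_finite hE)]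
    intro a han ha
    have h1 : 2 < ({e | S.graph.Inc e x} \ {a}).ncard := by
      have := Set.ncard_sdiff_singleton_add_one (show a ∈ {e | S.graph.Inc e x} from ha) (hfin x)
      rw [ncard_setOf_inc hs] at this
      omega
    obtain ⟨b, c, d, hb, hc, hd, hbc, hbd, hcd⟩ :=
      (Set.two_lt_ncard_iff ((hfin x).subset Set.sdiff_subset)).1 h1
    have hab : a ≠ b := fun h => hb.2 h.symm
    have hac : a ≠ c := fun h => hc.2 h.symm
    have had : a ≠ d := fun h => hd.2 h.symm
    have t1 := h.sign_triangle ha hb.1 hc.1 hab hac hbc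
    have t2 := h.sign_triangle ha hb.1 hd.1 hab had hbd
    have t3 := h.sign_triangle ha hc.1 hd.1 hac had hcd
    have t4 := h.sign_triangle hb.1 hc.1 hd.1 hbc hbd hcd
    rw [han.2] at t1 t2 t3
    rcases Int.units_eq_one_or (S.sign b) with h1 | h1 <;>
      rcases Int.units_eq_one_or (S.sign c) with h2 | h2 <;>
      rcases Int.units_eq_one_or (S.sign d) with h3 | h3 <;>
      rw [h1, h2] at t1 <;> rw [h1, h3] at t2 <;> rw [h2, h3] at t3 <;> rw [h1, h2, h3] at t4 <;>
      revert t1 t2 t3 t4 <;> decide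
  · obtain ⟨a, b, c, hab, hac, hbc, habc⟩ := Set.ncard_eq_three.1 ((ncard_setOf_inc hs).trans hd)
    have ha : S.graph.Inc a x := by
      have : a ∈ {e | S.graph.Inc e x} := by rw [habc]; simp
      exact this
    have hb : S.graph.Inc b x := by
      have : b ∈ {e | S.graph.Inc e x} := by rw [habc]; simp
      exact this
    have hc : S.graph.Inc c x := by
      have : c ∈ {e | S.graph.Inc e x} := by rw [habc]; simp
      exact this
    have t := h.sign_triangle ha hb hc hab hac hbc
    rw [neg_degree_of_degree_eq_three hs hE ha hb hc hab hac hbc hd]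
    rcases Int.units_eq_one_or (S.sign a) with h1 | h1 <;>
      rcases Int.units_eq_one_or (S.sign b) with h2 | h2 <;>
      rcases Int.units_eq_one_or (S.sign c) with h3 | h3 <;>
      rw [h1, h2, h3] at t ⊢ <;> revert t <;> decide
  -- Inserting `e` between the two consecutive edges of `C` at `x` gives a cycle of the line graph
  -- whose product is that of `C` times `-1`.
  · by_contra heC
    have hi := neg_inc_iff.1 he
    obtain ⟨g, a, b, w, hw, hab, hgx, hbx, hgw, hga, hgC, hwC, hsign⟩ :=
      exists_lineGraph_walk_of_isCircle hs hcirc hC hxC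
    rw [h.balanced hs C hC hcirc] at hsign
    have hbC := hwC b w.end_mem_support
    have heg : e ≠ g.1 := fun h => heC (h ▸ hgC)
    have heb : e ≠ b.1 := fun h => heC (h ▸ hbC)
    have hgb : g ≠ b := fun h => hgw (h ▸ w.end_mem_support)
    have := h.sign_mul_prod (e := ⟨e, hi.1.edge_mem⟩) (.cons hga w)
      (by rw [SimpleGraph.Walk.cons_isPath_iff]; exact ⟨hw, hgw⟩) (by
        rw [SimpleGraph.Walk.support_cons, List.mem_cons, not_or]
        exact ⟨fun h => heg (congrArg Subtype.val h), fun h => heC (hwC _ h)⟩)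
      (lineGraph_adj heg hi.1 hgx) (lineGraph_adj heb.symm hbx hi.1) hgb
    rw [SimpleGraph.Walk.support_cons, List.map_cons, List.prod_cons, ← hsign, hi.2] at this
    exact absurd this (by decide)

end SignedGraph

namespace SignedGraph

open Graph

variable {α : Type u} {β : Type v} {S : SignedGraph α β} {e f : β} {x y s t : α}
  {X : Set β}

/-! ### The line graph: sufficiency -/

open Classical in
/-- In a cyclic sequence of edges, those that link the two consecutive common vertices form an
even set. -/
lemma isEvenSet_of_cyclic {k : ℕ} [NeZero k] {a : ZMod k → β} {v : ZMod k → α}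
    (ha : Function.Injective a) (h0 : ∀ i, S.graph.Inc (a i) (v i))
    (h1 : ∀ i, S.graph.Inc (a (i + 1)) (v i)) :
    S.graph.IsEvenSet (a '' {i | v (i - 1) ≠ v i}) where
  subset := by
    rintro _ ⟨i, -, rfl⟩
    exact (h0 i).edge_mem
  finite := Set.toFinite _
  even z := by
    have hl : ∀ i, S.graph.Inc (a i) (v (i - 1)) := fun i => by simpa using h1 (i - 1)
    have hm : ∀ i, v (i - 1) ≠ v i → S.graph.mult (a i) z =
        (if z = v (i - 1) then 1 else 0) + if z = v i then 1 else 0 := by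
      intro i hi
      obtain ⟨w, hw⟩ := hl i
      rcases (h0 i).eq_or_eq_of_isLink hw with h | h
      · exact absurd h.symm hi
      · rw [h, hw.mult_eq]
    set g : ZMod k → ℕ := fun i => (if z = v (i - 1) then 1 else 0) + if z = v i then 1 else 0
      with hg
    -- Over the full cyclic sequence every `v i` is counted twice, once from each side. An index
    -- with `v (i - 1) = v i` contributes 0 or 2 and can be left out.
    have hall : Even (∑ i, g i) := by
      rw [hg, Finset.sum_add_distrib]
      exact ⟨_, congrArg (· + _) <|
        (Equiv.subRight (1 : ZMod k)).sum_comp fun i => if z = v i then 1 else 0⟩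
    have hdeg : S.graph.degIn (a '' {i | v (i - 1) ≠ v i}) z =
        ∑ i with v (i - 1) ≠ v i, g i := by
      rw [degIn, finsum_mem_image ha.injOn, ← finsum_mem_coe_finset]
      refine finsum_mem_congr (by simp) fun i hi => hm i (by simpa using hi)
    have hrest : Even (∑ i with ¬ v (i - 1) ≠ v i, g i) := by
      refine Finset.even_sum _ fun i hi => ?_
      have : v (i - 1) = v i := by simpa using hi
      simp only [hg, this]
      exact ⟨_, rfl⟩
    rw [← Finset.sum_filter_add_sum_filter_not _ fun i => v (i - 1) ≠ v i] at hall
    rw [hdeg]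
    exact (Nat.even_add.1 hall).2 hrest

lemma mem_zmod_three : ∀ i j : ZMod 3, j = i - 1 ∨ j = i ∨ j = i + 1 := by decide

open Classical in
/-- Around a cycle of the line graph the product of the signs is positive. -/
lemma LocalProperty.prod_cyclic (h : S.LocalProperty) (hb : S.Balanced) (hs : S.graph.Simple)
    (hE : E(S.graph).Finite) {k : ℕ} [NeZero k] (hk : 3 ≤ k) {a : ZMod k → β} {v : ZMod k → α}
    (ha : Function.Injective a) (h0 : ∀ i, S.graph.Inc (a i) (v i))
    (h1 : ∀ i, S.graph.Inc (a (i + 1)) (v i)) : ∏ i, S.sign (a i) = 1 := by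
  have hX := isEvenSet_of_cyclic ha h0 h1
  have hprod : ∏ i with v (i - 1) ≠ v i, S.sign (a i) = 1 := by
    rw [← hb.finprod_eq_one hX, finprod_mem_image ha.injOn, ← finprod_mem_coe_finset]
    exact finprod_mem_congr (by simp) fun i _ => rfl
  -- If all edges at which the vertex stays the same are positive, the product is that over the even
  -- set.
  by_cases hone : ∀ i, v (i - 1) = v i → S.sign (a i) = 1
  · rw [← hprod, Finset.prod_filter]
    refine Finset.prod_congr rfl fun i _ => ?_
    split_ifs with hi
    · rfl
    · exact hone i (not_not.1 hi)
  push Not at hone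
  obtain ⟨i, hi, hsi⟩ := hone
  replace hsi : S.sign (a i) = -1 := (Int.units_eq_one_or _).resolve_left hsi
  have hcast : ∀ m : ℕ, 0 < m → m < k → (m : ZMod k) ≠ 0 := fun m hm hmk hc =>
    absurd (Nat.le_of_dvd hm ((ZMod.natCast_eq_zero_iff m k).1 hc)) (by omega)
  have one_ne : (1 : ZMod k) ≠ 0 := by simpa using hcast 1 (by omega) (by omega)
  have two_ne : (2 : ZMod k) ≠ 0 := by simpa using hcast 2 (by omega) (by omega)
  -- Three consecutive edges meet at `v i`, and they are distinct since `k ≥ 3`. With `a i`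
  -- negative, Property 2 gives degree 3 and negative degree 2.
  have hp : S.graph.Inc (a (i - 1)) (v i) := hi ▸ h0 (i - 1)
  have hq := h0 i
  have hr := h1 i
  have hpq : a (i - 1) ≠ a i := fun hc => one_ne (by simpa using ha hc)
  have hqr : a i ≠ a (i + 1) := fun hc => one_ne (by simpa using ha hc)
  have hpr : a (i - 1) ≠ a (i + 1) := fun hc => two_ne (by linear_combination -(ha hc))
  have hneg : S.neg.Inc (a i) (v i) := neg_inc_iff.2 ⟨hq, hsi⟩
  have hpos : 0 < S.neg.degree (v i) := by
    rw [neg_degree hE, degIn_pos_iff (neg_finite hE)]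
    exact ⟨a i, mem_neg.2 ⟨hq.edge_mem, hsi⟩, hq⟩
  have hone' : ∀ e, S.graph.Inc e (v i) → S.graph.mult e (v i) = 1 := fun e hi =>
    mult_eq_one_iff.2 hi.isNonloopAt
  have hsub : ({a (i - 1), a i, a (i + 1)} : Set β) ⊆ E(S.graph) := by
    rintro e (rfl | rfl | rfl)
    exacts [hp.edge_mem, hq.edge_mem, hr.edge_mem]
  have hthree : S.graph.degIn {a (i - 1), a i, a (i + 1)} (v i) = 3 := by
    rw [degIn_insert (by simp) (by simp [hpq, hpr]), degIn_pair hqr, hone' _ hp, hone' _ hq,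
      hone' _ hr]
  have h3 : S.graph.degree (v i) = 3 := by
    refine le_antisymm (h.degree_le_three hq.vertex_mem hpos) ?_
    rw [← hthree, degree_eq_degIn hE]
    exact degIn_mono hE hsub
  have h2 : S.neg.degree (v i) = 2 := ((h _ hq.vertex_mem).2.1 h3).resolve_left hpos.ne'
  -- An edge of the even set at `v i` would bring the negative edge `a i` into the even set, but `a
  -- i` is not in it. So the sequence cannot leave `v i`.
  have hnot : ∀ j, S.graph.Inc (a j) (v i) → v (j - 1) = v j := by
    intro j hj
    by_contra hc
    obtain ⟨l, hl, hla⟩ := h.mem_of_isEvenSet h2 hX (Set.mem_image_of_mem a hc) hj hneg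
    exact hl (ha hla ▸ hi)
  have hvr : v (i + 1) = v i := by
    have := hnot _ hr
    rw [add_sub_cancel_right] at this
    exact this.symm
  have hw : S.graph.Inc (a (i + 1 + 1)) (v i) := hvr ▸ h1 (i + 1)
  have hmem : a (i + 1 + 1) ∈ ({a (i - 1), a i, a (i + 1)} : Set β) := by
    refine mem_of_degIn_le hE hsub ?_ hw.edge_mem hw
    rw [hthree, ← degree_eq_degIn hE, h3]
  -- The edge `a (i + 2)` is again one of the three edges at `v i`; by injectivity `k` divides 3, 2
  -- or 1.
  have hthree0 : (3 : ZMod k) = 0 := by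
    rcases hmem with hc | hc | hc
    · linear_combination ha hc
    · exact absurd (by linear_combination ha hc) two_ne
    · exact absurd (by linear_combination ha hc) one_ne
  obtain rfl : k = 3 := by
    have : k ∣ 3 := (ZMod.natCast_eq_zero_iff 3 k).1 (by exact_mod_cast hthree0)
    exact le_antisymm (Nat.le_of_dvd (by norm_num) this) hk
  have hd := neg_degree_of_degree_eq_three hs hE hp hq hr hpq hpr hqr h3
  rw [h2] at hd
  have hnmem : i - 1 ∉ ({i, i + 1} : Finset (ZMod 3)) := by
    rw [Finset.mem_insert, Finset.mem_singleton, not_or]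
    exact ⟨fun hc => hpq (congrArg a hc), fun hc => hpr (congrArg a hc)⟩
  have hprod3 : ∏ j, S.sign (a j) = S.sign (a (i - 1)) * (S.sign (a i) * S.sign (a (i + 1))) := by
    rw [← Finset.prod_pair (f := fun j => S.sign (a j)) fun hc => hqr (congrArg a hc),
      ← Finset.prod_insert (f := fun j => S.sign (a j)) hnmem]
    exact congrArg (Finset.prod · fun j => S.sign (a j)) (by ext j; simpa using mem_zmod_three i j)
  rw [hprod3]
  rcases Int.units_eq_one_or (S.sign (a (i - 1))) with t1 | t1 <;>
    rcases Int.units_eq_one_or (S.sign (a i)) with t2 | t2 <;>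
    rcases Int.units_eq_one_or (S.sign (a (i + 1))) with t3 | t3 <;>
    rw [t1, t2, t3] at hd ⊢ <;> revert hd <;> decide

/-- The vertices of the cycle are indexed by `ZMod k`, so that `i + 1` wraps around, and a common
end `v i` is chosen for each two consecutive edges. -/
theorem LocalProperty.lineConsistent (h : S.LocalProperty) (hb : S.Balanced)
    (hs : S.graph.Simple) (hE : E(S.graph).Finite) : S.LineConsistent := by
  classical
  intro x c hc
  have hk := hc.three_le_length
  set k := c.length with hkdef
  have : NeZero k := ⟨by omega⟩
  let a : ZMod k → E(S.graph) := fun i => c.getVert i.val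
  have hinj : Function.Injective a := by
    intro i j hij
    have hi := ZMod.val_lt i
    have hj := ZMod.val_lt j
    exact ZMod.val_injective k (hc.getVert_injOn' (by simp; omega) (by simp; omega) hij)
  have hadj : ∀ i, S.graph.lineGraph.Adj (a i) (a (i + 1)) := by
    intro i
    have hi := ZMod.val_lt i
    have := c.adj_getVert_succ (i := i.val) (by omega)
    suffices a (i + 1) = c.getVert (i.val + 1) by rw [this]; exact this ▸ c.adj_getVert_succ hi
    show c.getVert (i + 1).val = _
    rcases (show i.val + 1 ≤ k from hi).lt_or_eq with hlt | heq
    · have hone : (1 : ZMod k).val = 1 := ZMod.val_one'' (by omega)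
      rw [ZMod.val_add_of_lt (by omega), hone]
    · have h0 : i + 1 = 0 := by
        rw [← ZMod.natCast_zmod_val i]
        exact_mod_cast (ZMod.natCast_eq_zero_iff _ k).2 heq.symm.dvd
      rw [h0, heq, ZMod.val_zero, SimpleGraph.Walk.getVert_zero, hkdef,
        SimpleGraph.Walk.getVert_length]
  choose v h0 h1 using fun i => (hadj i).2
  have hprod := h.prod_cyclic hb hs hE hk (Subtype.val_injective.comp hinj) h0 h1
  rw [← List.prod_toFinset _ hc.support_nodup, ← hprod]
  have : c.support.tail.toFinset = Finset.univ.image a := by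
    ext f
    simp only [List.mem_toFinset, Finset.mem_image, Finset.mem_univ, true_and]
    have hmem : f ∈ c.support.tail ↔ f ∈ c.support := by
      refine ⟨List.mem_of_mem_tail, fun hf => ?_⟩
      rcases (SimpleGraph.Walk.mem_support_iff c).1 hf with rfl | hf
      · exact SimpleGraph.Walk.end_mem_tail_support hc.not_nil
      · exact hf
    rw [hmem]
    constructor
    · intro hf
      obtain ⟨n, rfl, hn⟩ := SimpleGraph.Walk.mem_support_iff_exists_getVert.1 hf
      rcases hn.lt_or_eq with hlt | heq
      · exact ⟨n, by simp only [a, ZMod.val_natCast_of_lt hlt]⟩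
      · refine ⟨0, ?_⟩
        rw [heq, SimpleGraph.Walk.getVert_length]
        simp [a]
    · rintro ⟨i, rfl⟩
      exact c.getVert_mem_support _
  rw [this, Finset.prod_image hinj.injOn]
  rfl

end SignedGraph
-- Assembly of the equivalences
theorem theoremT {α : Type u} {β : Type v} (S : SignedGraph α β)
    (hV : V(S.graph).Finite) (hE : E(S.graph).Finite) :
    [S.LocalProperty, S.ConstructionA, S.ConstructionB, S.ConstructionC].TFAE ∧
    (S.graph.Simple →
      [S.LineConsistent,
        S.ConstructionA ∧ S.Balanced,
        S.ConstructionB ∧ S.Balanced,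
        S.ConstructionC ∧ S.Balanced,
        S.ConstructionD].TFAE) := by
  have hA : S.LocalProperty ↔ S.ConstructionA :=
    ⟨fun h => h.constructionA hV hE, fun h => h.localProperty hV hE⟩
  have hC : S.LocalProperty ↔ S.ConstructionC :=
    ⟨fun h => h.constructionC hV hE, fun h => h.localProperty hE⟩
  have hB : S.ConstructionB ↔ S.ConstructionC := S.constructionB_iff
  refine ⟨?_, fun hs => ?_⟩
  · tfae_have 1 ↔ 2 := hA
    tfae_have 1 ↔ 4 := hC
    tfae_have 3 ↔ 4 := hB
    tfae_finish
  · have hL : S.LineConsistent ↔ S.LocalProperty ∧ S.Balanced :=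
      ⟨fun h => ⟨h.localProperty hs hE, h.balanced hs⟩, fun h => h.1.lineConsistent h.2 hs hE⟩
    tfae_have 1 ↔ 2 := by rw [hL, hA]
    tfae_have 1 ↔ 4 := by rw [hL, hC]
    tfae_have 3 ↔ 4 := by rw [hB]
    tfae_have 5 ↔ 4 := SignedGraph.constructionD_iff hV hE
    tfae_finish
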